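/- **Theorem.** A pattern $\alpha$ is a non-empty word over terminal letters and variables; it is *regular* if no variable occurs in it more than once. A substitution $h$ maps each variable of $\alpha$ to a (possibly empty) word over the terminal alphabet, and $h(\alpha)$ is the word obtained by replacing each variable $x$ in $\alpha$ by $h(x)$. For a word $w$ let $$d_{\mathtt{HAM}}(\alpha,w)=\min\{d_{\mathtt{HAM}}(h(\alpha),w)\mid h \text{ a substitution with } |h(\alpha)|=|w|\},$$ where $d_{\mathtt{HAM}}(u,v)$ denotes the number of positions on which the words $u,v$ of equal length differ. There is an algorithm on the unit-cost RAM with memory words of $O(\log n)$ bits (arithmetic, comparison and bitwise operations on memory words and indirect memory access take unit time) which solves the problem $\mathtt{MinMisMatch}_{\mathtt{Reg}}$ in $O(n\cdot\max\{1,\Phi\})$ time: given a word $w$ of length $n$ and a regular pattern $\alpha$ with $1\le|\alpha|\le n$, over an alphabet $\{1,\dots,\sigma\}$ of terminals with $\sigma\le n$ and with variables $x_1,\dots,x_n$ encoded as the integers $n+1,\dots,2n$, such that $|h(\alpha)|=n$ for at least one substitution $h$ (which always holds if $\alpha$ contains a variable), it computes $\Phi=d_{\mathtt{HAM}}(\alpha,w)$,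 within at most $C\cdot n\cdot\max\{1,\Phi\}$ steps for a constant $C$ that does not depend on $n$, $\sigma$, $w$ or $\alpha$. -/

import Mathlib

/-! ## Patterns with variables and Hamming distance -/

namespace PatternMatching

/-- A pattern over terminal letters in `A` and variables in `X` is a word over `A ⊕ X`
(`Sum.inl a` is the terminal `a`, `Sum.inr x` is the variable `x`). -/
abbrev Pattern (A X : Type) : Type := List (A ⊕ X)

/-- The word `h(α)`: every occurrence of a variable `x` is replaced by the (possibly empty)
word `h x`, terminals are unchanged. -/
def subst {A X : Type} (h : X → List A) (α : Pattern A X) : List A :=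
  α.flatMap (Sum.elim (fun a => [a]) h)

/-- The Hamming distance of two words of equal length: the number of positions on which they
differ. (It is only used for words of equal length.) -/
def hamming {A : Type} [DecidableEq A] (u v : List A) : ℕ :=
  (u.zip v).countP (fun p => p.1 ≠ p.2)

/-- A substitution `h` is admissible for `α` and `w` if `h(α)` has the length of `w`, so that
the Hamming distance of `h(α)` and `w` makes sense. -/
def Admissible {A X : Type} (α : Pattern A X) (w : List A) (h : X → List A) : Prop :=
  (subst h α).length = w.length

/-- The Hamming distance between a pattern and a word: the minimum of the Hamming distances of
`h(α)` and `w` over all admissible `h`. (The minimum exists as soon as there is an admissible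
substitution.) -/
noncomputable def patDist {A X : Type} [DecidableEq A] (α : Pattern A X) (w : List A) : ℕ :=
  sInf {d : ℕ | ∃ h : X → List A, Admissible α w h ∧ d = hamming (subst h α) w}

/-- A pattern is regular if no variable occurs in it more than once. -/
def IsRegular {A X : Type} [DecidableEq A] [DecidableEq X] (α : Pattern A X) : Prop :=
  ∀ x : X, α.count (Sum.inr x) ≤ 1

end PatternMatching

/-! ## The unit-cost RAM with words of logarithmic length

A machine has registers `0, 1, 2, …` and random-access arrays `0, 1, 2, …`; each register and each
array cell holds one memory word. A program is a finite text, so it names only finitely many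
registers and arrays (these arrays are interleaved parts of one random-access memory). Every
elementary step (reading a constant or a register, reading or writing an array cell at a computed
address, one arithmetic, bitwise or comparison operation on words, one assignment, one conditional
branch) costs one unit of time. -/

namespace WordRAM

/-- The operations on memory words. -/
inductive Op
  | add | sub | mul | div | mod | and | or | xor | shl | shr | lt | eq

/-- The effect of an operation on words of `W` bits; results are truncated to `W` bits,
subtraction is truncated at `0`, a comparison yields `1` (true) or `0` (false). -/
def Op.eval (W : ℕ) : Op → ℕ → ℕ → ℕ
  | .add, a, b => (a + b) % 2 ^ W
  | .sub, a, b => (a - b) % 2 ^ W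
  | .mul, a, b => (a * b) % 2 ^ W
  | .div, a, b => (a / b) % 2 ^ W
  | .mod, a, b => (a % b) % 2 ^ W
  | .and, a, b => (a &&& b) % 2 ^ W
  | .or, a, b => (a ||| b) % 2 ^ W
  | .xor, a, b => (a ^^^ b) % 2 ^ W
  | .shl, a, b => (a <<< b) % 2 ^ W
  | .shr, a, b => (a >>> b) % 2 ^ W
  | .lt, a, b => (if a < b then 1 else 0) % 2 ^ W
  | .eq, a, b => (if a = b then 1 else 0) % 2 ^ W

/-- Expressions: constants, registers, array cells at a computed address, operations. -/
inductive Expr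
  | const (k : ℕ)
  | reg (r : ℕ)
  | load (b : ℕ) (addr : Expr)
  | op (o : Op) (e₁ e₂ : Expr)

/-- Programs: built from assignments to registers and array cells by sequencing, branching and
loops. A test succeeds if its value is not `0`. -/
inductive Prog
  | skip
  | assign (r : ℕ) (e : Expr)
  | store (b : ℕ) (addr e : Expr)
  | seq (p q : Prog)
  | cond (e : Expr) (p q : Prog)
  | loop (e : Expr) (p : Prog)

/-- The contents of the registers and of the arrays. -/
structure State where
  reg : ℕ → ℕ
  mem : ℕ → ℕ → ℕ

/-- The value of an expression on a machine with words of `W` bits. -/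
def Expr.eval (W : ℕ) (s : State) : Expr → ℕ
  | .const k => k % 2 ^ W
  | .reg r => s.reg r
  | .load b addr => s.mem b (addr.eval W s)
  | .op o e₁ e₂ => o.eval W (e₁.eval W s) (e₂.eval W s)

/-- The time for evaluating an expression: the number of elementary steps in it. -/
def Expr.cost : Expr → ℕ
  | .const _ => 1
  | .reg _ => 1
  | .load _ addr => addr.cost + 1
  | .op _ e₁ e₂ => e₁.cost + e₂.cost + 1

/-- The state after writing `v` into register `r`. -/
def State.setReg (s : State) (r v : ℕ) : State :=
  { s with reg := Function.update s.reg r v }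

/-- The state after writing `v` into cell `i` of array `b`. -/
def State.setMem (s : State) (b i v : ℕ) : State :=
  { s with mem := Function.update s.mem b (Function.update (s.mem b) i v) }

/-- `Exec W p s t s'`: on a machine with words of `W` bits, the program `p` started in the state
`s` halts after exactly `t` elementary steps in the state `s'`. -/
inductive Exec (W : ℕ) : Prog → State → ℕ → State → Prop
  | skip (s : State) : Exec W .skip s 1 s
  | assign (s : State) (r : ℕ) (e : Expr) :
      Exec W (.assign r e) s (e.cost + 1) (s.setReg r (e.eval W s))
  | store (s : State) (b : ℕ) (addr e : Expr) :
      Exec W (.store b addr e) s (addr.cost + e.cost + 1)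
        (s.setMem b (addr.eval W s) (e.eval W s))
  | seq (p q : Prog) (s s₁ s₂ : State) (t₁ t₂ : ℕ) :
      Exec W p s t₁ s₁ → Exec W q s₁ t₂ s₂ → Exec W (.seq p q) s (t₁ + t₂) s₂
  | cond_true (e : Expr) (p q : Prog) (s s₁ : State) (t : ℕ) :
      e.eval W s ≠ 0 → Exec W p s t s₁ → Exec W (.cond e p q) s (e.cost + 1 + t) s₁
  | cond_false (e : Expr) (p q : Prog) (s s₁ : State) (t : ℕ) :
      e.eval W s = 0 → Exec W q s t s₁ → Exec W (.cond e p q) s (e.cost + 1 + t) s₁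
  | loop_stop (e : Expr) (p : Prog) (s : State) :
      e.eval W s = 0 → Exec W (.loop e p) s (e.cost + 1) s
  | loop_step (e : Expr) (p : Prog) (s s₁ s₂ : State) (t₁ t₂ : ℕ) :
      e.eval W s ≠ 0 → Exec W p s t₁ s₁ → Exec W (.loop e p) s₁ t₂ s₂ →
      Exec W (.loop e p) s (e.cost + 1 + t₁ + t₂) s₂

end WordRAM

/-! ## Instances as inputs of the machine -/

namespace PatternMatching

/-- The terminal letters are the integers `1, …, σ`. -/
def encodeLetter {σ : ℕ} (a : Fin σ) : ℕ := (a : ℕ) + 1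

/-- In a pattern, the terminals are the integers `1, …, σ` and the variables `x_1, …, x_n` are
the integers `n + 1, …, 2 n`. -/
def encodeSymbol {σ n : ℕ} : Fin σ ⊕ Fin n → ℕ
  | .inl a => encodeLetter a
  | .inr x => n + 1 + (x : ℕ)

/-- The initial state: `|w|`, `|α|` and `σ` are in the registers `0`, `1` and `2`, the word `w` is
in the array `0`, the pattern `α` is in the array `1`, everything else is `0`. -/
def inputState {σ n : ℕ} (w : List (Fin σ)) (α : Pattern (Fin σ) (Fin n)) : WordRAM.State where
  reg r := [w.length, α.length, σ].getD r 0
  mem b i :=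
    match b with
    | 0 => (w.map encodeLetter).getD i 0
    | 1 => (α.map encodeSymbol).getD i 0
    | _ => 0

/-- Words of logarithmic length: `c` times the binary length of the largest input symbol `2 n`. -/
def wordLength (c n : ℕ) : ℕ := c * Nat.size (2 * n)

end PatternMatching

set_option linter.unusedSimpArgs false

/-! ## Reasoning about programs -/

namespace WordRAM

/-! ### Expressions -/

/-! Fix a number d of mismatches and the prefix of length p of the word. Among all alignments of
pattern prefixes with this prefix of the word, only one has to be remembered: the largest position g
that directly follows a variable and is attainable with at most d mismatches (`IsTop`). The variable
in front of g can absorb further letters, so g remains attainable for every larger p, and whatever a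
smaller position leads to behind the next variable is attainable from g as well or already lies
behind. Hence the top position at p is the maximum of the one at p - 1 and of the positions
registered at p when runs of letters ended there; this is `LayerInv.isTop`, which rests on
`LayerInv.letters`.

Layer d determines the top positions for all p. From a top position the following run of letters is
compared with the word by a single query for a longest common extension. A run interrupted by a
mismatch waits and is resumed behind the mismatch in the next layer (`LayerInv.step_letter`,
`LayerInv.start_old`). If the top position at p differs from that of the previous layer, then it
costs exactly d mismatches (`LayerInv.start_new`), so its run belongs to the present layer. Each
position therefore causes at most one query per layer, a layer takes O(n) time, and the first layer
in which the whole pattern meets the whole word has the number Φ (`LayerInv.complete` for one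
direction, the field `found` for the other). This gives O(n (Φ + 1)) for the layers. That the
alignments of `Reach` are those of substitutions is `Encodes.reach_iff`; regularity enters there,
since the images of the variables can then be chosen independently.

The queries take constant time after a linear preprocessing of the word, a separator and the
pattern, joined into one word. The suffix array is found by the skew algorithm: the suffixes at
positions not divisible by 3 are sorted through a reduced word of triple ranks (`red_sufLt_iff`),
the others by two bucket passes (`thirds_sorted`), and both lists are merged
(`isSuffixArray_merge`). Kasai's algorithm (`kasai_step`) yields the common prefixes of neighbours,
and a longest common extension is a range minimum of them (`isLce_of_isMin`). Range minima use
blocks of logarithmic length: inside a block a bit mask of suffix minima decides (`IsMask.isMin`),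
and whole blocks are covered by a sparse table.

On the machine, loop-free programs are evaluated symbolically by rewriting with `Prog.den`, where
`omega` excludes overflow; loops are treated with an invariant and a potential that bounds the
remaining time (`Run.loop`); data that a program does not touch are carried along by `Exec.frame`.
-/

instance (k : ℕ) : OfNat Expr k := ⟨.const k⟩
instance : Add Expr := ⟨.op .add⟩
instance : Sub Expr := ⟨.op .sub⟩
instance : Mul Expr := ⟨.op .mul⟩
instance : Div Expr := ⟨.op .div⟩
instance : Mod Expr := ⟨.op .mod⟩

/-- Comparison `e₁ < e₂` as a word. -/
def lt (e₁ e₂ : Expr) : Expr := .op .lt e₁ e₂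
/-- Comparison `e₁ = e₂` as a word. -/
def eq (e₁ e₂ : Expr) : Expr := .op .eq e₁ e₂

@[simp] theorem lt_def (e₁ e₂ : Expr) : lt e₁ e₂ = .op .lt e₁ e₂ := rfl
@[simp] theorem eq_def (e₁ e₂ : Expr) : eq e₁ e₂ = .op .eq e₁ e₂ := rfl
@[simp] theorem Expr.ofNat_def (k : ℕ) : (OfNat.ofNat k : Expr) = .const k := rfl
@[simp] theorem Expr.zero_def : (0 : Expr) = .const 0 := rfl
@[simp] theorem Expr.one_def : (1 : Expr) = .const 1 := rfl
@[simp] theorem Expr.add_def (e₁ e₂ : Expr) : e₁ + e₂ = .op .add e₁ e₂ := rfl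
@[simp] theorem Expr.sub_def (e₁ e₂ : Expr) : e₁ - e₂ = .op .sub e₁ e₂ := rfl
@[simp] theorem Expr.mul_def (e₁ e₂ : Expr) : e₁ * e₂ = .op .mul e₁ e₂ := rfl
@[simp] theorem Expr.div_def (e₁ e₂ : Expr) : e₁ / e₂ = .op .div e₁ e₂ := rfl
@[simp] theorem Expr.mod_def (e₁ e₂ : Expr) : e₁ % e₂ = .op .mod e₁ e₂ := rfl

infixr:25 " ;; " => Prog.seq
infix:30 " ≔ " => Prog.assign

/-! ### Operations on words are exact as long as nothing overflows. -/

section Eval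
variable {W : ℕ}

@[simp] theorem Expr.eval_reg (s : State) (r : ℕ) : (Expr.reg r).eval W s = s.reg r := rfl
@[simp] theorem Expr.eval_load (s : State) (b : ℕ) (e : Expr) :
    (Expr.load b e).eval W s = s.mem b (e.eval W s) := rfl
@[simp] theorem Expr.eval_op (s : State) (o : Op) (e₁ e₂ : Expr) :
    (Expr.op o e₁ e₂).eval W s = o.eval W (e₁.eval W s) (e₂.eval W s) := rfl
@[simp] theorem Expr.eval_const (s : State) (k : ℕ) (h : k < 2 ^ W) : (Expr.const k).eval W s = k :=
  Nat.mod_eq_of_lt h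

@[simp] theorem Op.eval_add {a b : ℕ} (h : a + b < 2 ^ W) : Op.add.eval W a b = a + b :=
  Nat.mod_eq_of_lt h
@[simp] theorem Op.eval_sub {a b : ℕ} (h : a < 2 ^ W) : Op.sub.eval W a b = a - b :=
  Nat.mod_eq_of_lt (lt_of_le_of_lt (Nat.sub_le _ _) h)
@[simp] theorem Op.eval_mul {a b : ℕ} (h : a * b < 2 ^ W) : Op.mul.eval W a b = a * b :=
  Nat.mod_eq_of_lt h
@[simp] theorem Op.eval_div {a b : ℕ} (h : a < 2 ^ W) : Op.div.eval W a b = a / b :=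
  Nat.mod_eq_of_lt (lt_of_le_of_lt (Nat.div_le_self _ _) h)
@[simp] theorem Op.eval_mod {a b : ℕ} (h : a < 2 ^ W) : Op.mod.eval W a b = a % b :=
  Nat.mod_eq_of_lt (lt_of_le_of_lt (Nat.mod_le _ _) h)
@[simp] theorem Op.eval_lt {a b : ℕ} (h : 1 < 2 ^ W) : Op.lt.eval W a b = if a < b then 1 else 0 := by
  simp only [Op.eval]; split <;> exact Nat.mod_eq_of_lt (by omega)
@[simp] theorem Op.eval_eq {a b : ℕ} (h : 1 < 2 ^ W) : Op.eq.eval W a b = if a = b then 1 else 0 := by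
  simp only [Op.eval]; split <;> exact Nat.mod_eq_of_lt (by omega)
@[simp] theorem Op.eval_or {a b : ℕ} (ha : a < 2 ^ W) (hb : b < 2 ^ W) :
    Op.or.eval W a b = a ||| b := Nat.mod_eq_of_lt (Nat.or_lt_two_pow ha hb)
@[simp] theorem Op.eval_xor {a b : ℕ} (ha : a < 2 ^ W) (hb : b < 2 ^ W) :
    Op.xor.eval W a b = a ^^^ b := Nat.mod_eq_of_lt (Nat.xor_lt_two_pow ha hb)
@[simp] theorem Op.eval_shl {a b : ℕ} (h : a * 2 ^ b < 2 ^ W) : Op.shl.eval W a b = a * 2 ^ b := by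
  simp only [Op.eval]; rw [Nat.shiftLeft_eq]; exact Nat.mod_eq_of_lt h
@[simp] theorem Op.eval_shr {a b : ℕ} (h : a < 2 ^ W) : Op.shr.eval W a b = a / 2 ^ b := by
  simp only [Op.eval]; rw [Nat.shiftRight_eq_div_pow]
  exact Nat.mod_eq_of_lt (lt_of_le_of_lt (Nat.div_le_self _ _) h)

end Eval

/-! ### States -/

section State
variable (s : State) (r r' v b b' i i' : ℕ)

@[simp] theorem State.setReg_reg :
    (s.setReg r v).reg r' = if r' = r then v else s.reg r' := by
  simp [State.setReg, Function.update_apply]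
@[simp] theorem State.setReg_mem : (s.setReg r v).mem = s.mem := rfl
@[simp] theorem State.setMem_reg : (s.setMem b i v).reg = s.reg := rfl
@[simp] theorem State.setMem_mem :
    (s.setMem b i v).mem b' i' = if b' = b ∧ i' = i then v else s.mem b' i' := by
  simp only [State.setMem, Function.update_apply]
  split_ifs <;> simp_all
theorem State.setMem_mem_ne (h : b' ≠ b) : (s.setMem b i v).mem b' = s.mem b' := by
  funext j; simp [h]

end State

/-! ### Programs -/

/-- The effect of a loop-free program. -/
def Prog.den (W : ℕ) : Prog → State → State
  | .skip, s => s
  | .assign r e, s => s.setReg r (e.eval W s)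
  | .store b a e, s => s.setMem b (a.eval W s) (e.eval W s)
  | .seq p q, s => q.den W (p.den W s)
  | .cond e p q, s => if e.eval W s = 0 then q.den W s else p.den W s
  | .loop _ _, s => s

/-- Programs without loops. -/
def Prog.loopFree : Prog → Bool
  | .skip | .assign _ _ | .store _ _ _ => true
  | .seq p q | .cond _ p q => p.loopFree && q.loopFree
  | .loop _ _ => false

/-- A bound for the running time of a loop-free program. -/
def Prog.bound : Prog → ℕ
  | .skip => 1
  | .assign _ e => e.cost + 1
  | .store _ a e => a.cost + e.cost + 1
  | .seq p q => p.bound + q.bound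
  | .cond e p q => e.cost + 1 + (p.bound + q.bound)
  | .loop _ _ => 0

/-- Whether a program may write to the register `r`. -/
def Prog.wreg (r : ℕ) : Prog → Bool
  | .assign r' _ => r == r'
  | .seq p q | .cond _ p q => p.wreg r || q.wreg r
  | .loop _ p => p.wreg r
  | _ => false

/-- Whether a program may write to the array `b`. -/
def Prog.wmem (b : ℕ) : Prog → Bool
  | .store b' _ _ => b == b'
  | .seq p q | .cond _ p q => p.wmem b || q.wmem b
  | .loop _ p => p.wmem b
  | _ => false

/-- The registers and arrays to which `p` does not write agree in `s` and `s'`. -/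
structure Frame (p : Prog) (s s' : State) : Prop where
  reg : ∀ r, p.wreg r = false → s'.reg r = s.reg r
  mem : ∀ b, p.wmem b = false → s'.mem b = s.mem b

theorem Frame.refl (p : Prog) (s : State) : Frame p s s := ⟨fun _ _ => rfl, fun _ _ => rfl⟩

theorem Frame.trans {p : Prog} {s s₁ s₂ : State} (h₁ : Frame p s s₁) (h₂ : Frame p s₁ s₂) :
    Frame p s s₂ :=
  ⟨fun r h => (h₂.reg r h).trans (h₁.reg r h), fun b h => (h₂.mem b h).trans (h₁.mem b h)⟩

theorem Frame.seq_left {p q : Prog} {s s₁ : State} (h : Frame p s s₁) : Frame (.seq p q) s s₁ :=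
  ⟨fun r hr => h.reg r (by simp_all [Prog.wreg]), fun b hb => h.mem b (by simp_all [Prog.wmem])⟩

theorem Frame.seq_right {p q : Prog} {s s₁ : State} (h : Frame q s s₁) : Frame (.seq p q) s s₁ :=
  ⟨fun r hr => h.reg r (by simp_all [Prog.wreg]), fun b hb => h.mem b (by simp_all [Prog.wmem])⟩

theorem Frame.mono {p q : Prog} {s s₁ : State} (h : Frame p s s₁)
    (hr : ∀ r, q.wreg r = false → p.wreg r = false)
    (hm : ∀ b, q.wmem b = false → p.wmem b = false) : Frame q s s₁ :=
  ⟨fun r h' => h.reg r (hr r h'), fun b h' => h.mem b (hm b h')⟩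

theorem Frame.setReg {p : Prog} {s s₁ : State} (h : Frame p s s₁) {r : ℕ} (v : ℕ)
    (hr : p.wreg r = true) : Frame p s (s₁.setReg r v) :=
  ⟨fun r' h' => by
    have : r' ≠ r := by rintro rfl; simp_all
    simpa [this] using h.reg r' h', h.mem⟩

/-- What a program cannot change is read off its text by a Boolean function, so later the side
conditions for concrete programs hold by `rfl`. -/
theorem Exec.frame {W : ℕ} {p : Prog} {s s' : State} {t : ℕ} (h : Exec W p s t s') :
    Frame p s s' := by
  induction h with
  | skip s => exact Frame.refl _ _
  | assign s r e =>
    exact ⟨fun r' h => by simp_all [Prog.wreg], fun b _ => rfl⟩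
  | store s b a e =>
    refine ⟨fun r _ => rfl, fun b' h => ?_⟩
    funext i
    simp_all [Prog.wmem]
  | seq p q s s₁ s₂ t₁ t₂ _ _ h₁ h₂ => exact h₁.seq_left.trans h₂.seq_right
  | cond_true e p q s s₁ t _ _ h =>
    exact ⟨fun r hr => h.reg r (by simp_all [Prog.wreg]),
      fun b hb => h.mem b (by simp_all [Prog.wmem])⟩
  | cond_false e p q s s₁ t _ _ h =>
    exact ⟨fun r hr => h.reg r (by simp_all [Prog.wreg]),
      fun b hb => h.mem b (by simp_all [Prog.wmem])⟩
  | loop_stop e p s _ => exact Frame.refl _ _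
  | loop_step e p s s₁ s₂ t₁ t₂ _ _ _ h₁ h₂ =>
    exact Frame.trans ⟨fun r hr => h₁.reg r (by simp_all [Prog.wreg]),
      fun b hb => h₁.mem b (by simp_all [Prog.wmem])⟩ h₂

/-- Without loops the final state is an explicit function of the initial one and the time is bounded
by the length of the text; both branches of a conditional are charged. -/
theorem Exec.den {W : ℕ} : ∀ {p : Prog} (s : State), p.loopFree = true →
    ∃ t ≤ p.bound, Exec W p s t (p.den W s)
  | .skip, s, _ => ⟨1, le_rfl, .skip s⟩
  | .assign r e, s, _ => ⟨_, le_rfl, .assign s r e⟩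
  | .store b a e, s, _ => ⟨_, le_rfl, .store s b a e⟩
  | .seq p q, s, h => by
    simp only [Prog.loopFree, Bool.and_eq_true] at h
    obtain ⟨t₁, h₁, e₁⟩ := Exec.den (p := p) s h.1
    obtain ⟨t₂, h₂, e₂⟩ := Exec.den (p := q) (p.den W s) h.2
    exact ⟨t₁ + t₂, add_le_add h₁ h₂, .seq _ _ _ _ _ _ _ e₁ e₂⟩
  | .cond e p q, s, h => by
    simp only [Prog.loopFree, Bool.and_eq_true] at h
    by_cases he : e.eval W s = 0
    · obtain ⟨t₂, h₂, e₂⟩ := Exec.den (p := q) s h.2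
      refine ⟨_, ?_, by simpa [Prog.den, he] using .cond_false e p q s _ _ he e₂⟩
      simp only [Prog.bound]; omega
    · obtain ⟨t₂, h₂, e₂⟩ := Exec.den (p := p) s h.1
      refine ⟨_, ?_, by simpa [Prog.den, he] using .cond_true e p q s _ _ he e₂⟩
      simp only [Prog.bound]; omega
  | .loop _ _, _, h => by simp [Prog.loopFree] at h

/-- Started in `s`, the program `p` halts within `T` steps in a state with the property `Q`. -/
def Run (W : ℕ) (p : Prog) (T : ℕ) (s : State) (Q : State → Prop) : Prop :=
  ∃ t s', Exec W p s t s' ∧ t ≤ T ∧ Q s'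

/-! ### Rules for total correctness with time bounds. -/

namespace Run
variable {W : ℕ} {p q : Prog} {T T₁ T₂ : ℕ} {s s₀ : State} {Q Q' : State → Prop} {e : Expr}

theorem mono (h : Run W p T₁ s Q) (hT : T₁ ≤ T) (hQ : ∀ s', Frame p s s' → Q s' → Q' s') :
    Run W p T s Q' := by
  obtain ⟨t, s', h₁, h₂, h₃⟩ := h
  exact ⟨t, s', h₁, h₂.trans hT, hQ _ h₁.frame h₃⟩

theorem seq (h₁ : Run W p T₁ s Q') (h₂ : ∀ s₁, Frame p s s₁ → Q' s₁ → Run W q T₂ s₁ Q)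
    (hT : T₁ + T₂ ≤ T) : Run W (.seq p q) T s Q := by
  obtain ⟨t, s', e₁, t₁, q₁⟩ := h₁
  obtain ⟨t', s'', e₂, t₂, q₂⟩ := h₂ s' e₁.frame q₁
  exact ⟨_, _, .seq _ _ _ _ _ _ _ e₁ e₂, by omega, q₂⟩

theorem den (hp : p.loopFree = true) (hT : p.bound ≤ T) (hQ : Q (p.den W s)) : Run W p T s Q := by
  obtain ⟨t, ht, h⟩ := Exec.den (W := W) s hp
  exact ⟨t, _, h, ht.trans hT, hQ⟩

theorem assign {r : ℕ} (v : ℕ) (he : e.eval W s = v) (h : Run W q T₂ (s.setReg r v) Q)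
    (hT : e.cost + 1 + T₂ ≤ T) : Run W (.seq (.assign r e) q) T s Q := by
  obtain ⟨t, s', h₁, h₂, h₃⟩ := h
  subst he
  exact ⟨_, s', .seq _ _ _ _ _ _ _ (.assign _ _ _) h₁, by omega, h₃⟩

theorem store {b : ℕ} {a : Expr} (i v : ℕ) (ha : a.eval W s = i) (he : e.eval W s = v)
    (h : Run W q T₂ (s.setMem b i v) Q)
    (hT : a.cost + e.cost + 1 + T₂ ≤ T) : Run W (.seq (.store b a e) q) T s Q := by
  obtain ⟨t, s', h₁, h₂, h₃⟩ := h
  subst he ha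
  exact ⟨_, s', .seq _ _ _ _ _ _ _ (.store _ _ _ _) h₁, by omega, h₃⟩

/-- The rule for loops: `τ` is a bound for the time that is left. -/
theorem loop (I : State → Prop) (τ : State → ℕ) (h₀ : I s₀)
    (hbody : ∀ s, Frame p s₀ s → I s → e.eval W s ≠ 0 →
      ∃ K, Run W p K s (fun s' => I s' ∧ K + e.cost + 1 + τ s' ≤ τ s))
    (hT : τ s₀ + e.cost + 1 ≤ T)
    (hQ : ∀ s, Frame p s₀ s → I s → e.eval W s = 0 → Q s) : Run W (.loop e p) T s₀ Q := by
  have key : ∀ k s, τ s ≤ k → Frame p s₀ s → I s →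
      ∃ t s', Exec W (.loop e p) s t s' ∧ t ≤ τ s + e.cost + 1 ∧ Q s' := by
    intro k
    induction k with
    | zero =>
      intro s hk hf hI
      by_cases he : e.eval W s = 0
      · exact ⟨_, _, Exec.loop_stop _ _ _ he, by omega, hQ s hf hI he⟩
      -- Another round would consume at least `e.cost + 1` units of a potential that is already 0.
      · obtain ⟨K, t, s', _, _, _, h⟩ := hbody s hf hI he
        omega
    | succ k ih =>
      intro s hk hf hI
      by_cases he : e.eval W s = 0
      · exact ⟨_, _, Exec.loop_stop _ _ _ he, by omega, hQ s hf hI he⟩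
      · obtain ⟨K, t, s', h₁, h₂, h₃, h⟩ := hbody s hf hI he
        obtain ⟨t', s'', h₄, h₅, h₆⟩ := ih s' (by omega) (hf.trans h₁.frame) h₃
        exact ⟨_, _, .loop_step _ _ _ _ _ _ _ he h₁ h₄, by omega, h₆⟩
  obtain ⟨t, s', h₁, h₂, h₃⟩ := key _ s₀ le_rfl (Frame.refl _ _) h₀
  exact ⟨t, s', h₁, by omega, h₃⟩

/-- The rule for loops with a loop-free body and a bounded number `μ` of iterations. -/
theorem loop_den (I : State → Prop) (μ : State → ℕ) (h₀ : I s₀) (hp : p.loopFree = true)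
    (hbody : ∀ s, Frame p s₀ s → I s → e.eval W s ≠ 0 →
      I (p.den W s) ∧ μ (p.den W s) < μ s)
    (hT : (p.bound + e.cost + 1) * μ s₀ + e.cost + 1 ≤ T)
    (hQ : ∀ s, Frame p s₀ s → I s → e.eval W s = 0 → Q s) : Run W (.loop e p) T s₀ Q := by
  refine loop I (fun s => (p.bound + e.cost + 1) * μ s) h₀ (fun s hf hI he => ?_) hT hQ
  obtain ⟨h₁, h₂⟩ := hbody s hf hI he
  refine ⟨p.bound, Run.den hp le_rfl ⟨h₁, ?_⟩⟩
  calc _ = (p.bound + e.cost + 1) * (μ (p.den W s) + 1) := by ring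
    _ ≤ _ := Nat.mul_le_mul_left _ h₂

end Run

end WordRAM

/-! ## Bucket sort -/

namespace WordRAM

/-- The sequence `f` begins with the list `L`. -/
def Holds (f : ℕ → ℕ) (L : List ℕ) : Prop := ∀ i (h : i < L.length), f i = L[i]

theorem Holds.nil (f : ℕ → ℕ) : Holds f [] := fun _ h => by simp at h

theorem Holds.congr {f g : ℕ → ℕ} {L : List ℕ} (h : Holds f L)
    (hfg : ∀ i < L.length, g i = f i) : Holds g L :=
  fun i hi => (hfg i hi).trans (h i hi)

theorem Holds.concat {f g : ℕ → ℕ} {L : List ℕ} {v : ℕ} (h : Holds f L)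
    (hfg : ∀ i < L.length, g i = f i) (hv : g L.length = v) : Holds g (L ++ [v]) := by
  intro i hi
  rw [List.getElem_append]
  split
  · next h' => exact (h.congr hfg) i h'
  · next h' =>
    simp only [List.length_append, List.length_singleton] at hi
    obtain rfl : i = L.length := by omega
    simpa using hv

/-- The list `L`, stably sorted by the keys `κ`; elements with keys `≥ K` are dropped. -/
def bsort (κ : ℕ → ℕ) (K : ℕ) (L : List ℕ) : List ℕ :=
  (List.range K).flatMap fun v => L.filter (κ · = v)

theorem bsort_succ (κ : ℕ → ℕ) (K : ℕ) (L : List ℕ) :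
    bsort κ (K + 1) L = bsort κ K L ++ L.filter (κ · = K) := by
  simp [bsort, List.range_succ]

theorem bsort_perm' (κ : ℕ → ℕ) (K : ℕ) (L : List ℕ) :
    (bsort κ K L).Perm (L.filter (κ · < K)) := by
  induction K with
  | zero => simp [bsort]
  | succ K ih =>
    rw [bsort_succ]
    refine (ih.append_right _).trans ?_
    have := List.filter_append_perm (fun x => decide (κ x < K)) (L.filter (κ · < K + 1))
    rw [List.filter_filter, List.filter_filter] at this
    refine List.Perm.trans (List.Perm.of_eq ?_) this
    congr 1 <;> refine List.filter_congr fun x _ => ?_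
    · simp only [← Bool.decide_and, decide_eq_decide]; omega
    · rw [← decide_not, ← Bool.decide_and, decide_eq_decide]; omega

theorem bsort_perm {κ : ℕ → ℕ} {K : ℕ} {L : List ℕ} (h : ∀ x ∈ L, κ x < K) :
    (bsort κ K L).Perm L := by
  refine (bsort_perm' κ K L).trans (List.Perm.of_eq (List.filter_eq_self.2 ?_))
  simpa using h

/-- This is stability: elements with equal keys keep the relation they had before. Passes from the
least to the most significant key thus sort lexicographically. -/
theorem bsort_pairwise (κ : ℕ → ℕ) (K : ℕ) {L : List ℕ} {ρ : ℕ → ℕ → Prop} (h : L.Pairwise ρ) :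
    (bsort κ K L).Pairwise fun a b => κ a < κ b ∨ κ a = κ b ∧ ρ a b := by
  induction K with
  | zero => simp [bsort]
  | succ K ih =>
    rw [bsort_succ, List.pairwise_append]
    refine ⟨ih, ?_, fun a ha b hb => ?_⟩
    · refine (h.filter _).imp_of_mem fun {a b} ha hb hab => ?_
      simp only [List.mem_filter, decide_eq_true_eq] at ha hb
      exact .inr ⟨by omega, hab⟩
    · have := (bsort_perm' κ K L).mem_iff.1 ha
      simp only [List.mem_filter, decide_eq_true_eq] at this hb
      exact .inl (by omega)

/-- Distribute the `r21` elements of the array `src` to the buckets of their keys. -/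
def distribute (src : ℕ) (key : Expr) : Prog :=
  23 ≔ 0 ;;
  .loop (lt (.reg 23) (.reg 21))
    (20 ≔ .load src (.reg 23) ;;
     27 ≔ key ;;
     .store 19 (.reg 27 * .reg 22 + .load 18 (.reg 27)) (.reg 20) ;;
     .store 18 (.reg 27) (.load 18 (.reg 27) + 1) ;;
     23 ≔ .reg 23 + 1)

/-- Collect the contents of the `r22` buckets in the array `dst`. -/
def collect (dst : ℕ) : Prog :=
  24 ≔ 0 ;; 25 ≔ 0 ;; 26 ≔ 0 ;;
  .loop (lt (.reg 24) (.reg 22))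
    (.cond (lt (.reg 25) (.load 18 (.reg 24)))
      (.store dst (.reg 26) (.load 19 (.reg 24 * .reg 22 + .reg 25)) ;;
        25 ≔ .reg 25 + 1 ;; 26 ≔ .reg 26 + 1)
      (.store 18 (.reg 24) 0 ;; 24 ≔ .reg 24 + 1 ;; 25 ≔ 0))

theorem bucket_addr {v c K : ℕ} (hv : v < K) (hc : c < K) : v * K + c < K * K := by nlinarith

/-- Slot c of bucket v has the address `v * K + c`, which is unambiguous while no bucket holds K
elements. These quadratic addresses are the reason why `K * K` has to fit into a word. -/
theorem bucket_inj {v c v' c' K : ℕ} (hc : c < K) (hc' : c' < K)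
    (h : v * K + c = v' * K + c') : v = v' ∧ c = c' := by
  have h₁ : (v * K + c) / K = v := by
    rw [add_comm, Nat.add_mul_div_right _ _ (by omega), Nat.div_eq_of_lt hc, zero_add]
  have h₂ : (v' * K + c') / K = v' := by
    rw [add_comm, Nat.add_mul_div_right _ _ (by omega), Nat.div_eq_of_lt hc', zero_add]
  obtain rfl : v = v' := by rw [← h₁, ← h₂, h]
  exact ⟨rfl, by omega⟩

/-- Only the counters in array 18 have to be clean at the start. The slots in array 19 may contain
remnants of earlier passes, because no slot beyond a counter is ever read. The frame in `hkey` uses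
the key 0 as a placeholder, as the key expression has no influence on which registers and arrays are
written. -/
theorem distribute_run {W src K : ℕ} {key : Expr} {s : State} {L : List ℕ} {κ : ℕ → ℕ}
    (hW : K * K < 2 ^ W) (hsrc₁ : src ≠ 18) (hsrc₂ : src ≠ 19)
    (h21 : s.reg 21 = L.length) (h22 : s.reg 22 = K) (hLK : L.length < K)
    (hL : Holds (s.mem src) L) (hκ : ∀ x ∈ L, κ x < K)
    (hkey : ∀ s', Frame (distribute src 0) s s' → s'.reg 20 ∈ L →
      key.eval W s' = κ (s'.reg 20))
    (h18 : ∀ v, s.mem 18 v = 0) :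
    Run W (distribute src key) (100 * (key.cost + 1) * (K + 1)) s fun s' => ∀ v,
      s'.mem 18 v = (L.filter (κ · = v)).length ∧ (v < K →
      Holds (fun c => s'.mem 19 (v * K + c)) (L.filter (κ · = v))) := by
  have hK : K ≤ K * K := Nat.le_mul_self K
  refine Run.seq (Q' := fun s' => s' = s.setReg 23 0) (T₁ := 2) (T₂ := (26 + key.cost) * L.length + 4)
    (Run.den rfl le_rfl (by simp (disch := omega) [Prog.den])) ?_ ?_
  swap
  · nlinarith
  rintro _ hf rfl
  refine Run.loop_den (fun s' => s'.reg 23 ≤ L.length ∧ ∀ v,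
      s'.mem 18 v = ((L.take (s'.reg 23)).filter (κ · = v)).length ∧ (v < K →
      Holds (fun c => s'.mem 19 (v * K + c)) ((L.take (s'.reg 23)).filter (κ · = v))))
      (fun s' => L.length - s'.reg 23) ?_ rfl ?_ ?_ ?_
  · refine ⟨by simp, fun v => ⟨by simpa using h18 v, fun _ => by simpa using Holds.nil _⟩⟩
  · rintro s' hf' ⟨hk, hI⟩ he
    have e21 : s'.reg 21 = L.length := by rw [hf'.reg 21 rfl]; simpa using h21
    have e22 : s'.reg 22 = K := by rw [hf'.reg 22 rfl]; simpa using h22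
    have esrc : s'.mem src = s.mem src := by
      rw [hf'.mem src (by simp [Prog.wmem, hsrc₁, hsrc₂])]; rfl
    generalize hkk : s'.reg 23 = k at *
    have hkL : k < L.length := by simpa (disch := omega) [hkk, e21] using he
    have hx : s'.mem src k = L[k] := by rw [esrc]; exact hL k hkL
    have hxL : L[k] ∈ L := List.getElem_mem _
    have hkv : key.eval W (s'.setReg 20 L[k]) = κ L[k] := by
      have := hkey (s'.setReg 20 L[k]) ?_ (by simp)
      · simpa using this
      · refine Frame.setReg ?_ _ rfl
        exact (hf.seq_left).trans (hf'.mono (fun r hr => by simp_all [Prog.wreg, distribute])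
          (fun r hr => by simp_all [Prog.wmem, distribute]))
    have hv := hκ _ hxL
    have hc := (hI (κ L[k])).1
    have hcL : ((L.take k).filter (κ · = κ L[k])).length < K := by
      refine lt_of_le_of_lt (List.length_filter_le _ _) ?_
      simp; omega
    have hb := bucket_addr hv hcL
    rw [← hc] at hb hcL
    have htake : L.take (k + 1) = L.take k ++ [L[k]] := (List.take_concat_get' L k hkL).symm
    have e23 : (Prog.den W (20 ≔ .load src (.reg 23) ;; 27 ≔ key ;;
     .store 19 (.reg 27 * .reg 22 + .load 18 (.reg 27)) (.reg 20) ;;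
     .store 18 (.reg 27) (.load 18 (.reg 27) + 1) ;; 23 ≔ .reg 23 + 1) s') =
      ((((s'.setReg 20 L[k]).setReg 27 (κ L[k])).setMem 19
        (κ L[k] * K + s'.mem 18 (κ L[k])) L[k]).setMem 18 (κ L[k])
        (s'.mem 18 (κ L[k]) + 1)).setReg 23 (k + 1) := by
      simp (disch := omega) [Prog.den, hkk, hx, hkv, e22]
    rw [e23]
    refine ⟨⟨by simpa using hkL, fun v => ?_⟩, by simp; omega⟩
    obtain ⟨hc', hB'⟩ := hI v
    by_cases hvv : v = κ L[k]
    · subst hvv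
      simp only [State.setReg_reg, State.setReg_mem, State.setMem_mem, if_true, htake,
        List.filter_append]
      refine ⟨by simp [hc], ?_⟩
      simp only [decide_true, List.filter_cons_of_pos, List.filter_nil]
      intro hvK
      refine (hB' hvK).concat (fun i hi => ?_) ?_
      · have : i ≠ s'.mem 18 (κ L[k]) := by omega
        simp [this]
      · simp [hc]
    · simp only [State.setReg_reg, State.setReg_mem, State.setMem_mem, if_true, htake,
        List.filter_append]
      have : [L[k]].filter (κ · = v) = [] := by simp [Ne.symm hvv]
      rw [this, List.append_nil]
      refine ⟨by simp [hc', hvv], fun hvK => (hB' hvK).congr fun i hi => ?_⟩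
      have hi' : i < K := by
        refine lt_of_lt_of_le hi ((List.length_filter_le _ _).trans ?_)
        simp; omega
      have : ¬ (v * K + i = κ L[k] * K + s'.mem 18 (κ L[k])) := fun h =>
        hvv (bucket_inj hi' hcL h).1
      simp [this]
  · simp [Prog.bound, Expr.cost]
    nlinarith
  · rintro s' hf' ⟨hk, hI⟩ he
    have e21 : s'.reg 21 = L.length := by rw [hf'.reg 21 rfl]; simpa using h21
    have : s'.reg 23 = L.length := by
      have : ¬ s'.reg 23 < L.length := by simpa (disch := omega) [e21] using he
      omega
    simpa [this] using hI

theorem length_bsort_le (κ : ℕ → ℕ) (K : ℕ) (L : List ℕ) : (bsort κ K L).length ≤ L.length :=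
  (bsort_perm' κ K L).length_eq.trans_le (List.length_filter_le _ _)

/-- Every round either moves one element or closes one bucket, so the time is linear in K although
there are `K * K` slots. Closing a bucket resets its counter, which leaves array 18 clean for the
next pass. -/
theorem collect_run {W dst K : ℕ} {s : State} {L : List ℕ} {κ : ℕ → ℕ}
    (hW : K * K < 2 ^ W) (hdst₁ : dst ≠ 18) (hdst₂ : dst ≠ 19)
    (h22 : s.reg 22 = K) (hLK : L.length < K) (hκ : ∀ x ∈ L, κ x < K)
    (hB : ∀ v, s.mem 18 v = (L.filter (κ · = v)).length ∧ (v < K →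
      Holds (fun c => s.mem 19 (v * K + c)) (L.filter (κ · = v)))) :
    Run W (collect dst) (100 * (K + 1)) s fun s' =>
      Holds (s'.mem dst) (bsort κ K L) ∧ ∀ v, s'.mem 18 v = 0 := by
  have hK : K ≤ K * K := Nat.le_mul_self K
  refine Run.assign 0 (by simp (disch := omega)) (T₂ := 100 * K + 98) ?_ (by simp [Expr.cost]; omega)
  refine Run.assign 0 (by simp (disch := omega)) (T₂ := 100 * K + 96) ?_ (by simp [Expr.cost]; omega)
  refine Run.assign 0 (by simp (disch := omega)) (T₂ := 100 * K + 94) ?_ (by simp [Expr.cost]; omega)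
  refine Run.loop_den (fun s' => s'.reg 24 ≤ K ∧
      s'.reg 26 = (bsort κ (s'.reg 24) L).length + s'.reg 25 ∧
      s'.reg 25 ≤ (L.filter (κ · = s'.reg 24)).length ∧
      Holds (s'.mem dst) (bsort κ (s'.reg 24) L ++ (L.filter (κ · = s'.reg 24)).take (s'.reg 25)) ∧
      ∀ v, s'.mem 18 v = if v < s'.reg 24 then 0 else (L.filter (κ · = v)).length)
      (fun s' => (K - s'.reg 24) + (L.length - s'.reg 26)) ?_ rfl ?_ ?_ ?_
  · refine ⟨by simp, by simp [bsort], by simp, by simpa [bsort] using Holds.nil _, ?_⟩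
    simpa using fun v => (hB v).1
  · rintro s' hf' ⟨hv, ho, hc, hD, h18⟩ he
    have e22 : s'.reg 22 = K := by rw [hf'.reg 22 rfl]; simpa using h22
    have e19 : s'.mem 19 = s.mem 19 := by
      rw [hf'.mem 19 (by simp [Prog.wmem, hdst₂.symm])]; rfl
    generalize hkv : s'.reg 24 = v at *
    generalize hkc : s'.reg 25 = c at *
    generalize hko : s'.reg 26 = o at *
    have hvK : v < K := by simpa (disch := omega) [hkv, e22] using he
    have e18 := h18 v
    rw [if_neg (lt_irrefl _)] at e18
    have hlen := length_bsort_le κ (v + 1) L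
    rw [bsort_succ, List.length_append] at hlen
    by_cases hcv : c < s'.mem 18 v
    · have hb := bucket_addr hvK (lt_of_lt_of_le hcv (by
        rw [e18]; exact ((List.length_filter_le _ _).trans hLK.le)))
      have e : (Prog.den W (.cond (lt (.reg 25) (.load 18 (.reg 24)))
          (.store dst (.reg 26) (.load 19 (.reg 24 * .reg 22 + .reg 25)) ;;
            25 ≔ .reg 25 + 1 ;; 26 ≔ .reg 26 + 1)
          (.store 18 (.reg 24) 0 ;; 24 ≔ .reg 24 + 1 ;; 25 ≔ 0)) s') =
          ((s'.setMem dst o (s'.mem 19 (v * K + c))).setReg 25 (c + 1)).setReg 26 (o + 1) := by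
        simp (disch := omega) [Prog.den, hkv, hkc, hko, e22, hcv]
      rw [e]
      have hval := (hB v).2 hvK c (by omega)
      simp only [State.setReg_reg, State.setReg_mem, State.setMem_mem, State.setMem_reg, hkv,
        if_true, hdst₁.symm, false_and, if_false, OfNat.ofNat_eq_ofNat, Nat.reduceEqDiff]
      refine ⟨⟨hv, by omega, by omega, ?_, h18⟩, by omega⟩
      rw [← List.take_concat_get' _ _ (by omega), ← List.append_assoc]
      have hl : (bsort κ v L ++ (L.filter (κ · = v)).take c).length = o := by
        rw [List.length_append, List.length_take_of_le hc]; omega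
      refine hD.concat (fun i hi => ?_) ?_
      · have : i ≠ o := by omega
        simp [this]
      · simp [hl, e19, hval]
    · have e : (Prog.den W (.cond (lt (.reg 25) (.load 18 (.reg 24)))
          (.store dst (.reg 26) (.load 19 (.reg 24 * .reg 22 + .reg 25)) ;;
            25 ≔ .reg 25 + 1 ;; 26 ≔ .reg 26 + 1)
          (.store 18 (.reg 24) 0 ;; 24 ≔ .reg 24 + 1 ;; 25 ≔ 0)) s') =
          ((s'.setMem 18 v 0).setReg 24 (v + 1)).setReg 25 0 := by
        simp (disch := omega) [Prog.den, hkv, hkc, hko, e22, hcv]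
      rw [e]
      have hc' : c = (L.filter (κ · = v)).length := by omega
      have hlen2 : (bsort κ (v + 1) L).length = (bsort κ v L).length + c := by
        rw [bsort_succ, List.length_append, hc']
      rw [hc', List.take_length, ← bsort_succ] at hD
      simp only [State.setReg_reg, State.setReg_mem, State.setMem_mem, State.setMem_reg, hko,
        if_true, if_false, OfNat.ofNat_eq_ofNat, Nat.reduceEqDiff, hdst₁, false_and]
      refine ⟨⟨hvK, by omega, by simp, by
        rwa [State.setMem_mem_ne _ _ _ _ _ hdst₁, List.take_zero, List.append_nil], fun v' => ?_⟩, by omega⟩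
      have := h18 v'
      by_cases hvv : v' = v
      · simp [hvv]
      · simp only [true_and, hvv, if_false, this]
        exact if_congr (by omega) rfl rfl
  · simp [Prog.bound, Expr.cost, bsort]
    omega
  · rintro s' hf' ⟨hv, ho, hc, hD, h18⟩ he
    have e22 : s'.reg 22 = K := by rw [hf'.reg 22 rfl]; simpa using h22
    have hvK : s'.reg 24 = K := by
      have : ¬ s'.reg 24 < K := by simpa (disch := omega) [e22] using he
      omega
    rw [hvK] at hD hc h18
    have hnil : ∀ v, K ≤ v → L.filter (κ · = v) = [] := fun v hv => by
      simp only [List.filter_eq_nil_iff, decide_eq_true_eq]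
      intro x hx; have := hκ x hx; omega
    rw [hnil K le_rfl, List.take_nil, List.append_nil] at hD
    refine ⟨hD, fun v => ?_⟩
    rw [h18]; split_ifs with h
    · rfl
    · rw [hnil v (by omega)]; rfl

/-- Stable sort of the array `src` by the keys `key` into the array `dst`. -/
def radixPass (src dst : ℕ) (key : Expr) : Prog := distribute src key ;; collect dst

theorem radixPass_run {W src dst K : ℕ} {key : Expr} {s : State} {L : List ℕ} {κ : ℕ → ℕ}
    (hW : K * K < 2 ^ W) (hsrc₁ : src ≠ 18) (hsrc₂ : src ≠ 19) (hdst₁ : dst ≠ 18) (hdst₂ : dst ≠ 19)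
    (h21 : s.reg 21 = L.length) (h22 : s.reg 22 = K) (hLK : L.length < K)
    (hL : Holds (s.mem src) L) (hκ : ∀ x ∈ L, κ x < K)
    (hkey : ∀ s', Frame (distribute src 0) s s' → s'.reg 20 ∈ L →
      key.eval W s' = κ (s'.reg 20))
    (h18 : ∀ v, s.mem 18 v = 0) :
    Run W (radixPass src dst key) (100 * (key.cost + 2) * (K + 1)) s fun s' =>
      Holds (s'.mem dst) (bsort κ K L) ∧ ∀ v, s'.mem 18 v = 0 := by
  refine Run.seq (distribute_run hW hsrc₁ hsrc₂ h21 h22 hLK hL hκ hkey h18)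
    (fun s₁ hf h => collect_run hW hdst₁ hdst₂ ?_ hLK hκ h) ?_
  · rw [hf.reg 22 rfl, h22]
  · nlinarith

end WordRAM

/-! ## Suffixes of words -/

namespace Suffix

/-- `f` represents a word of length `N` over the positive integers, followed by zeros. -/
structure IsWord (f : ℕ → ℕ) (N : ℕ) : Prop where
  pos : ∀ i < N, 0 < f i
  zero : ∀ i, N ≤ i → f i = 0

/-- The suffix of `f` at `i` is lexicographically smaller than the one at `j`. -/
def sufLt (f : ℕ → ℕ) (i j : ℕ) : Prop :=
  ∃ k, (∀ l < k, f (i + l) = f (j + l)) ∧ f (i + k) < f (j + k)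

/-- The longest common prefix of the suffixes at `i` and `j` has length `k`. -/
def IsLce (f : ℕ → ℕ) (i j k : ℕ) : Prop :=
  (∀ l < k, f (i + l) = f (j + l)) ∧ f (i + k) ≠ f (j + k)

variable {f : ℕ → ℕ} {N i j k : ℕ}

theorem IsLce.symm (h : IsLce f i j k) : IsLce f j i k := ⟨fun l hl => (h.1 l hl).symm, h.2.symm⟩

theorem IsLce.unique {k' : ℕ} (h : IsLce f i j k) (h' : IsLce f i j k') : k = k' := by
  rcases lt_trichotomy k k' with hk | hk | hk
  · exact absurd (h'.1 k hk) h.2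
  · exact hk
  · exact absurd (h.1 k' hk) h'.2

theorem IsLce.le_of_forall {l : ℕ} (h : IsLce f i j k) (hl : ∀ x < l, f (i + x) = f (j + x)) :
    l ≤ k := by
  by_contra hlt
  exact h.2 (hl k (by omega))

theorem sufLt.irrefl : ¬ sufLt f i i := fun ⟨_, _, h⟩ => lt_irrefl _ h

theorem sufLt.exists_isLce (h : sufLt f i j) : ∃ k, IsLce f i j k ∧ f (i + k) < f (j + k) := by
  obtain ⟨k, h₁, h₂⟩ := h
  exact ⟨k, ⟨h₁, h₂.ne⟩, h₂⟩

theorem sufLt.lt_of_isLce (h : sufLt f i j) (hk : IsLce f i j k) : f (i + k) < f (j + k) := by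
  obtain ⟨k', h', h''⟩ := h.exists_isLce
  rwa [hk.unique h']

theorem sufLt.asymm (h : sufLt f i j) : ¬ sufLt f j i := fun h' => by
  obtain ⟨k, hk, h₁⟩ := h.exists_isLce
  exact h₁.asymm (h'.lt_of_isLce hk.symm)

/-- Sandwiched suffixes: the longest common prefix of the outer ones is the shorter one. -/
theorem IsLce.trans {a b c x y : ℕ} (hab : sufLt f a b) (hbc : sufLt f b c)
    (hx : IsLce f a b x) (hy : IsLce f b c y) :
    IsLce f a c (min x y) ∧ f (a + min x y) < f (c + min x y) := by
  have h₁ := hab.lt_of_isLce hx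
  have h₂ := hbc.lt_of_isLce hy
  -- At the smaller of the two lengths at least one of the two comparisons is strict, and the other
  -- one is strict or an equality.
  have key : f (a + min x y) < f (c + min x y) := by
    rcases lt_trichotomy x y with h | h | h
    · rw [min_eq_left h.le, ← hy.1 x h]; exact h₁
    · subst h; rw [min_self]; exact h₁.trans h₂
    · rw [min_eq_right h.le, hx.1 y h]; exact h₂
  refine ⟨⟨fun l hl => ?_, key.ne⟩, key⟩
  exact (hx.1 l (by omega)).trans (hy.1 l (by omega))

theorem sufLt.trans {a b c : ℕ} (hab : sufLt f a b) (hbc : sufLt f b c) : sufLt f a c := by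
  obtain ⟨x, hx, -⟩ := hab.exists_isLce
  obtain ⟨y, hy, -⟩ := hbc.exists_isLce
  obtain ⟨h₁, h₂⟩ := IsLce.trans hab hbc hx hy
  exact ⟨_, h₁.1, h₂⟩

theorem sufLt_trichotomy (f : ℕ → ℕ) (i j : ℕ) :
    sufLt f i j ∨ (∀ l, f (i + l) = f (j + l)) ∨ sufLt f j i := by
  by_cases h : ∀ l, f (i + l) = f (j + l)
  · exact .inr (.inl h)
  · push Not at h
    classical
    have h₁ : ∀ l < Nat.find h, f (i + l) = f (j + l) := fun l hl => by
      simpa using Nat.find_min h hl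
    rcases lt_or_gt_of_ne (Nat.find_spec h) with h₂ | h₂
    · exact .inl ⟨_, h₁, h₂⟩
    · exact .inr (.inr ⟨_, fun l hl => (h₁ l hl).symm, h₂⟩)

theorem IsWord.eq_zero_iff (hf : IsWord f N) : f i = 0 ↔ N ≤ i :=
  ⟨fun h => by by_contra h'; have := hf.pos i (by omega); omega, hf.zero i⟩

/-- The zeros behind the word are an end marker: the first zero reveals the length of a suffix.
Therefore the order of the suffixes is total on the positions up to N. -/
theorem IsWord.eq_of_forall (hf : IsWord f N) (hi : i ≤ N) (hj : j ≤ N)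
    (h : ∀ l, f (i + l) = f (j + l)) : i = j := by
  have h₁ := hf.eq_zero_iff.1 ((h (N - i)).symm.trans (hf.zero _ (by omega)))
  have h₂ := hf.eq_zero_iff.1 ((h (N - j)).trans (hf.zero _ (by omega)))
  omega

theorem IsWord.sufLt_or (hf : IsWord f N) (hi : i ≤ N) (hj : j ≤ N) (hij : i ≠ j) :
    sufLt f i j ∨ sufLt f j i := by
  rcases sufLt_trichotomy f i j with h | h | h
  · exact .inl h
  · exact absurd (hf.eq_of_forall hi hj h) hij
  · exact .inr h

/-- Peeling off one letter, or two, leads from a pair of positions to a pair of sampled ones whose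
order is already known. -/
theorem sufLt_iff_head : sufLt f i j ↔ f i < f j ∨ f i = f j ∧ sufLt f (i + 1) (j + 1) := by
  constructor
  · rintro ⟨_ | k, h₁, h₂⟩
    · exact .inl h₂
    · refine .inr ⟨h₁ 0 (by omega), k, fun l hl => ?_, ?_⟩
      · have := h₁ (l + 1) (by omega)
        rwa [show i + (l + 1) = i + 1 + l by ring, show j + (l + 1) = j + 1 + l by ring] at this
      · rwa [show i + (k + 1) = i + 1 + k by ring, show j + (k + 1) = j + 1 + k by ring] at h₂
  · rintro (h | ⟨h, k, h₁, h₂⟩)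
    · exact ⟨0, by simp, h⟩
    · refine ⟨k + 1, fun l hl => ?_, ?_⟩
      · rcases l with _ | l
        · exact h
        · rw [show i + (l + 1) = i + 1 + l by ring, show j + (l + 1) = j + 1 + l by ring]
          exact h₁ l (by omega)
      · rwa [show i + (k + 1) = i + 1 + k by ring, show j + (k + 1) = j + 1 + k by ring]

theorem IsWord.sufLt_end (hf : IsWord f N) (hi : N ≤ i) : sufLt f i j ↔ j < N := by
  constructor
  · rintro ⟨k, -, h⟩
    by_contra hj
    rw [hf.zero (j + k) (by omega)] at h
    omega
  · intro hj
    refine ⟨0, by simp, ?_⟩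
    rw [hf.zero _ (by omega)]
    exact hf.pos _ hj

theorem IsWord.not_sufLt_end (hf : IsWord f N) (hj : N ≤ j) : ¬ sufLt f i j := by
  rintro ⟨k, -, h⟩
  rw [hf.zero (j + k) (by omega)] at h
  omega

/-! ### The reduction of a word to its sample of triples -/

/-- Lexicographic comparison of the triples at `i` and `j`. -/
def tripleLt (f : ℕ → ℕ) (i j : ℕ) : Prop :=
  f i < f j ∨ f i = f j ∧
    (f (i + 1) < f (j + 1) ∨ f (i + 1) = f (j + 1) ∧ f (i + 2) < f (j + 2))

instance (f : ℕ → ℕ) (i j : ℕ) : Decidable (tripleLt f i j) := by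
  unfold tripleLt; infer_instance

/-- The triples at `i` and `j` agree. -/
def tripleEq (f : ℕ → ℕ) (i j : ℕ) : Prop :=
  f i = f j ∧ f (i + 1) = f (j + 1) ∧ f (i + 2) = f (j + 2)

instance (f : ℕ → ℕ) (i j : ℕ) : Decidable (tripleEq f i j) := by
  unfold tripleEq; infer_instance

/-- The length of the reduced word of a word of length `N`. -/
def redLen (N : ℕ) : ℕ := (N + 2) / 3 + N / 3

/-- The position to which the letter `k` of the reduced word belongs. -/
def samplePos (N k : ℕ) : ℕ :=
  if k < (N + 2) / 3 then 3 * k + 1 else 3 * (k - (N + 2) / 3) + 2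

/-- The index of the position `i` in the reduced word. -/
def sampleIdx (N i : ℕ) : ℕ := if i % 3 = 1 then i / 3 else (N + 2) / 3 + i / 3

/-- The sampled positions. -/
def samples (N : ℕ) : List ℕ := (List.range (redLen N)).map (samplePos N)

/-- The reduced word: the triples at the sampled positions are replaced by their ranks. -/
def red (f : ℕ → ℕ) (N k : ℕ) : ℕ :=
  if k < redLen N then 1 + (samples N).countP (fun a => tripleLt f a (samplePos N k)) else 0

theorem sampleIdx_samplePos (N k : ℕ) : sampleIdx N (samplePos N k) = k := by
  unfold sampleIdx samplePos; split_ifs <;> omega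

theorem samplePos_sampleIdx (h₁ : i % 3 ≠ 0) (h₂ : i < N ∨ i = N ∧ i % 3 = 1) :
    samplePos N (sampleIdx N i) = i ∧ sampleIdx N i < redLen N := by
  unfold sampleIdx samplePos redLen; split_ifs <;> omega

theorem samplePos_spec (h : k < redLen N) : samplePos N k % 3 ≠ 0 ∧
    (samplePos N k < N ∨ samplePos N k = N ∧ samplePos N k % 3 = 1) := by
  unfold samplePos redLen at *; split_ifs <;> omega

/-- If N has residue 1, the position N itself is sampled, with a triple of zeros. Otherwise the half
of the reduced word for residue 1 could end with a triple without an end marker, and comparisons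
would run on into the half for residue 2. -/
theorem mem_samples : i ∈ samples N ↔ i % 3 ≠ 0 ∧ (i < N ∨ i = N ∧ i % 3 = 1) := by
  simp only [samples, List.mem_map, List.mem_range]
  constructor
  · rintro ⟨k, hk, rfl⟩; exact samplePos_spec hk
  · rintro ⟨h₁, h₂⟩
    exact ⟨_, (samplePos_sampleIdx h₁ h₂).2, (samplePos_sampleIdx h₁ h₂).1⟩

theorem length_samples : (samples N).length = redLen N := by simp [samples]

theorem redLen_lt (h : 2 ≤ N) : redLen N < N := by unfold redLen; omega

/-- The names count the smaller triples with multiplicity, so they need not be consecutive; only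
their order matters. Strictness comes from the triple at the position of k, which is counted for k'
but not for k itself. -/
theorem red_lt_of_tripleLt {k' : ℕ} (hk : k < redLen N) (hk' : k' < redLen N)
    (h : tripleLt f (samplePos N k) (samplePos N k')) : red f N k < red f N k' := by
  simp only [red, hk, hk', if_true, add_lt_add_iff_left]
  have hmem : samplePos N k ∈ samples N := List.mem_map.2 ⟨k, List.mem_range.2 hk, rfl⟩
  obtain ⟨l₁, l₂, e⟩ := List.append_of_mem hmem
  have mono : ∀ l : List ℕ, l.countP (fun a => decide (tripleLt f a (samplePos N k))) ≤
      l.countP (fun a => decide (tripleLt f a (samplePos N k'))) := fun l => by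
    refine List.countP_mono_left fun x _ hx => ?_
    simp only [decide_eq_true_eq] at hx ⊢
    unfold tripleLt at *; omega
  have h₁ := mono l₁
  have h₂ := mono l₂
  rw [e]
  simp only [List.countP_append, List.countP_cons, h, decide_true, if_true]
  have : ¬ tripleLt f (samplePos N k) (samplePos N k) := by unfold tripleLt; omega
  simp only [this, decide_false, Bool.false_eq_true, if_false]
  omega

theorem red_eq_of_tripleEq {k' : ℕ} (hk : k < redLen N) (hk' : k' < redLen N)
    (h : tripleEq f (samplePos N k) (samplePos N k')) : red f N k = red f N k' := by
  simp only [red, hk, hk', if_true, add_right_inj]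
  refine List.countP_congr fun x _ => ?_
  simp only [decide_eq_true_eq]
  unfold tripleEq at h; unfold tripleLt; omega

theorem red_isWord (f : ℕ → ℕ) (N : ℕ) : IsWord (red f N) (redLen N) :=
  ⟨fun i hi => by simp [red, hi], fun i hi => by simp [red, not_lt.2 hi]⟩

/-- The letters of the reduced word are bounded by its length, so linearly many buckets suffice
again on the next level. -/
theorem red_le (f : ℕ → ℕ) (N k : ℕ) : red f N k ≤ redLen N := by
  unfold red; split_ifs with hk
  · have hmem : samplePos N k ∈ samples N := List.mem_map.2 ⟨k, List.mem_range.2 hk, rfl⟩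
    have hlt : (samples N).countP (fun a => decide (tripleLt f a (samplePos N k))) <
        (samples N).length := by
      refine lt_of_le_of_ne List.countP_le_length fun h => ?_
      have := List.countP_eq_length.1 h _ hmem
      simp [tripleLt] at this
    rw [length_samples] at hlt
    omega
  · omega

theorem sampleIdx_add (l : ℕ) : sampleIdx N (i + 3 * l) = sampleIdx N i + l := by
  unfold sampleIdx; split_ifs <;> omega

/-- If the suffixes differ first at distance x, then their triples before the one with number `x /
3` agree, and those with this number are ordered like the suffixes. -/
theorem red_sufLt_of_sufLt {k' : ℕ} (hf : IsWord f N) (hk : k < redLen N) (hk' : k' < redLen N)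
    (h : sufLt f (samplePos N k) (samplePos N k')) : sufLt (red f N) k k' := by
  obtain ⟨x, h₁, h₂⟩ := h
  have ek := sampleIdx_samplePos N k
  have ek' := sampleIdx_samplePos N k'
  obtain ⟨m₁, b₁⟩ := samplePos_spec hk
  obtain ⟨m₂, b₂⟩ := samplePos_spec hk'
  generalize samplePos N k = i at *
  generalize samplePos N k' = j at *
  have hj : ∀ y ≤ x, j + y < N := fun y hy => by
    by_contra hn
    rw [hf.zero (j + x) (by omega)] at h₂
    omega
  have hi : ∀ y < x, i + y < N := fun y hy => by
    by_contra hn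
    have := h₁ y hy
    rw [hf.zero (i + y) (by omega), eq_comm, hf.eq_zero_iff] at this
    have := hj y hy.le
    omega
  have idx : ∀ {a l c : ℕ}, a % 3 ≠ 0 → sampleIdx N a = c → a + 3 * l < N →
      samplePos N (c + l) = a + 3 * l ∧ c + l < redLen N := fun {a l c} ha hc hl => by
    rw [← hc, ← sampleIdx_add]
    exact samplePos_sampleIdx (by omega) (.inl hl)
  refine ⟨x / 3, fun l hl => ?_, ?_⟩
  · obtain ⟨p₁, p₂⟩ := idx (l := l) m₁ ek (hi _ (by omega))
    obtain ⟨p₃, p₄⟩ := idx (l := l) m₂ ek' (hj _ (by omega))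
    refine red_eq_of_tripleEq p₂ p₄ ?_
    rw [p₁, p₃]
    exact ⟨h₁ _ (by omega), by simpa [add_assoc] using h₁ (3 * l + 1) (by omega),
      by simpa [add_assoc] using h₁ (3 * l + 2) (by omega)⟩
  · obtain ⟨p₃, p₄⟩ := idx (l := x / 3) m₂ ek' (hj _ (by omega))
    by_cases hc : i + 3 * (x / 3) < N ∨ i + 3 * (x / 3) = N ∧ (i + 3 * (x / 3)) % 3 = 1
    · obtain ⟨p₁, p₂⟩ := samplePos_sampleIdx (N := N) (i := i + 3 * (x / 3)) (by omega) hc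
      rw [sampleIdx_add, ek] at p₁ p₂
      refine red_lt_of_tripleLt p₂ p₄ ?_
      rw [p₁, p₃]
      have e₀ : x % 3 ≠ 0 → f (i + 3 * (x / 3)) = f (j + 3 * (x / 3)) :=
        fun _ => h₁ _ (by omega)
      have e₁ : x % 3 = 2 → f (i + 3 * (x / 3) + 1) = f (j + 3 * (x / 3) + 1) :=
        fun _ => h₁ (3 * (x / 3) + 1) (by omega)
      have hx : x % 3 = 0 ∨ x % 3 = 1 ∨ x % 3 = 2 := by omega
      unfold tripleLt
      rcases hx with hx | hx | hx
      · left
        rwa [show i + 3 * (x / 3) = i + x by omega, show j + 3 * (x / 3) = j + x by omega]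
      · refine .inr ⟨e₀ (by omega), .inl ?_⟩
        rwa [show i + 3 * (x / 3) + 1 = i + x by omega, show j + 3 * (x / 3) + 1 = j + x by omega]
      · refine .inr ⟨e₀ (by omega), .inr ⟨e₁ (by omega), ?_⟩⟩
        rwa [show i + 3 * (x / 3) + 2 = i + x by omega, show j + 3 * (x / 3) + 2 = j + x by omega]
    -- The first suffix ends right before this triple. That occurs only for residue 2, since N is
    -- sampled for residue 1; the index then lies just behind the reduced word, where its value is
    -- 0.
    · have : redLen N ≤ k + x / 3 := by
        rw [← ek]
        by_cases hx : x = 0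
        · omega
        · have := hi (x - 1) (by omega)
          unfold sampleIdx redLen; split_ifs <;> omega
      rw [(red_isWord f N).zero _ this]
      exact (red_isWord f N).pos _ p₄

/-- The converse direction comes from totality: the opposite order in f would give the opposite
order in the reduced word. -/
theorem red_sufLt_iff {k' : ℕ} (hf : IsWord f N) (hk : k < redLen N) (hk' : k' < redLen N) :
    sufLt (red f N) k k' ↔ sufLt f (samplePos N k) (samplePos N k') := by
  refine ⟨fun h => ?_, red_sufLt_of_sufLt hf hk hk'⟩
  have hne : samplePos N k ≠ samplePos N k' := fun e => by
    have : k = k' := by rw [← sampleIdx_samplePos N k, e, sampleIdx_samplePos N k']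
    exact sufLt.irrefl (this ▸ h)
  have b₁ := (samplePos_spec hk).2
  have b₂ := (samplePos_spec hk').2
  refine (hf.sufLt_or (by omega) (by omega) hne).resolve_right fun h' => ?_
  exact h.asymm (red_sufLt_of_sufLt hf hk' hk h')

/-! ### Suffix arrays -/

/-- `L` is the suffix array of the word `f` of length `N`. -/
structure IsSuffixArray (f : ℕ → ℕ) (N : ℕ) (L : List ℕ) : Prop where
  perm : L.Perm (List.range N)
  sorted : L.Pairwise (sufLt f)

/-- The sorted list of the sampled positions of `f` below `N`, from the suffix array of the
reduced word. -/
def sortedSamples (N : ℕ) (L : List ℕ) : List ℕ := (L.map (samplePos N)).filter (· < N)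

theorem sortedSamples_pairwise {L : List ℕ} (hf : IsWord f N)
    (hL : IsSuffixArray (red f N) (redLen N) L) : (sortedSamples N L).Pairwise (sufLt f) := by
  refine List.Pairwise.filter _ (List.pairwise_map.2 ?_)
  refine hL.sorted.imp_of_mem fun {a b} ha hb h => ?_
  have ha' := List.mem_range.1 (hL.perm.mem_iff.1 ha)
  have hb' := List.mem_range.1 (hL.perm.mem_iff.1 hb)
  exact (red_sufLt_iff hf ha' hb').1 h

theorem mem_sortedSamples {L : List ℕ} (hL : IsSuffixArray (red f N) (redLen N) L) :
    i ∈ sortedSamples N L ↔ i < N ∧ i % 3 ≠ 0 := by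
  have : i ∈ L.map (samplePos N) ↔ i ∈ samples N := (hL.perm.map _).mem_iff
  simp only [sortedSamples, List.mem_filter, this, mem_samples, decide_eq_true_eq]
  omega

theorem nodup_of_sorted {L : List ℕ} (h : L.Pairwise (sufLt f)) : L.Nodup :=
  h.imp fun {a b} h => by rintro rfl; exact sufLt.irrefl h

/-- The positions below `N` that are divisible by 3. -/
def thirds (N : ℕ) : List ℕ := (List.range ((N + 2) / 3)).map (3 * ·)

theorem mem_thirds : i ∈ thirds N ↔ i < N ∧ i % 3 = 0 := by
  simp only [thirds, List.mem_map, List.mem_range]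
  constructor
  · rintro ⟨k, hk, rfl⟩; omega
  · rintro ⟨h₁, h₂⟩; exact ⟨i / 3, by omega, by omega⟩

theorem nodup_thirds : (thirds N).Nodup :=
  List.Nodup.map (fun a b h => by simpa using h) List.nodup_range

open Classical in
/-- Non-strict comparison of suffixes. -/
noncomputable def sufLe (f : ℕ → ℕ) (i j : ℕ) : Bool := decide (¬ sufLt f j i)

/-- Merging asks for a total preorder on all of ℕ, where different positions may have equal
suffixes. Negating the strict order provides one. -/
theorem sufLe_trans (f : ℕ → ℕ) (a b c : ℕ) (h₁ : sufLe f a b = true) (h₂ : sufLe f b c = true) :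
    sufLe f a c = true := by
  simp only [sufLe, decide_eq_true_eq] at *
  intro h
  rcases sufLt_trichotomy f a b with hab | hab | hab
  · exact h₂ (h.trans hab)
  · exact h₂ ⟨h.choose, fun l hl => (h.choose_spec.1 l hl).trans (hab l),
      (hab h.choose) ▸ h.choose_spec.2⟩
  · exact h₁ hab

theorem sufLe_total (f : ℕ → ℕ) (a b : ℕ) : (sufLe f a b || sufLe f b a) = true := by
  simp only [sufLe, Bool.or_eq_true, decide_eq_true_eq]
  by_cases h : sufLt f b a
  · exact .inr h.asymm
  · exact .inl h

theorem sufLe_eq (hf : IsWord f N) (hi : i < N) (hj : j < N) (hij : i ≠ j) :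
    sufLe f i j = true ↔ sufLt f i j := by
  simp only [sufLe, decide_eq_true_eq]
  exact ⟨fun h => (hf.sufLt_or hi.le hj.le hij).resolve_right h, fun h => h.asymm⟩

theorem isSuffixArray_merge {A Z : List ℕ} (hf : IsWord f N)
    (hA : A.Pairwise (sufLt f)) (hZ : Z.Pairwise (sufLt f))
    (mA : ∀ i, i ∈ A ↔ i < N ∧ i % 3 ≠ 0) (mZ : ∀ i, i ∈ Z ↔ i < N ∧ i % 3 = 0) :
    IsSuffixArray f N (A.merge Z (sufLe f)) := by
  have hp : (A.merge Z (sufLe f)).Perm (A ++ Z) := List.merge_perm_append _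
  have hnd : (A ++ Z).Nodup := by
    refine List.nodup_append.2 ⟨nodup_of_sorted hA, nodup_of_sorted hZ, ?_⟩
    intro a ha b hb hab
    have := (mA a).1 ha
    have := (mZ b).1 hb
    omega
  have hmem : ∀ x, x ∈ A ++ Z ↔ x < N := fun x => by
    rw [List.mem_append, mA, mZ]; omega
  refine ⟨hp.trans ((List.perm_ext_iff_of_nodup hnd List.nodup_range).2 fun x => by
    rw [hmem, List.mem_range]), ?_⟩
  have hle : ∀ {L : List ℕ}, L.Pairwise (sufLt f) → L.Pairwise (fun a b => sufLe f a b = true) :=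
    fun h => h.imp fun {a b} h => by simp only [sufLe, decide_eq_true_eq]; exact h.asymm
  have hs := List.pairwise_merge (sufLe_trans f) (sufLe_total f) A Z (hle hA) (hle hZ)
  have hnd' : (A.merge Z (sufLe f)).Nodup := hp.nodup_iff.2 hnd
  refine (hs.and hnd').imp_of_mem fun {a b} ha hb h => ?_
  exact (sufLe_eq hf ((hmem a).1 (hp.mem_iff.1 ha)) ((hmem b).1 (hp.mem_iff.1 hb)) h.2).1 h.1

/-! ### Ranks -/

/-- The array `R` contains the ranks, starting with 1, of the sampled positions of `f`. -/
structure IsSampleRank (N : ℕ) (A : List ℕ) (R : ℕ → ℕ) : Prop where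
  rank : ∀ r (h : r < A.length), R A[r] = r + 1
  zero : R N = 0 ∧ R (N + 1) = 0

section Rank
variable {A : List ℕ} {R : ℕ → ℕ}

/-- The positions N and N + 1, where the suffix is empty, carry the rank 0. Peeling off one or two
letters near the end of the word thus needs no special treatment. -/
theorem IsSampleRank.lt_iff (hR : IsSampleRank N A R) (hf : IsWord f N)
    (hA : A.Pairwise (sufLt f)) (mA : ∀ i, i ∈ A ↔ i < N ∧ i % 3 ≠ 0)
    (hi : i % 3 ≠ 0) (hi' : i ≤ N + 1) (hj : j % 3 ≠ 0) (hj' : j ≤ N + 1) :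
    R i < R j ↔ sufLt f i j := by
  have h0 : ∀ {i}, i ≤ N + 1 → N ≤ i → R i = 0 := fun {i} h₁ h₂ => by
    obtain rfl | rfl : i = N ∨ i = N + 1 := by omega
    · exact hR.zero.1
    · exact hR.zero.2
  by_cases hjN : j < N
  swap
  · rw [h0 hj' (by omega)]
    exact ⟨fun h => by omega, fun h => absurd h (hf.not_sufLt_end (by omega))⟩
  obtain ⟨b, hb, rfl⟩ := List.mem_iff_getElem.1 ((mA j).2 ⟨hjN, hj⟩)
  rw [hR.rank b hb]
  by_cases hiN : i < N
  swap
  · rw [h0 hi' (by omega), hf.sufLt_end (by omega)]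
    simp [hjN]
  obtain ⟨a, ha, rfl⟩ := List.mem_iff_getElem.1 ((mA i).2 ⟨hiN, hi⟩)
  rw [hR.rank a ha, add_lt_add_iff_right]
  have hP := List.pairwise_iff_getElem.1 hA
  refine ⟨hP a b ha hb, fun h => ?_⟩
  rcases lt_trichotomy a b with h' | h' | h'
  · exact h'
  · subst h'; exact absurd h sufLt.irrefl
  · exact absurd h (hP b a hb ha h').asymm

theorem IsSampleRank.le (hR : IsSampleRank N A R) (mA : ∀ i, i ∈ A ↔ i < N ∧ i % 3 ≠ 0)
    (hi : i % 3 ≠ 0) (hi' : i ≤ N + 1) : R i ≤ A.length := by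
  by_cases hiN : i < N
  · obtain ⟨a, ha, rfl⟩ := List.mem_iff_getElem.1 ((mA i).2 ⟨hiN, hi⟩)
    rw [hR.rank a ha]; omega
  · obtain rfl | rfl : i = N ∨ i = N + 1 := by omega
    · rw [hR.zero.1]; omega
    · rw [hR.zero.2]; omega

/-- The suffix at a multiple of 3 consists of one letter and a sampled suffix. A pass by the rank of
the latter followed by a stable pass by the letter sorts these suffixes; a tie in both keys would
contradict that different suffixes are comparable. -/
theorem thirds_sorted {K K' : ℕ} (hR : IsSampleRank N A R) (hf : IsWord f N)
    (hA : A.Pairwise (sufLt f)) (mA : ∀ i, i ∈ A ↔ i < N ∧ i % 3 ≠ 0)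
    (hK : ∀ a ∈ thirds N, R (a + 1) < K) :
    (WordRAM.bsort f K' (WordRAM.bsort (fun a => R (a + 1)) K (thirds N))).Pairwise (sufLt f) := by
  refine (WordRAM.bsort_pairwise f K'
    (WordRAM.bsort_pairwise (fun a => R (a + 1)) K nodup_thirds)).imp_of_mem ?_
  intro a b ha hb h
  have hm : ∀ x, x ∈ WordRAM.bsort f K' (WordRAM.bsort (fun a => R (a + 1)) K (thirds N)) →
      x < N ∧ x % 3 = 0 := fun x hx => by
    have h₁ := (List.mem_filter.1 ((WordRAM.bsort_perm' _ _ _).mem_iff.1 hx)).1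
    exact mem_thirds.1 ((WordRAM.bsort_perm hK).mem_iff.1 h₁)
  obtain ⟨a₁, a₂⟩ := hm a ha
  obtain ⟨b₁, b₂⟩ := hm b hb
  rw [sufLt_iff_head]
  rcases h with h | ⟨h, h' | ⟨h', hne⟩⟩
  · exact .inl h
  · exact .inr ⟨h, (hR.lt_iff hf hA mA (by omega) (by omega) (by omega) (by omega)).1 h'⟩
  · refine (hf.sufLt_or a₁.le b₁.le hne).elim sufLt_iff_head.1 fun h'' => ?_
    rcases sufLt_iff_head.1 h'' with h₃ | ⟨_, h₃⟩
    · omega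
    · have := (hR.lt_iff hf hA mA (by omega) (by omega) (by omega) (by omega)).2 h₃
      omega

/-- The residues 1 and 0 become 2 and 1 after one letter, both sampled. In `sufLt_iff_two` the
residues 2 and 0 would become 0 and 1, and only after two letters are they the sampled residues 1
and 2. -/
theorem sufLt_iff_one (hR : IsSampleRank N A R) (hf : IsWord f N)
    (hA : A.Pairwise (sufLt f)) (mA : ∀ i, i ∈ A ↔ i < N ∧ i % 3 ≠ 0)
    (hi : i < N) (hi' : i % 3 = 1) (hj : j < N) (hj' : j % 3 = 0) :
    sufLt f i j ↔ f i < f j ∨ f i = f j ∧ R (i + 1) < R (j + 1) := by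
  rw [sufLt_iff_head, hR.lt_iff hf hA mA (by omega) (by omega) (by omega) (by omega)]

theorem sufLt_iff_two (hR : IsSampleRank N A R) (hf : IsWord f N)
    (hA : A.Pairwise (sufLt f)) (mA : ∀ i, i ∈ A ↔ i < N ∧ i % 3 ≠ 0)
    (hi : i < N) (hi' : i % 3 = 2) (hj : j < N) (hj' : j % 3 = 0) :
    sufLt f i j ↔ f i < f j ∨ f i = f j ∧ (f (i + 1) < f (j + 1) ∨
      f (i + 1) = f (j + 1) ∧ R (i + 2) < R (j + 2)) := by
  rw [sufLt_iff_head, sufLt_iff_head (i := i + 1),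
    hR.lt_iff hf hA mA (by omega) (by omega) (by omega) (by omega)]

end Rank

/-! ### Longest common prefixes -/

/-- `m` is the minimum of `V` on the interval `[l, r)`. -/
def IsMin (V : ℕ → ℕ) (l r m : ℕ) : Prop :=
  (∃ x, l ≤ x ∧ x < r ∧ V x = m) ∧ ∀ x, l ≤ x → x < r → m ≤ V x

theorem IsMin.union {V : ℕ → ℕ} {l r l' r' a b : ℕ} (h₁ : IsMin V l r a) (h₂ : IsMin V l' r' b)
    (hl : l ≤ l') (hm : l' ≤ r) (hr : r ≤ r') : IsMin V l r' (min a b) := by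
  obtain ⟨⟨x, hx₁, hx₂, hx⟩, ha⟩ := h₁
  obtain ⟨⟨y, hy₁, hy₂, hy⟩, hb⟩ := h₂
  refine ⟨?_, fun z h₁ h₂ => ?_⟩
  · rcases le_total a b with h | h
    · exact ⟨x, by omega, by omega, by rw [min_eq_left h, hx]⟩
    · exact ⟨y, by omega, by omega, by rw [min_eq_right h, hy]⟩
  · by_cases hz : z < r
    · exact (min_le_left _ _).trans (ha z h₁ hz)
    · exact (min_le_right _ _).trans (hb z (by omega) h₂)

theorem IsMin.unique {V : ℕ → ℕ} {l r a b : ℕ} (h₁ : IsMin V l r a) (h₂ : IsMin V l r b) :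
    a = b := by
  obtain ⟨⟨x, hx₁, hx₂, hx⟩, ha⟩ := h₁
  obtain ⟨⟨y, hy₁, hy₂, hy⟩, hb⟩ := h₂
  have := ha y hy₁ hy₂
  have := hb x hx₁ hx₂
  omega

section Lcp
variable {sa : ℕ → ℕ}

/-- Induction on b with the sandwich lemma `IsLce.trans`: passing to the next suffix in the sorted
order takes the minimum with one more entry. Entry r + 1 belongs to the neighbours r and r + 1,
which explains the interval from a + 1 to b. -/
theorem isLce_of_isMin {V : ℕ → ℕ} (hs : ∀ a b, a < b → b < N → sufLt f (sa a) (sa b))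
    (hV : ∀ r, r + 1 < N → IsLce f (sa r) (sa (r + 1)) (V (r + 1))) {a b m : ℕ} (hab : a < b)
    (hb : b < N) (hm : IsMin V (a + 1) (b + 1) m) : IsLce f (sa a) (sa b) m := by
  induction b, hab using Nat.le_induction generalizing m with
  | base =>
    obtain ⟨⟨x, hx₁, hx₂, rfl⟩, -⟩ := hm
    obtain rfl : x = a + 1 := by omega
    exact hV a hb
  | succ b hab ih =>
    obtain ⟨k, hk, -⟩ := (hs a b hab (by omega)).exists_isLce
    obtain ⟨m', hm'⟩ : ∃ m', IsMin V (a + 1) (b + 1) m' := by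
      obtain ⟨x, hx, hmin⟩ := Finset.exists_min_image (Finset.Ico (a + 1) (b + 1)) V
        ⟨a + 1, by simp; omega⟩
      rw [Finset.mem_Ico] at hx
      exact ⟨V x, ⟨x, hx.1, hx.2, rfl⟩, fun y h₁ h₂ => hmin y (Finset.mem_Ico.2 ⟨h₁, h₂⟩)⟩
    have h₁ := ih (by omega) hm'
    have h₂ : IsMin V (b + 1) (b + 1 + 1) (V (b + 1)) :=
      ⟨⟨b + 1, le_rfl, by omega, rfl⟩, fun x h₁ h₂ => by
        obtain rfl : x = b + 1 := by omega
        exact le_rfl⟩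
    rw [hm.unique (hm'.union h₂ (by omega) le_rfl (by omega))]
    exact (IsLce.trans (hs a b hab (by omega)) (hs b (b + 1) (by omega) hb) h₁ (hV b hb)).1

/-- Let j be the predecessor of i in the suffix array. Deleting the first letters leaves j + 1
before i + 1, with h - 1 common letters. The predecessor of i + 1 is j + 1 or lies between the two,
hence shares at least as many letters with i + 1. -/
theorem kasai_step {rk : ℕ → ℕ} {h : ℕ} (hf : IsWord f N)
    (hs : ∀ a b, a < b → b < N → sufLt f (sa a) (sa b))
    (hrk : ∀ i < N, rk i < N ∧ sa (rk i) = i) (hsa : ∀ r < N, sa r < N ∧ rk (sa r) = r)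
    (hi : i < N) (h₁ : 1 ≤ rk i) (hl : IsLce f (sa (rk i - 1)) i h) (h₂ : 2 ≤ h) :
    i + 1 < N ∧ 1 ≤ rk (i + 1) ∧
      ∀ l < h - 1, f (sa (rk (i + 1) - 1) + l) = f (i + 1 + l) := by
  obtain ⟨hri, hsi⟩ := hrk i hi
  have hj := (hsa (rk i - 1) (by omega)).1
  have hji : sufLt f (sa (rk i - 1)) i := by
    have := hs (rk i - 1) (rk i) (by omega) hri
    rwa [hsi] at this
  generalize sa (rk i - 1) = j at *
  have hne : j ≠ i := by rintro rfl; exact sufLt.irrefl hji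
  have e₁ := hl.1 1 (by omega)
  have hj' : j + 1 < N := by
    by_contra hn
    rw [hf.zero (j + 1) (by omega), eq_comm, hf.eq_zero_iff] at e₁
    omega
  have hi' : i + 1 < N := by
    have := hf.pos _ hj'
    by_contra hn
    rw [hf.zero (i + 1) (by omega)] at e₁
    omega
  have hlt : sufLt f (j + 1) (i + 1) := by
    rcases sufLt_iff_head.1 hji with h' | h'
    · have := hl.1 0 (by omega)
      simp only [add_zero] at this; omega
    · exact h'.2
  obtain ⟨ri, si⟩ := hrk (i + 1) hi'
  obtain ⟨rj, sj⟩ := hrk (j + 1) hj'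
  have hr : rk (j + 1) < rk (i + 1) := by
    rcases lt_trichotomy (rk (j + 1)) (rk (i + 1)) with h' | h' | h'
    · exact h'
    · rw [← sj, ← si, h'] at hlt; exact absurd hlt sufLt.irrefl
    · have := hs _ _ h' rj
      rw [si, sj] at this
      exact absurd this hlt.asymm
  refine ⟨hi', by omega, ?_⟩
  have hagree : ∀ l < h - 1, f (j + 1 + l) = f (i + 1 + l) := fun l hl' => by
    have := hl.1 (l + 1) (by omega)
    rwa [show j + 1 + l = j + (l + 1) by ring, show i + 1 + l = i + (l + 1) by ring]
  by_cases he : rk (j + 1) = rk (i + 1) - 1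
  · rw [← he, sj]; exact hagree
  · have q₁ := hs (rk (j + 1)) (rk (i + 1) - 1) (by omega) (by omega)
    have q₂ := hs (rk (i + 1) - 1) (rk (i + 1)) (by omega) ri
    rw [sj] at q₁
    rw [si] at q₂
    obtain ⟨x, hx, -⟩ := q₁.exists_isLce
    obtain ⟨y, hy, -⟩ := q₂.exists_isLce
    have := (IsLce.trans q₁ q₂ hx hy).1.le_of_forall hagree
    exact fun l hl => hy.1 l (by omega)

end Lcp

end Suffix

/-! ## The reduction step of the suffix sorting -/

namespace WordRAM
open Suffix

theorem Holds.map_range_iff {g : ℕ → ℕ} {f : ℕ → ℕ} {n : ℕ} :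
    Holds f ((List.range n).map g) ↔ ∀ i < n, f i = g i := by
  simp [Holds]

/-- List the sampled positions in the array 3. -/
def listSamples : Prog :=
  14 ≔ 0 ;;
  .loop (lt (.reg 14) (.reg 13))
    (.cond (lt (.reg 14) (.reg 16))
      (.store 3 (.reg 14) (3 * .reg 14 + 1)) (.store 3 (.reg 14) (3 * (.reg 14 - .reg 16) + 2)) ;;
     14 ≔ .reg 14 + 1)

theorem listSamples_run {W N : ℕ} {s : State} (hW : 3 * N + 10 < 2 ^ W)
    (h13 : s.reg 13 = redLen N) (h16 : s.reg 16 = (N + 2) / 3) :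
    Run W listSamples (100 * (N + 2)) s fun s' => Holds (s'.mem 3) (samples N) := by
  have hr : redLen N ≤ N + 1 := by unfold redLen; omega
  refine Run.assign 0 (by simp (disch := omega)) (T₂ := 100 * N + 190) ?_
    (by simp [Expr.cost]; omega)
  refine Run.loop_den (fun s' => s'.reg 14 ≤ redLen N ∧
      ∀ i < s'.reg 14, s'.mem 3 i = samplePos N i) (fun s' => redLen N - s'.reg 14)
      (by simp) rfl ?_ ?_ ?_
  · rintro s' hf ⟨hk, hI⟩ he
    have e13 : s'.reg 13 = redLen N := by rw [hf.reg 13 rfl]; simpa using h13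
    have e16 : s'.reg 16 = (N + 2) / 3 := by rw [hf.reg 16 rfl]; simpa using h16
    generalize hkk : s'.reg 14 = k at *
    have hkN : k < redLen N := by simpa (disch := omega) [hkk, e13] using he
    have e : Prog.den W (.cond (lt (.reg 14) (.reg 16))
        (.store 3 (.reg 14) (3 * .reg 14 + 1)) (.store 3 (.reg 14) (3 * (.reg 14 - .reg 16) + 2)) ;;
        14 ≔ .reg 14 + 1) s' = (s'.setMem 3 k (samplePos N k)).setReg 14 (k + 1) := by
      unfold samplePos
      by_cases h : k < (N + 2) / 3 <;> simp (disch := omega) [Prog.den, hkk, e16, h]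
    rw [e]
    refine ⟨⟨by simpa using hkN, fun i hi => ?_⟩, by simp; omega⟩
    simp only [State.setReg_reg, if_true] at hi
    by_cases hik : i = k
    · simp [hik]
    · simpa [hik] using hI i (by omega)
  · simp [Prog.bound, Expr.cost]; omega
  · rintro s' hf ⟨hk, hI⟩ he
    have e13 : s'.reg 13 = redLen N := by rw [hf.reg 13 rfl]; simpa using h13
    have : ¬ s'.reg 14 < redLen N := by simpa (disch := omega) [e13] using he
    exact Holds.map_range_iff.2 fun i hi => hI i (by omega)

/-- Sort the sampled positions in the array 3 by their triples, into the array 4. -/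
def sortTriples : Prog :=
  radixPass 3 4 (.load 2 (.reg 11 + .reg 20 + 2)) ;;
  radixPass 4 3 (.load 2 (.reg 11 + .reg 20 + 1)) ;;
  radixPass 3 4 (.load 2 (.reg 11 + .reg 20))

/-- Radix sort from the last letter of the triples to the first. Since N may be sampled, letters up
to position N + 2 are read, and therefore each word occupies N + 3 cells. -/
theorem sortTriples_run {W N off : ℕ} {s : State} {f : ℕ → ℕ}
    (hW : (2 * N + 1) * (2 * N + 1) < 2 ^ W) (hW' : off + 6 * N + 10 < 2 ^ W) (hN : 2 ≤ N)
    (h11 : s.reg 11 = off) (h21 : s.reg 21 = redLen N) (h22 : s.reg 22 = 2 * N + 1)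
    (hS : ∀ i ≤ N + 2, s.mem 2 (off + i) = f i) (hfK : ∀ i, f i ≤ 2 * N)
    (h3 : Holds (s.mem 3) (samples N)) (h18 : ∀ v, s.mem 18 v = 0) :
    Run W sortTriples (10000 * N) s fun s' => (∀ v, s'.mem 18 v = 0) ∧
      ∃ B : List ℕ, Holds (s'.mem 4) B ∧ B.Perm (samples N) ∧
        B.Pairwise (fun a b => ¬ tripleLt f b a) := by
  have hlen : (samples N).length = redLen N := length_samples
  have hlt := redLen_lt hN
  have hm : ∀ {a}, a ∈ samples N → a ≤ N := fun {a} ha => by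
    have := mem_samples.1 ha; omega
  have hκ : ∀ j, ∀ x ∈ samples N, f (x + j) < 2 * N + 1 := fun j x _ => by
    have := hfK (x + j); omega
  refine Run.seq (T₁ := 100 * 8 * (2 * N + 2)) (T₂ := 200 * 8 * (2 * N + 2))
    (radixPass_run (κ := fun a => f (a + 2)) (L := samples N) hW
    (by decide) (by decide) (by decide) (by decide) (by rw [h21, hlen]) h22 (by omega) h3 (hκ 2)
    (fun s' hf ha => ?_) h18) ?_ (by omega)
  · have := hm ha
    have e11 : s'.reg 11 = off := by rw [hf.reg 11 rfl, h11]
    have e2 : s'.mem 2 = s.mem 2 := hf.mem 2 rfl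
    simp (disch := omega) [e11, e2]
    rw [add_assoc]; exact hS _ (by omega)
  rintro s₁ hf₁ ⟨hB₁, h18₁⟩
  have hp₁ := bsort_perm (hκ 2)
  generalize hB₁e : bsort (fun a => f (a + 2)) (2 * N + 1) (samples N) = B₁ at *
  have hw₁ : B₁.Pairwise (fun a b => f (a + 2) < f (b + 2) ∨ f (a + 2) = f (b + 2) ∧ True) := by
    rw [← hB₁e]; exact bsort_pairwise _ _ (List.pairwise_of_forall fun _ _ => trivial)
  have hκ₁ : ∀ x ∈ B₁, f (x + 1) < 2 * N + 1 := fun x hx => hκ 1 x (hp₁.mem_iff.1 hx)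
  refine Run.seq (T₁ := 100 * 8 * (2 * N + 2)) (T₂ := 100 * 8 * (2 * N + 2))
    (radixPass_run (κ := fun a => f (a + 1)) (L := B₁) hW
    (by decide) (by decide) (by decide) (by decide) (by rw [hf₁.reg 21 rfl, h21, hp₁.length_eq, hlen])
    (by rw [hf₁.reg 22 rfl, h22]) (by rw [hp₁.length_eq]; omega) hB₁ hκ₁
    (fun s' hf ha => ?_) h18₁) ?_ (by omega)
  · have := hm (hp₁.mem_iff.1 ha)
    have e11 : s'.reg 11 = off := by rw [hf.reg 11 rfl, hf₁.reg 11 rfl, h11]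
    have e2 : s'.mem 2 = s.mem 2 := by rw [hf.mem 2 rfl, hf₁.mem 2 rfl]
    simp (disch := omega) [e11, e2]
    rw [add_assoc]; exact hS _ (by omega)
  rintro s₂ hf₂ ⟨hB₂, h18₂⟩
  have hp₂ := (bsort_perm hκ₁).trans hp₁
  have hw₂ := bsort_pairwise (fun a => f (a + 1)) (2 * N + 1) hw₁
  generalize bsort (fun a => f (a + 1)) (2 * N + 1) B₁ = B₂ at *
  have hκ₂ : ∀ x ∈ B₂, f x < 2 * N + 1 := fun x hx => hκ 0 x (hp₂.mem_iff.1 hx)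
  refine Run.mono (T₁ := 100 * 8 * (2 * N + 2))
    ((radixPass_run (κ := f) (L := B₂) hW
    (by decide) (by decide) (by decide) (by decide)
    (by rw [hf₂.reg 21 rfl, hf₁.reg 21 rfl, h21, hp₂.length_eq, hlen])
    (by rw [hf₂.reg 22 rfl, hf₁.reg 22 rfl, h22]) (by rw [hp₂.length_eq]; omega) hB₂ hκ₂
    (fun s' hf ha => ?_) h18₂).mono (by simp [Expr.cost]) (fun _ _ h => h)) le_rfl ?_
  · have := hm (hp₂.mem_iff.1 ha)
    have e11 : s'.reg 11 = off := by rw [hf.reg 11 rfl, hf₂.reg 11 rfl, hf₁.reg 11 rfl, h11]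
    have e2 : s'.mem 2 = s.mem 2 := by rw [hf.mem 2 rfl, hf₂.mem 2 rfl, hf₁.mem 2 rfl]
    simp (disch := omega) [e11, e2]
    exact hS _ (by omega)
  rintro s₃ - ⟨hB₃, h18₃⟩
  refine ⟨h18₃, _, hB₃, (bsort_perm hκ₂).trans hp₂, ?_⟩
  refine (bsort_pairwise f (2 * N + 1) hw₂).imp fun {a b} h => ?_
  unfold tripleLt
  omega

/-- In sorted order the triples smaller than the one at a form an initial segment, and its length is
the number that the name counts. -/
theorem red_sampleIdx_eq {f : ℕ → ℕ} {N a r₀ : ℕ} {B : List ℕ} (hB : B.Perm (samples N))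
    (ha : a ∈ samples N) (hr : r₀ ≤ B.length) (h₁ : ∀ x (h : x < B.length), x < r₀ → tripleLt f B[x] a)
    (h₂ : ∀ x (h : x < B.length), r₀ ≤ x → ¬ tripleLt f B[x] a) :
    red f N (sampleIdx N a) = r₀ + 1 := by
  obtain ⟨p₁, p₂⟩ := samplePos_sampleIdx (mem_samples.1 ha).1 (mem_samples.1 ha).2
  rw [red, if_pos p₂, p₁, ← hB.countP_eq, ← List.take_append_drop r₀ B, List.countP_append,
    List.countP_eq_length.2, List.countP_eq_zero.2, List.length_take_of_le hr]
  · ring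
  · intro x hx
    obtain ⟨i, hi, rfl⟩ := List.mem_iff_getElem.1 hx
    simp only [List.length_drop] at hi
    simpa using h₂ (r₀ + i) (by omega) (by omega)
  · intro x hx
    obtain ⟨i, hi, rfl⟩ := List.mem_iff_getElem.1 hx
    simp only [List.length_take] at hi
    simpa using h₁ i (by omega) (by omega)

/-- Write the rank of the next triple to the reduced word. -/
def nameTriple : Prog :=
  28 ≔ .load 4 (.reg 14) ;; 29 ≔ .load 4 (.reg 14 - 1) ;;
   .cond (eq (.load 2 (.reg 11 + .reg 28)) (.load 2 (.reg 11 + .reg 29)))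
    (.cond (eq (.load 2 (.reg 11 + .reg 28 + 1)) (.load 2 (.reg 11 + .reg 29 + 1)))
      (.cond (eq (.load 2 (.reg 11 + .reg 28 + 2)) (.load 2 (.reg 11 + .reg 29 + 2)))
        .skip (15 ≔ .reg 14 + 1)) (15 ≔ .reg 14 + 1)) (15 ≔ .reg 14 + 1) ;;
   .cond (eq (.reg 28 % 3) 1)
    (.store 2 (.reg 17 + .reg 28 / 3) (.reg 15))
    (.store 2 (.reg 17 + (.reg 16 + .reg 28 / 3)) (.reg 15)) ;;
   14 ≔ .reg 14 + 1

/-- Write the ranks of the triples to the reduced word. -/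
def nameTriples : Prog :=
  14 ≔ 0 ;; 15 ≔ 1 ;;
  .loop (lt (.reg 14) (.reg 13))
    nameTriple

theorem nameTriples_run {W N off : ℕ} {s : State} {f : ℕ → ℕ} {B : List ℕ}
    (hW : off + 6 * N + 10 < 2 ^ W) (hN : 2 ≤ N)
    (h11 : s.reg 11 = off) (h13 : s.reg 13 = redLen N) (h16 : s.reg 16 = (N + 2) / 3)
    (h17 : s.reg 17 = off + N + 3)
    (hS : ∀ i ≤ N + 2, s.mem 2 (off + i) = f i)
    (h4 : Holds (s.mem 4) B) (hB : B.Perm (samples N))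
    (hs : B.Pairwise (fun a b => ¬ tripleLt f b a)) :
    Run W nameTriples (100 * (N + 2)) s fun s' =>
      (∀ k < redLen N, s'.mem 2 (off + N + 3 + k) = red f N k) ∧
      ∀ x, x < off + N + 3 ∨ off + N + 3 + redLen N ≤ x → s'.mem 2 x = s.mem 2 x := by
  have hlt := redLen_lt hN
  have hr1 : 1 ≤ redLen N := by unfold redLen; omega
  have hlen : B.length = redLen N := by rw [hB.length_eq, length_samples]
  have hPair := List.pairwise_iff_getElem.1 hs
  have hmem : ∀ r, r < redLen N → s.mem 4 r ∈ samples N := fun r hr => by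
    rw [h4 r (by omega)]; exact hB.mem_iff.1 (List.getElem_mem _)
  have hm : ∀ {a}, a ∈ samples N → a ≤ N := fun {a} ha => by
    have := mem_samples.1 ha; omega
  have hle : ∀ x y, x < y → y < redLen N → ¬ tripleLt f (s.mem 4 y) (s.mem 4 x) :=
    fun x y hxy hy => by
      rw [h4 x (by omega), h4 y (by omega)]; exact hPair x y (by omega) (by omega) hxy
  generalize hb : s.mem 4 = b at *
  refine Run.assign 0 (by simp (disch := omega)) (T₂ := 100 * N + 190) ?_
    (by simp [Expr.cost]; omega)
  -- Since `0 - 1 = 0`, the first triple is compared with itself and keeps this initial name. From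
  -- then on register 15 is one more than the index of the first triple equal to the current one.
  refine Run.assign 1 (by simp (disch := omega)) (T₂ := 100 * N + 180) ?_
    (by simp [Expr.cost]; omega)
  refine Run.loop_den (fun s' => s'.reg 14 ≤ redLen N ∧
      (∀ r < s'.reg 14, s'.mem 2 (off + N + 3 + sampleIdx N (b r)) = red f N (sampleIdx N (b r))) ∧
      (∀ x, x < off + N + 3 ∨ off + N + 3 + redLen N ≤ x → s'.mem 2 x = s.mem 2 x) ∧
      ∃ r₀ ≤ s'.reg 14 - 1, s'.reg 15 = r₀ + 1 ∧ tripleEq f (b r₀) (b (s'.reg 14 - 1)) ∧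
        ∀ x < r₀, tripleLt f (b x) (b (s'.reg 14 - 1)))
      (fun s' => redLen N - s'.reg 14) ?_ rfl ?_ ?_ ?_
  · refine ⟨by simp, by simp, by simp, 0, by simp, by simp, by simp [tripleEq], by simp⟩
  · rintro s' hf ⟨hk, hI₁, hI₂, r₀, hr₀, h15, hE, hL⟩ he
    have e11 : s'.reg 11 = off := by rw [hf.reg 11 rfl]; simpa using h11
    have e13 : s'.reg 13 = redLen N := by rw [hf.reg 13 rfl]; simpa using h13
    have e16 : s'.reg 16 = (N + 2) / 3 := by rw [hf.reg 16 rfl]; simpa using h16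
    have e17 : s'.reg 17 = off + N + 3 := by rw [hf.reg 17 rfl]; simpa using h17
    have e4 : s'.mem 4 = b := by rw [hf.mem 4 rfl]; simpa using hb
    generalize hkk : s'.reg 14 = k at *
    have hkN : k < redLen N := by simpa (disch := omega) [hkk, e13] using he
    have ha := hmem k hkN
    have hp := hm (hmem (k - 1) (by omega))
    have haN := hm ha
    have hidx := (samplePos_sampleIdx (mem_samples.1 ha).1 (mem_samples.1 ha).2).2
    have hf2 : ∀ i ≤ N + 2, s'.mem 2 (off + i) = f i := fun i hi => by
      rw [hI₂ _ (by omega), hS i hi]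
    -- the name of the new triple
    obtain ⟨v, r₁, hr₁, hv, hE₁, hL₁, hv'⟩ : ∃ v, ∃ r₁ ≤ k, v = r₁ + 1 ∧
        tripleEq f (b r₁) (b k) ∧ (∀ x < r₁, tripleLt f (b x) (b k)) ∧
        v = if tripleEq f (b k) (b (k - 1)) then s'.reg 15 else k + 1 := by
      by_cases h : tripleEq f (b k) (b (k - 1))
      · refine ⟨s'.reg 15, r₀, by omega, h15, ?_, fun x hx => ?_, by rw [if_pos h]⟩
        · unfold tripleEq at *; omega
        · have := hL x hx
          unfold tripleEq at *; unfold tripleLt at *; omega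
      · refine ⟨k + 1, k, le_rfl, rfl, ⟨rfl, rfl, rfl⟩, fun x hx => ?_, by rw [if_neg h]⟩
        have hk1 := hle (k - 1) k (by omega) hkN
        have hxk : x = k - 1 ∨ ¬ tripleLt f (b (k - 1)) (b x) := by
          by_cases hxe : x = k - 1
          · exact .inl hxe
          · exact .inr (hle x (k - 1) (by omega) (by omega))
        rcases hxk with rfl | hxk
        · unfold tripleEq at *; unfold tripleLt at *; omega
        · unfold tripleEq at *; unfold tripleLt at *; omega
    have hval : red f N (sampleIdx N (b k)) = v := by
      rw [hv]
      refine red_sampleIdx_eq hB ha (by omega) (fun x h hx => ?_) (fun x h hx => ?_)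
      · rw [← h4 x h]; exact hL₁ x hx
      · rw [← h4 x h]
        rcases hx.eq_or_lt with rfl | hx
        · unfold tripleEq at hE₁; unfold tripleLt; omega
        · have := hle r₁ x hx (by omega)
          unfold tripleEq at hE₁; unfold tripleLt at *; omega
    have e₁ : Prog.den W (.cond (eq (.load 2 (.reg 11 + .reg 28)) (.load 2 (.reg 11 + .reg 29)))
      (.cond (eq (.load 2 (.reg 11 + .reg 28 + 1)) (.load 2 (.reg 11 + .reg 29 + 1)))
        (.cond (eq (.load 2 (.reg 11 + .reg 28 + 2)) (.load 2 (.reg 11 + .reg 29 + 2)))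
          .skip (15 ≔ .reg 14 + 1)) (15 ≔ .reg 14 + 1)) (15 ≔ .reg 14 + 1))
        ((s'.setReg 28 (b k)).setReg 29 (b (k - 1))) =
        if tripleEq f (b k) (b (k - 1)) then (s'.setReg 28 (b k)).setReg 29 (b (k - 1))
        else ((s'.setReg 28 (b k)).setReg 29 (b (k - 1))).setReg 15 (k + 1) := by
      unfold tripleEq
      by_cases h₀ : f (b k) = f (b (k - 1))
      · by_cases h₁ : f (b k + 1) = f (b (k - 1) + 1)
        · by_cases h₂ : f (b k + 2) = f (b (k - 1) + 2)
          · simp (disch := omega) [Prog.den, hkk, e11, hf2, h₀, h₁, h₂, add_assoc]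
          · simp (disch := omega) [Prog.den, hkk, e11, hf2, h₀, h₁, h₂, add_assoc]
        · simp (disch := omega) [Prog.den, hkk, e11, hf2, h₀, h₁, add_assoc]
      · simp (disch := omega) [Prog.den, hkk, e11, hf2, h₀]
    have e₂ : ∀ s₁ : State, s₁.reg 28 = b k → s₁.reg 17 = off + N + 3 →
        s₁.reg 16 = (N + 2) / 3 → s₁.reg 15 = v → s₁.reg 14 = k → Prog.den W
        (.cond (eq (.reg 28 % 3) 1) (.store 2 (.reg 17 + .reg 28 / 3) (.reg 15))
      (.store 2 (.reg 17 + (.reg 16 + .reg 28 / 3)) (.reg 15)) ;; 14 ≔ .reg 14 + 1) s₁ =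
        (s₁.setMem 2 (off + N + 3 + sampleIdx N (b k)) v).setReg 14 (k + 1) := by
      intro s₁ q₁ q₂ q₃ q₄ q₅
      unfold sampleIdx
      by_cases h : b k % 3 = 1 <;> simp (disch := omega) [Prog.den, q₁, q₂, q₃, q₄, q₅, h]
    obtain ⟨s₁, hs₁, hs₁m, hs₁r⟩ : ∃ s₁ : State, s₁.mem = s'.mem ∧ s₁.reg 15 = v ∧ Prog.den W
        nameTriple s' =
        (s₁.setMem 2 (off + N + 3 + sampleIdx N (b k)) v).setReg 14 (k + 1) := by
      refine ⟨if tripleEq f (b k) (b (k - 1)) then (s'.setReg 28 (b k)).setReg 29 (b (k - 1))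
        else ((s'.setReg 28 (b k)).setReg 29 (b (k - 1))).setReg 15 (k + 1), ?_, ?_, ?_⟩
      · split_ifs <;> rfl
      · rw [hv']; split_ifs <;> simp
      · have e₀ : (28 ≔ .load 4 (.reg 14)).den W s' = s'.setReg 28 (b k) := by
          simp [Prog.den, hkk, e4]
        have e₀' : (29 ≔ .load 4 (.reg 14 - 1)).den W (s'.setReg 28 (b k)) =
            (s'.setReg 28 (b k)).setReg 29 (b (k - 1)) := by
          simp (disch := omega) [Prog.den, hkk, e4]
        rw [nameTriple, Prog.den, e₀, Prog.den, e₀', Prog.den, e₁]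
        refine e₂ _ ?_ ?_ ?_ ?_ ?_
        · split_ifs <;> simp
        · split_ifs <;> simpa using e17
        · split_ifs <;> simpa using e16
        · rw [hv']; split_ifs <;> simp
        · split_ifs <;> simpa using hkk
    rw [hs₁r]
    simp only [State.setReg_reg, State.setReg_mem, State.setMem_mem, State.setMem_reg, hs₁, if_true,
      true_and, Nat.add_sub_cancel, Nat.reduceEqDiff, if_false]
    refine ⟨⟨hkN, fun r hr => ?_, fun x hx => ?_, r₁, hr₁, ?_, hE₁, hL₁⟩, by omega⟩
    · split_ifs with h
      · have : sampleIdx N (b r) = sampleIdx N (b k) := by omega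
        rw [this, hval]
      · refine hI₁ r (lt_of_le_of_ne (by omega) ?_)
        rintro rfl; exact h rfl
    · rw [if_neg (by omega)]; exact hI₂ x hx
    · rw [hs₁m, hv]
  · simp [nameTriple, Prog.bound, Expr.cost]; omega
  · rintro s' hf ⟨hk, hI₁, hI₂, -⟩ he
    have e13 : s'.reg 13 = redLen N := by rw [hf.reg 13 rfl]; simpa using h13
    have hkr : ¬ s'.reg 14 < redLen N := by simpa (disch := omega) [e13] using he
    refine ⟨fun k hk => ?_, hI₂⟩
    have hkm : samplePos N k ∈ B := hB.mem_iff.2 (List.mem_map.2 ⟨k, List.mem_range.2 hk, rfl⟩)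
    obtain ⟨r, hr, e⟩ := List.mem_iff_getElem.1 hkm
    have := hI₁ r (by omega)
    rwa [h4 r hr, e, sampleIdx_samplePos N k] at this

/-- Append the reduced word of the current word to the stack of words in the array 2. The length
of the current word is in the register 10, its offset is in the register 11. -/
def reduceStep : Prog :=
  16 ≔ (.reg 10 + 2) / 3 ;; 13 ≔ .reg 16 + .reg 10 / 3 ;; listSamples ;;
  21 ≔ .reg 13 ;; 22 ≔ 2 * .reg 10 + 1 ;; 17 ≔ .reg 11 + .reg 10 + 3 ;; sortTriples ;; nameTriples ;;
  .store 7 (.reg 12) (.reg 10) ;; 12 ≔ .reg 12 + 1 ;; 11 ≔ .reg 17 ;; 10 ≔ .reg 13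

/-- The cells above the stack are still 0, and they supply the padding behind the new word. -/
theorem reduceStep_run {W N off ℓ : ℕ} {s : State} {f : ℕ → ℕ}
    (hW : (2 * N + 1) * (2 * N + 1) < 2 ^ W) (hW' : off + 6 * N + 20 < 2 ^ W) (hℓ : ℓ + 1 < 2 ^ W)
    (hN : 2 ≤ N) (h10 : s.reg 10 = N) (h11 : s.reg 11 = off) (h12 : s.reg 12 = ℓ)
    (hS : ∀ i ≤ N + 2, s.mem 2 (off + i) = f i) (hfK : ∀ i, f i ≤ 2 * N)
    (hS0 : ∀ x, off + N + 3 ≤ x → s.mem 2 x = 0) (h18 : ∀ v, s.mem 18 v = 0) :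
    Run W reduceStep (20000 * N) s fun s' =>
      s'.reg 10 = redLen N ∧ s'.reg 11 = off + N + 3 ∧ s'.reg 12 = ℓ + 1 ∧
      (∀ k ≤ redLen N + 2, s'.mem 2 (off + N + 3 + k) = red f N k) ∧
      (∀ x < off + N + 3, s'.mem 2 x = s.mem 2 x) ∧
      (∀ x, off + N + 3 + redLen N + 3 ≤ x → s'.mem 2 x = 0) ∧
      s'.mem 7 ℓ = N ∧ (∀ x, x ≠ ℓ → s'.mem 7 x = s.mem 7 x) ∧ ∀ v, s'.mem 18 v = 0 := by
  have hlt := redLen_lt hN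
  refine Run.assign ((N + 2) / 3) (by simp (disch := omega) [h10]) (T₂ := 20000 * N - 10) ?_
    (by simp [Expr.cost]; omega)
  refine Run.assign (redLen N) (by simp (disch := omega) [h10]; rfl) (T₂ := 20000 * N - 20) ?_
    (by simp [Expr.cost]; omega)
  refine Run.seq (T₁ := 100 * (N + 2)) (T₂ := 20000 * N - 1000 * N)
    (listSamples_run (N := N) (by omega) (by simp) (by simp)) ?_ (by omega)
  intro s₁ f₁ h3
  refine Run.assign (redLen N) (by simp [f₁.reg 13 rfl]) (T₂ := 20000 * N - 1020 * N) ?_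
    (by simp [Expr.cost]; omega)
  refine Run.assign (2 * N + 1) (by simp (disch := omega) [f₁.reg 10 rfl, h10])
    (T₂ := 20000 * N - 1040 * N) ?_ (by simp [Expr.cost]; omega)
  refine Run.assign (off + N + 3) (by simp (disch := omega) [f₁.reg 10 rfl, f₁.reg 11 rfl, h10, h11])
    (T₂ := 20000 * N - 1060 * N) ?_ (by simp [Expr.cost]; omega)
  refine Run.seq (T₁ := 10000 * N) (T₂ := 8940 * N) (sortTriples_run (N := N) (off := off) (f := f) hW
    (by omega) hN (by simp [f₁.reg 11 rfl, h11]) (by simp) (by simp)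
    (fun i hi => by simpa [f₁.mem 2 rfl] using hS i hi) hfK (by simpa using h3)
    (fun v => by simpa [f₁.mem 18 rfl] using h18 v)) ?_ (by omega)
  rintro s₂ f₂ ⟨h18₂, B, hB, hBp, hBs⟩
  refine Run.seq (T₁ := 100 * (N + 2)) (T₂ := 8740 * N) (nameTriples_run (N := N) (off := off) (f := f)
    (by omega) hN (by simp [f₂.reg 11 rfl, f₁.reg 11 rfl, h11]) (by simp [f₂.reg 13 rfl, f₁.reg 13 rfl])
    (by simp [f₂.reg 16 rfl, f₁.reg 16 rfl]) (by simp [f₂.reg 17 rfl])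
    (fun i hi => by simpa [f₂.mem 2 rfl, f₁.mem 2 rfl] using hS i hi) hB hBp hBs) ?_ (by omega)
  rintro s₃ f₃ ⟨hn₁, hn₂⟩
  have e12 : s₃.reg 12 = ℓ := by simp [f₃.reg 12 rfl, f₂.reg 12 rfl, f₁.reg 12 rfl, h12]
  have e10 : s₃.reg 10 = N := by simp [f₃.reg 10 rfl, f₂.reg 10 rfl, f₁.reg 10 rfl, h10]
  have e13 : s₃.reg 13 = redLen N := by simp [f₃.reg 13 rfl, f₂.reg 13 rfl, f₁.reg 13 rfl]
  have e17 : s₃.reg 17 = off + N + 3 := by simp [f₃.reg 17 rfl, f₂.reg 17 rfl]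
  have e2 : ∀ x, x < off + N + 3 ∨ off + N + 3 + redLen N ≤ x → s₃.mem 2 x = s.mem 2 x :=
    fun x hx => by simpa [f₂.mem 2 rfl, f₁.mem 2 rfl] using hn₂ x hx
  have e7 : s₃.mem 7 = s.mem 7 := by simp [f₃.mem 7 rfl, f₂.mem 7 rfl, f₁.mem 7 rfl]
  refine Run.den rfl (by simp [Prog.bound, Expr.cost]; omega) ?_
  simp (disch := omega) [Prog.den, e12, e10, e13, e17]
  refine ⟨fun k hk => ?_, fun x hx => e2 x (.inl hx), fun x hx => ?_, fun x hx => ?_, ?_⟩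
  · by_cases h : k < redLen N
    · exact hn₁ k h
    · rw [e2 _ (.inr (by omega)), hS0 _ (by omega), (red_isWord f N).zero k (by omega)]
  · rw [e2 _ (.inr (by omega)), hS0 _ (by omega)]
  · simp [hx, e7]
  · simpa [f₃.mem 18 rfl] using h18₂

end WordRAM

/-! ## The merging step of the suffix sorting -/

namespace WordRAM
open Suffix

/-- Process the next entry of the suffix array of the reduced word. -/
def unreduceSample : Prog :=
  28 ≔ .load 5 (.reg 14) ;;
  .cond (lt (.reg 28) (.reg 16)) (29 ≔ 3 * .reg 28 + 1) (29 ≔ 3 * (.reg 28 - .reg 16) + 2) ;;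
  .cond (lt (.reg 29) (.reg 10))
    (.store 3 (.reg 31) (.reg 29) ;; 31 ≔ .reg 31 + 1 ;; .store 6 (.reg 29) (.reg 31)) .skip ;;
  14 ≔ .reg 14 + 1

/-- List the sampled positions in the array 3 in sorted order and compute their ranks in the
array 6. -/
def unreduceSamples : Prog :=
  31 ≔ 0 ;; .store 6 (.reg 10) 0 ;; .store 6 (.reg 10 + 1) 0 ;; 14 ≔ 0 ;;
  .loop (lt (.reg 14) (.reg 13)) unreduceSample

theorem sortedSamples_take_succ {N k : ℕ} {L : List ℕ} (h : k < L.length) :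
    sortedSamples N (L.take (k + 1)) = sortedSamples N (L.take k) ++
      if samplePos N L[k] < N then [samplePos N L[k]] else [] := by
  rw [← List.take_concat_get' L k h, sortedSamples, List.map_append, List.filter_append]
  congr 1
  split_ifs with h' <;> simp [h']

theorem unreduceSamples_run {W N : ℕ} {s : State} {f : ℕ → ℕ} {L : List ℕ}
    (hW : 6 * N + 20 < 2 ^ W) (h10 : s.reg 10 = N) (h13 : s.reg 13 = redLen N)
    (h16 : s.reg 16 = (N + 2) / 3) (hf : IsWord f N)
    (hL : IsSuffixArray (red f N) (redLen N) L) (h5 : Holds (s.mem 5) L) :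
    Run W unreduceSamples (200 * (N + 1)) s fun s' =>
      s'.reg 31 = (sortedSamples N L).length ∧ Holds (s'.mem 3) (sortedSamples N L) ∧
      IsSampleRank N (sortedSamples N L) (s'.mem 6) := by
  have hr : redLen N ≤ N + 1 := by unfold redLen; omega
  have hlen : L.length = redLen N := by simpa using hL.perm.length_eq
  have hA := nodup_of_sorted (sortedSamples_pairwise hf hL)
  refine Run.assign 0 (by simp (disch := omega)) (T₂ := 200 * N + 190) ?_
    (by simp [Expr.cost]; omega)
  refine Run.store N 0 (by simp [h10]) (by simp (disch := omega)) (T₂ := 200 * N + 180) ?_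
    (by simp [Expr.cost]; omega)
  refine Run.store (N + 1) 0 (by simp (disch := omega) [h10]) (by simp (disch := omega))
    (T₂ := 200 * N + 160) ?_ (by simp [Expr.cost]; omega)
  refine Run.assign 0 (by simp (disch := omega)) (T₂ := 200 * N + 150) ?_
    (by simp [Expr.cost]; omega)
  refine Run.loop_den (fun s' => s'.reg 14 ≤ redLen N ∧
      s'.reg 31 = (sortedSamples N (L.take (s'.reg 14))).length ∧
      Holds (s'.mem 3) (sortedSamples N (L.take (s'.reg 14))) ∧
      IsSampleRank N (sortedSamples N (L.take (s'.reg 14))) (s'.mem 6))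
      (fun s' => redLen N - s'.reg 14) ?_ rfl ?_ ?_ ?_
  · refine ⟨by simp, by simp [sortedSamples], by simpa [sortedSamples] using Holds.nil _,
      by simp [sortedSamples], by simp, by simp⟩
  · rintro s' hf' ⟨hk, h31, h3, hR⟩ he
    have e10 : s'.reg 10 = N := by rw [hf'.reg 10 rfl]; simpa using h10
    have e13 : s'.reg 13 = redLen N := by rw [hf'.reg 13 rfl]; simpa using h13
    have e16 : s'.reg 16 = (N + 2) / 3 := by rw [hf'.reg 16 rfl]; simpa using h16
    have e5 : s'.mem 5 = s.mem 5 := by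
      rw [hf'.mem 5 rfl]; funext i; simp
    generalize hkk : s'.reg 14 = k at *
    have hkN : k < redLen N := by simpa (disch := omega) [hkk, e13] using he
    have hkL : k < L.length := by omega
    have hx : s'.mem 5 k = L[k] := by rw [e5]; exact h5 k hkL
    have hxr := List.mem_range.1 (hL.perm.mem_iff.1 (List.getElem_mem hkL))
    have ht := sortedSamples_take_succ (N := N) hkL
    have hnd : (sortedSamples N (L.take (k + 1))).Nodup :=
      hA.sublist (List.Sublist.filter _ ((List.take_sublist _ _).map _))
    have hlA : (sortedSamples N (L.take k)).length ≤ k := by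
      refine (List.length_filter_le _ _).trans ?_
      simp
    have hpos := (samplePos_spec hxr).2
    have hposd : samplePos N L[k] = if L[k] < (N + 2) / 3 then 3 * L[k] + 1
      else 3 * (L[k] - (N + 2) / 3) + 2 := rfl
    generalize hpe : samplePos N L[k] = a at *
    generalize L[k] = x at *
    generalize hAe : sortedSamples N (L.take k) = A at *
    have e₁ : Prog.den W (.cond (lt (.reg 28) (.reg 16)) (29 ≔ 3 * .reg 28 + 1)
        (29 ≔ 3 * (.reg 28 - .reg 16) + 2)) (s'.setReg 28 x) = (s'.setReg 28 x).setReg 29 a := by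
      rw [hposd]
      by_cases h : x < (N + 2) / 3 <;> simp (disch := omega) [Prog.den, e16, h]
    have e₀ : (28 ≔ .load 5 (.reg 14)).den W s' = s'.setReg 28 x := by
      simp [Prog.den, hkk, hx]
    rw [unreduceSample, Prog.den, e₀, Prog.den, e₁]
    by_cases haN : a < N
    · rw [if_pos haN] at ht
      simp (disch := omega) [Prog.den, e10, haN, h31, hkk, ht]
      refine ⟨⟨hkN, ?_, fun r hr => ?_, ?_, ?_⟩, by omega⟩
      · exact h3.concat (fun i hi => by
          have : i ≠ A.length := by omega
          simp [this]) (by simp)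
      · have hnd' := List.nodup_iff_injective_get.1 hnd
        rw [ht] at hnd
        simp only [List.length_append, List.length_singleton] at hr
        by_cases hrA : r < A.length
        · have : A[r] ≠ a := fun h => by
            have := (List.nodup_append.1 hnd).2.2 A[r] (List.getElem_mem _) a (by simp)
            exact this h
          rw [List.getElem_append_left hrA]
          simpa [this] using hR.rank r hrA
        · obtain rfl : r = A.length := by omega
          simp
      · have : N ≠ a := by omega
        simpa [this] using hR.zero.1
      · have : N + 1 ≠ a := by omega
        simpa [this] using hR.zero.2
    · rw [if_neg haN, List.append_nil] at ht
      simp (disch := omega) [Prog.den, e10, haN, h31, hkk, ht]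
      exact ⟨⟨hkN, h3, hR⟩, by omega⟩
  · simp [unreduceSample, Prog.bound, Expr.cost]; omega
  · rintro s' hf' ⟨hk, h31, h3, hR⟩ he
    have e13 : s'.reg 13 = redLen N := by rw [hf'.reg 13 rfl]; simpa using h13
    have hkN : ¬ s'.reg 14 < redLen N := by simpa (disch := omega) [e13] using he
    rw [List.take_of_length_le (by omega)] at h31 h3 hR
    exact ⟨h31, h3, hR⟩

/-- List the multiples of 3 in the array 4. -/
def listThirds : Prog :=
  14 ≔ 0 ;; .loop (lt (.reg 14) (.reg 16)) (.store 4 (.reg 14) (3 * .reg 14) ;; 14 ≔ .reg 14 + 1)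

theorem listThirds_run {W N : ℕ} {s : State} (hW : 6 * N + 20 < 2 ^ W)
    (h16 : s.reg 16 = (N + 2) / 3) :
    Run W listThirds (100 * (N + 1)) s fun s' => Holds (s'.mem 4) (thirds N) := by
  refine Run.assign 0 (by simp (disch := omega)) (T₂ := 100 * N + 90) ?_
    (by simp [Expr.cost]; omega)
  refine Run.loop_den (fun s' => s'.reg 14 ≤ (N + 2) / 3 ∧ ∀ i < s'.reg 14, s'.mem 4 i = 3 * i)
    (fun s' => (N + 2) / 3 - s'.reg 14) (by simp) rfl ?_ ?_ ?_
  · rintro s' hf ⟨hk, hI⟩ he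
    have e16 : s'.reg 16 = (N + 2) / 3 := by rw [hf.reg 16 rfl]; simpa using h16
    generalize hkk : s'.reg 14 = k at *
    have hkN : k < (N + 2) / 3 := by simpa (disch := omega) [hkk, e16] using he
    simp (disch := omega) [Prog.den, hkk]
    refine ⟨⟨hkN, fun i hi => ?_⟩, by omega⟩
    by_cases hik : i = k
    · simp [hik]
    · simpa [hik] using hI i (by omega)
  · simp [Prog.bound, Expr.cost]; omega
  · rintro s' hf ⟨hk, hI⟩ he
    have e16 : s'.reg 16 = (N + 2) / 3 := by rw [hf.reg 16 rfl]; simpa using h16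
    have : ¬ s'.reg 14 < (N + 2) / 3 := by simpa (disch := omega) [e16] using he
    exact Holds.map_range_iff.2 fun i hi => hI i (by omega)

/-- Set the register 33 to 1 if the suffix at the sampled position `r28` is smaller than the suffix
at the position `r29`, which is divisible by 3, and to 0 otherwise. -/
def compareSuffixes : Prog :=
  .cond (lt (.load 2 (.reg 11 + .reg 28)) (.load 2 (.reg 11 + .reg 29))) (33 ≔ 1)
    (.cond (eq (.load 2 (.reg 11 + .reg 28)) (.load 2 (.reg 11 + .reg 29)))
      (.cond (eq (.reg 28 % 3) 1)
        (33 ≔ lt (.load 6 (.reg 28 + 1)) (.load 6 (.reg 29 + 1)))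
        (.cond (lt (.load 2 (.reg 11 + .reg 28 + 1)) (.load 2 (.reg 11 + .reg 29 + 1))) (33 ≔ 1)
          (.cond (eq (.load 2 (.reg 11 + .reg 28 + 1)) (.load 2 (.reg 11 + .reg 29 + 1)))
            (33 ≔ lt (.load 6 (.reg 28 + 2)) (.load 6 (.reg 29 + 2)))
            (33 ≔ 0))))
      (33 ≔ 0))

open Classical in
theorem compareSuffixes_den {W N off a z : ℕ} {s : State} {f : ℕ → ℕ} {A : List ℕ}
    (hW : off + 6 * N + 20 < 2 ^ W) (h11 : s.reg 11 = off) (h28 : s.reg 28 = a)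
    (h29 : s.reg 29 = z) (hS : ∀ i ≤ N + 2, s.mem 2 (off + i) = f i)
    (hR : IsSampleRank N A (s.mem 6)) (hf : IsWord f N)
    (hA : A.Pairwise (sufLt f)) (mA : ∀ i, i ∈ A ↔ i < N ∧ i % 3 ≠ 0)
    (ha : a < N) (ha' : a % 3 ≠ 0) (hz : z < N) (hz' : z % 3 = 0) :
    compareSuffixes.den W s = s.setReg 33 (if sufLt f a z then 1 else 0) := by
  have sa := hS a (by omega)
  have sz := hS z (by omega)
  have sa1 := hS (a + 1) (by omega)
  have sz1 := hS (z + 1) (by omega)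
  rw [← add_assoc] at sa1 sz1
  by_cases h₀ : f a < f z
  · have : sufLt f a z := sufLt_iff_head.2 (.inl h₀)
    simp (disch := omega) [compareSuffixes, Prog.den, h11, h28, h29, sa, sz, h₀, this]
  by_cases h₁ : f a = f z
  swap
  · have : ¬ sufLt f a z := fun h => by
      rcases sufLt_iff_head.1 h with h | h <;> omega
    simp (disch := omega) [compareSuffixes, Prog.den, h11, h28, h29, sa, sz, h₀, h₁, this]
  by_cases h₂ : a % 3 = 1
  · rw [sufLt_iff_one hR hf hA mA ha h₂ hz hz']
    simp (disch := omega) [compareSuffixes, Prog.den, h11, h28, h29, sa, sz, h₁, h₂]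
  rw [sufLt_iff_two hR hf hA mA ha (by omega) hz hz']
  by_cases h₃ : f (a + 1) < f (z + 1)
  · simp (disch := omega) [compareSuffixes, Prog.den, h11, h28, h29, sa, sz, h₁, h₂, sa1, sz1, h₃]
  by_cases h₄ : f (a + 1) = f (z + 1)
  · simp (disch := omega) [compareSuffixes, Prog.den, h11, h28, h29, sa, sz, h₁, h₂, sa1, sz1, h₄]
  · simp (disch := omega) [compareSuffixes, Prog.den, h11, h28, h29, sa, sz, h₁, h₂, sa1, sz1, h₃, h₄]

/-- Produce the next entry of the merged list. -/
def mergeNext : Prog :=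
  28 ≔ .load 3 (.reg 14) ;; 29 ≔ .load 4 (.reg 15) ;;
  .cond (lt (.reg 14) (.reg 31)) (.cond (lt (.reg 15) (.reg 16)) compareSuffixes (33 ≔ 1))
    (33 ≔ 0) ;;
  .cond (.reg 33)
    (.store 5 (.reg 32) (.reg 28) ;; 14 ≔ .reg 14 + 1)
    (.store 5 (.reg 32) (.reg 29) ;; 15 ≔ .reg 15 + 1) ;;
  32 ≔ .reg 32 + 1

/-- Merge the arrays 3 and 4 into the array 5. -/
def mergeLists : Prog :=
  14 ≔ 0 ;; 15 ≔ 0 ;; 32 ≔ 0 ;; .loop (lt (.reg 32) (.reg 10)) mergeNext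

theorem mergeLists_run {W N off : ℕ} {s : State} {f : ℕ → ℕ} {A Z : List ℕ}
    (hW : off + 6 * N + 20 < 2 ^ W) (h10 : s.reg 10 = N) (h11 : s.reg 11 = off)
    (h31 : s.reg 31 = A.length) (h16 : s.reg 16 = Z.length)
    (hS : ∀ i ≤ N + 2, s.mem 2 (off + i) = f i)
    (hR : IsSampleRank N A (s.mem 6)) (hf : IsWord f N)
    (hA : A.Pairwise (sufLt f)) (mA : ∀ i, i ∈ A ↔ i < N ∧ i % 3 ≠ 0)
    (mZ : ∀ i, i ∈ Z ↔ i < N ∧ i % 3 = 0)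
    (h3 : Holds (s.mem 3) A) (h4 : Holds (s.mem 4) Z) (hlen : A.length + Z.length = N) :
    Run W mergeLists (200 * (N + 1)) s fun s' => Holds (s'.mem 5) (A.merge Z (sufLe f)) := by
  classical
  refine Run.assign 0 (by simp (disch := omega)) (T₂ := 200 * N + 190) ?_
    (by simp [Expr.cost]; omega)
  refine Run.assign 0 (by simp (disch := omega)) (T₂ := 200 * N + 180) ?_
    (by simp [Expr.cost]; omega)
  refine Run.assign 0 (by simp (disch := omega)) (T₂ := 200 * N + 170) ?_
    (by simp [Expr.cost]; omega)
  -- The output so far, followed by the merge of what remains of both lists, is always the merge of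
  -- the complete lists.
  refine Run.loop_den (fun s' => s'.reg 14 ≤ A.length ∧ s'.reg 15 ≤ Z.length ∧
      s'.reg 32 = s'.reg 14 + s'.reg 15 ∧ ∃ O, Holds (s'.mem 5) O ∧ O.length = s'.reg 32 ∧
        O ++ (A.drop (s'.reg 14)).merge (Z.drop (s'.reg 15)) (sufLe f) = A.merge Z (sufLe f))
      (fun s' => N - s'.reg 32) ?_ rfl ?_ ?_ ?_
  · exact ⟨by simp, by simp, by simp, [], by simpa using Holds.nil _, by simp, by simp⟩
  · rintro s' hf' ⟨hx, hy, ho, O, hO, hOl, hOm⟩ he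
    have e10 : s'.reg 10 = N := by rw [hf'.reg 10 rfl]; simpa using h10
    have e11 : s'.reg 11 = off := by rw [hf'.reg 11 rfl]; simpa using h11
    have e31 : s'.reg 31 = A.length := by rw [hf'.reg 31 rfl]; simpa using h31
    have e16 : s'.reg 16 = Z.length := by rw [hf'.reg 16 rfl]; simpa using h16
    have e2 : s'.mem 2 = s.mem 2 := by rw [hf'.mem 2 rfl]; simp
    have e3 : s'.mem 3 = s.mem 3 := by rw [hf'.mem 3 rfl]; simp
    have e4 : s'.mem 4 = s.mem 4 := by rw [hf'.mem 4 rfl]; simp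
    have e6 : s'.mem 6 = s.mem 6 := by rw [hf'.mem 6 rfl]; simp
    have hoN : s'.reg 32 < N := by simpa (disch := omega) [e10] using he
    generalize hxx : s'.reg 14 = x at *
    generalize hyy : s'.reg 15 = y at *
    generalize hoo : s'.reg 32 = o at *
    -- taking the next entry from `A`
    have takeA : x < A.length → (A.drop x).merge (Z.drop y) (sufLe f) =
        s.mem 3 x :: (A.drop (x + 1)).merge (Z.drop y) (sufLe f) →
        mergeNext.den W s' = (((((s'.setReg 28 (s.mem 3 x)).setReg 29 (s.mem 4 y)).setReg 33 1).setMem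
          5 o (s.mem 3 x)).setReg 14 (x + 1)).setReg 32 (o + 1) →
        ((mergeNext.den W s').reg 14 ≤ A.length ∧ (mergeNext.den W s').reg 15 ≤ Z.length ∧
          (mergeNext.den W s').reg 32 = (mergeNext.den W s').reg 14 + (mergeNext.den W s').reg 15 ∧
          ∃ O, Holds ((mergeNext.den W s').mem 5) O ∧ O.length = (mergeNext.den W s').reg 32 ∧
          O ++ (A.drop ((mergeNext.den W s').reg 14)).merge (Z.drop ((mergeNext.den W s').reg 15))
            (sufLe f) = A.merge Z (sufLe f)) ∧
          N - (mergeNext.den W s').reg 32 < N - o := by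
      intro hxA hm e
      rw [e]
      simp only [State.setReg_reg, State.setReg_mem, State.setMem_reg, if_true, Nat.reduceEqDiff,
        if_false, hxx, hyy]
      refine ⟨⟨hxA, hy, by omega, O ++ [s.mem 3 x], ?_, by simp [hOl], ?_⟩, by omega⟩
      · refine hO.concat (fun i hi => ?_) (by simp [hOl])
        have : i ≠ o := by omega
        simp [this]
      · rw [← hOm, hm, List.append_assoc]; rfl
    have takeZ : y < Z.length → (A.drop x).merge (Z.drop y) (sufLe f) =
        s.mem 4 y :: (A.drop x).merge (Z.drop (y + 1)) (sufLe f) →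
        mergeNext.den W s' = (((((s'.setReg 28 (s.mem 3 x)).setReg 29 (s.mem 4 y)).setReg 33 0).setMem
          5 o (s.mem 4 y)).setReg 15 (y + 1)).setReg 32 (o + 1) →
        ((mergeNext.den W s').reg 14 ≤ A.length ∧ (mergeNext.den W s').reg 15 ≤ Z.length ∧
          (mergeNext.den W s').reg 32 = (mergeNext.den W s').reg 14 + (mergeNext.den W s').reg 15 ∧
          ∃ O, Holds ((mergeNext.den W s').mem 5) O ∧ O.length = (mergeNext.den W s').reg 32 ∧
          O ++ (A.drop ((mergeNext.den W s').reg 14)).merge (Z.drop ((mergeNext.den W s').reg 15))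
            (sufLe f) = A.merge Z (sufLe f)) ∧
          N - (mergeNext.den W s').reg 32 < N - o := by
      intro hyZ hm e
      rw [e]
      simp only [State.setReg_reg, State.setReg_mem, State.setMem_reg, if_true, Nat.reduceEqDiff,
        if_false, hxx, hyy]
      refine ⟨⟨hx, hyZ, by omega, O ++ [s.mem 4 y], ?_, by simp [hOl], ?_⟩, by omega⟩
      · refine hO.concat (fun i hi => ?_) (by simp [hOl])
        have : i ≠ o := by omega
        simp [this]
      · rw [← hOm, hm, List.append_assoc]; rfl
    by_cases hxA : x < A.length
    · have dA := List.drop_eq_getElem_cons hxA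
      rw [← h3 x hxA] at dA
      have ma := (mA _).1 (h3 x hxA ▸ List.getElem_mem hxA)
      by_cases hyZ : y < Z.length
      · have dZ := List.drop_eq_getElem_cons hyZ
        rw [← h4 y hyZ] at dZ
        have mz := (mZ _).1 (h4 y hyZ ▸ List.getElem_mem hyZ)
        have hc := compareSuffixes_den (W := W) (N := N) (off := off) (a := s.mem 3 x)
          (z := s.mem 4 y) (s := (s'.setReg 28 (s.mem 3 x)).setReg 29 (s.mem 4 y)) (f := f) (A := A)
          hW (by simpa using e11) (by simp) (by simp) (by simpa [e2] using hS)
          (by simpa [e6] using hR) hf hA mA ma.1 ma.2 mz.1 mz.2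
        have hle := sufLe_eq hf ma.1 mz.1 (fun h => by omega)
        by_cases hlt : sufLt f (s.mem 3 x) (s.mem 4 y)
        · rw [if_pos hlt] at hc
          refine takeA hxA ?_ ?_
          · rw [dZ, dA, List.cons_merge_cons_pos _ _ _ (hle.2 hlt)]
          · simp (disch := omega) [mergeNext, Prog.den, hxx, hyy, e3, e4, e31, e16, hxA, hyZ, hc, hoo]
        · rw [if_neg hlt] at hc
          refine takeZ hyZ ?_ ?_
          · rw [dZ, dA, List.cons_merge_cons_neg _ _ _ (fun h => hlt (hle.1 h))]
          · simp (disch := omega) [mergeNext, Prog.den, hxx, hyy, e3, e4, e31, e16, hxA, hyZ, hc, hoo]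
      · refine takeA hxA ?_ ?_
        · have dZ : Z.drop y = [] := List.drop_of_length_le (by omega)
          rw [dZ, List.merge_right, List.merge_right, dA]
        · simp (disch := omega) [mergeNext, Prog.den, hxx, hyy, e3, e4, e31, e16, hxA, hyZ, hoo]
    · have hyZ : y < Z.length := by omega
      have dZ := List.drop_eq_getElem_cons hyZ
      rw [← h4 y hyZ] at dZ
      refine takeZ hyZ ?_ ?_
      · rw [List.drop_of_length_le (by omega), List.nil_merge, List.nil_merge, dZ]
      · simp (disch := omega) [mergeNext, Prog.den, hxx, hyy, e3, e4, e31, e16, hxA, hoo]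
  · simp [mergeNext, compareSuffixes, Prog.bound, Expr.cost]; omega
  · rintro s' hf' ⟨hx, hy, ho, O, hO, hOl, hOm⟩ he
    have e10 : s'.reg 10 = N := by rw [hf'.reg 10 rfl]; simpa using h10
    have hoN : ¬ s'.reg 32 < N := by simpa (disch := omega) [e10] using he
    rw [List.drop_of_length_le (by omega), List.drop_of_length_le (by omega), List.merge_right,
      List.append_nil] at hOm
    rwa [← hOm]

/-- Compute the suffix array of the last but one word on the stack from the one of the last word. -/
def mergeStep : Prog :=
  13 ≔ .reg 10 ;; 12 ≔ .reg 12 - 1 ;; 10 ≔ .load 7 (.reg 12) ;; 11 ≔ .reg 11 - (.reg 10 + 3) ;;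
  16 ≔ (.reg 10 + 2) / 3 ;; unreduceSamples ;; listThirds ;;
  21 ≔ .reg 16 ;; 22 ≔ 2 * .reg 10 + 1 ;;
  radixPass 4 8 (.load 6 (.reg 20 + 1)) ;; radixPass 8 4 (.load 2 (.reg 11 + .reg 20)) ;; mergeLists

theorem mergeStep_run {W N off ℓ : ℕ} {s : State} {f : ℕ → ℕ} {L : List ℕ}
    (hW : (2 * N + 1) * (2 * N + 1) < 2 ^ W) (hW' : off + 6 * N + 20 < 2 ^ W) (hℓ : ℓ + 1 < 2 ^ W)
    (hN : 2 ≤ N) (h10 : s.reg 10 = redLen N) (h11 : s.reg 11 = off + N + 3) (h12 : s.reg 12 = ℓ + 1)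
    (h7 : s.mem 7 ℓ = N) (hS : ∀ i ≤ N + 2, s.mem 2 (off + i) = f i) (hf : IsWord f N)
    (hfK : ∀ i, f i ≤ 2 * N) (h18 : ∀ v, s.mem 18 v = 0)
    (hL : IsSuffixArray (red f N) (redLen N) L) (h5 : Holds (s.mem 5) L) :
    Run W mergeStep (20000 * N) s fun s' =>
      s'.reg 10 = N ∧ s'.reg 11 = off ∧ s'.reg 12 = ℓ ∧ (∀ v, s'.mem 18 v = 0) ∧
      ∃ L, IsSuffixArray f N L ∧ Holds (s'.mem 5) L := by
  have hlt := redLen_lt hN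
  have hA := sortedSamples_pairwise hf hL
  have mA := fun i => mem_sortedSamples (i := i) hL
  have hZlen : (thirds N).length = (N + 2) / 3 := by simp [thirds]
  refine Run.assign (redLen N) (by simp [h10]) (T₂ := 20000 * N - 10) ?_
    (by simp [Expr.cost]; omega)
  refine Run.assign ℓ (by simp (disch := omega) [h12]) (T₂ := 20000 * N - 20) ?_
    (by simp [Expr.cost]; omega)
  refine Run.assign N (by simp [h7]) (T₂ := 20000 * N - 30) ?_ (by simp [Expr.cost]; omega)
  refine Run.assign off ?_ (T₂ := 20000 * N - 40) ?_ (by simp [Expr.cost]; omega)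
  · simp (disch := omega) [h11]
  refine Run.assign ((N + 2) / 3) (by simp (disch := omega)) (T₂ := 20000 * N - 1000 * N) ?_
    (by simp [Expr.cost]; omega)
  refine Run.seq (T₁ := 200 * (N + 1)) (T₂ := 18500 * N)
    (unreduceSamples_run (N := N) (f := f) (L := L) (by omega) (by simp) (by simp) (by simp) hf hL
      (by simpa using h5)) ?_ (by omega)
  rintro s₁ f₁ ⟨hA₁, hA₂, hR⟩
  refine Run.seq (T₁ := 100 * (N + 1)) (T₂ := 18000 * N)
    (listThirds_run (N := N) (by omega) (by simp [f₁.reg 16 rfl])) ?_ (by omega)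
  rintro s₂ f₂ hZ
  refine Run.assign ((N + 2) / 3) (by simp [f₂.reg 16 rfl, f₁.reg 16 rfl]) (T₂ := 17900 * N) ?_
    (by simp [Expr.cost]; omega)
  refine Run.assign (2 * N + 1) (by simp (disch := omega) [f₂.reg 10 rfl, f₁.reg 10 rfl])
    (T₂ := 17800 * N) ?_ (by simp [Expr.cost]; omega)
  have hAlen : (sortedSamples N L).length ≤ N := by
    refine (List.length_filter_le _ _).trans ?_
    have := hL.perm.length_eq
    simp only [List.length_range] at this
    simp only [List.length_map]; omega
  have hκ₁ : ∀ a ∈ thirds N, s₁.mem 6 (a + 1) < 2 * N + 1 := fun a ha => by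
    have := mem_thirds.1 ha
    have := hR.le mA (i := a + 1) (by omega) (by omega)
    omega
  refine Run.seq (T₁ := 100 * 6 * (2 * N + 2)) (T₂ := 10000 * N)
    ((radixPass_run (κ := fun a => s₁.mem 6 (a + 1)) (L := thirds N) (K := 2 * N + 1) hW (by decide)
      (by decide) (by decide) (by decide) (by simp [hZlen]) (by simp) (by omega) (by simpa using hZ)
      hκ₁ (fun s' hf' ha => ?_) (fun v => ?_)).mono (by simp [Expr.cost]) fun _ _ h => h)
      ?_ (by omega)
  · have := mem_thirds.1 ha
    have e6 : s'.mem 6 = s₁.mem 6 := by rw [hf'.mem 6 rfl]; simp [f₂.mem 6 rfl]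
    simp (disch := omega) [e6]
  · simpa [f₂.mem 18 rfl, f₁.mem 18 rfl] using h18 v
  rintro s₃ f₃ ⟨hZ₁, h18₁⟩
  have hp₁ := bsort_perm hκ₁
  have hsort := thirds_sorted (K' := 2 * N + 1) hR hf hA mA hκ₁
  generalize bsort (fun a => s₁.mem 6 (a + 1)) (2 * N + 1) (thirds N) = Z₁ at *
  have hκ₂ : ∀ a ∈ Z₁, f a < 2 * N + 1 := fun a _ => by have := hfK a; omega
  have e2 : s₃.mem 2 = s.mem 2 := by simp [f₃.mem 2 rfl, f₂.mem 2 rfl, f₁.mem 2 rfl]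
  have e10 : s₃.reg 10 = N := by simp [f₃.reg 10 rfl, f₂.reg 10 rfl, f₁.reg 10 rfl]
  have e11 : s₃.reg 11 = off := by simp [f₃.reg 11 rfl, f₂.reg 11 rfl, f₁.reg 11 rfl]
  have e12 : s₃.reg 12 = ℓ := by simp [f₃.reg 12 rfl, f₂.reg 12 rfl, f₁.reg 12 rfl]
  have e16 : s₃.reg 16 = (N + 2) / 3 := by simp [f₃.reg 16 rfl, f₂.reg 16 rfl, f₁.reg 16 rfl]
  have e31 : s₃.reg 31 = (sortedSamples N L).length := by
    simp [f₃.reg 31 rfl, f₂.reg 31 rfl, hA₁]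
  have e3 : s₃.mem 3 = s₁.mem 3 := by simp [f₃.mem 3 rfl, f₂.mem 3 rfl]
  have e6 : s₃.mem 6 = s₁.mem 6 := by simp [f₃.mem 6 rfl, f₂.mem 6 rfl]
  refine Run.seq (T₁ := 100 * 6 * (2 * N + 2)) (T₂ := 5000 * N)
    ((radixPass_run (κ := f) (L := Z₁) (K := 2 * N + 1) hW (by decide)
      (by decide) (by decide) (by decide) ?_ (by simp [f₃.reg 22 rfl]) ?_ hZ₁
      hκ₂ (fun s' hf' ha => ?_) h18₁).mono (by simp [Expr.cost]) fun _ _ h => h)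
      ?_ (by omega)
  · rw [f₃.reg 21 rfl, hp₁.length_eq, hZlen]; simp
  · rw [hp₁.length_eq]; omega
  · have := mem_thirds.1 (hp₁.mem_iff.1 ha)
    have e11' : s'.reg 11 = off := by rw [hf'.reg 11 rfl, e11]
    have e2' : s'.mem 2 = s.mem 2 := by rw [hf'.mem 2 rfl, e2]
    simp (disch := omega) [e11', e2']
    exact hS _ (by omega)
  rintro s₄ f₄ ⟨hZ₂, h18₂⟩
  have hp₂ := (bsort_perm hκ₂).trans hp₁
  generalize bsort f (2 * N + 1) Z₁ = Z₂ at *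
  have mZ : ∀ i, i ∈ Z₂ ↔ i < N ∧ i % 3 = 0 := fun i => by rw [hp₂.mem_iff, mem_thirds]
  have hM := isSuffixArray_merge hf hA hsort mA mZ
  refine (mergeLists_run (N := N) (off := off) (A := sortedSamples N L) (Z := Z₂) hW'
    (by rw [f₄.reg 10 rfl, e10]) (by rw [f₄.reg 11 rfl, e11]) (by rw [f₄.reg 31 rfl, e31])
    (by rw [f₄.reg 16 rfl, e16, hp₂.length_eq, hZlen]) (by rw [f₄.mem 2 rfl, e2]; exact hS)
    (by rw [f₄.mem 6 rfl, e6]; exact hR) hf hA mA mZ (by rw [f₄.mem 3 rfl, e3]; exact hA₂) hZ₂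
    (by simpa using hM.perm.length_eq)).mono (by omega) fun s₅ f₅ h => ?_
  exact ⟨by rw [f₅.reg 10 rfl, f₄.reg 10 rfl, e10], by rw [f₅.reg 11 rfl, f₄.reg 11 rfl, e11],
    by rw [f₅.reg 12 rfl, f₄.reg 12 rfl, e12], by rw [f₅.mem 18 rfl]; exact h18₂, _, hM, h⟩

end WordRAM

/-! ## Suffix arrays and longest common prefixes -/

namespace WordRAM
open Suffix

/-- The words on the stack: the word, its length and its offset. -/
def level (f : ℕ → ℕ) (N : ℕ) : ℕ → (ℕ → ℕ) × ℕ × ℕ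
  | 0 => (f, N, 0)
  | ℓ + 1 => (red (level f N ℓ).1 (level f N ℓ).2.1, redLen (level f N ℓ).2.1,
      (level f N ℓ).2.2 + (level f N ℓ).2.1 + 3)

/-- The suffix array of the word of length `r10` at the beginning of the array 2 is computed in the
array 5. -/
def sortSuffixes : Prog :=
  11 ≔ 0 ;; 12 ≔ 0 ;; .loop (lt 1 (.reg 10)) reduceStep ;; .store 5 0 0 ;;
  .loop (lt 0 (.reg 12)) mergeStep

/-- The stack holds the first `ℓ + 1` words. -/
structure StackInv (f : ℕ → ℕ) (N ℓ : ℕ) (s : State) : Prop where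
  len : s.reg 10 = (level f N ℓ).2.1
  off : s.reg 11 = (level f N ℓ).2.2
  depth : s.reg 12 = ℓ
  cnt : ∀ v, s.mem 18 v = 0
  word : ∀ j ≤ ℓ, ∀ i ≤ (level f N j).2.1 + 2, s.mem 2 ((level f N j).2.2 + i) = (level f N j).1 i
  lens : ∀ j < ℓ, s.mem 7 j = (level f N j).2.1 ∧ 2 ≤ (level f N j).2.1

/-- A word of length M ≥ 2 has a reduced word of length at most 5 M / 6. The factor 18 makes the
loss in length worth 3 M, which covers the shift of the offset by M + 3. So the whole stack needs
linear space. -/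
theorem StackInv.bounds {f : ℕ → ℕ} {N ℓ : ℕ} {s : State} (h : StackInv f N ℓ s) :
    (level f N ℓ).2.2 + 18 * (level f N ℓ).2.1 ≤ 18 * N ∧ ℓ + (level f N ℓ).2.1 ≤ N ∧
      (level f N ℓ).2.1 ≤ N := by
  have : ∀ j ≤ ℓ, (level f N j).2.2 + 18 * (level f N j).2.1 ≤ 18 * N ∧
      j + (level f N j).2.1 ≤ N ∧ (level f N j).2.1 ≤ N := by
    intro j
    induction j with
    | zero => intro _; simp [level]
    | succ j ih =>
      intro hj
      have := ih (by omega)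
      have h2 := (h.lens j (by omega)).2
      simp only [level]
      unfold redLen
      omega
  exact this ℓ le_rfl

theorem level_off_le {f : ℕ → ℕ} {N j ℓ : ℕ} (h : j < ℓ) :
    (level f N j).2.2 + (level f N j).2.1 + 3 ≤ (level f N ℓ).2.2 := by
  induction ℓ, h using Nat.le_induction with
  | base => simp [level]
  | succ ℓ _ ih => simp only [level]; omega

theorem level_isWord {f : ℕ → ℕ} {N : ℕ} (hf : IsWord f N) (ℓ : ℕ) :
    IsWord (level f N ℓ).1 (level f N ℓ).2.1 := by
  cases ℓ with
  | zero => exact hf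
  | succ ℓ => exact red_isWord _ _

theorem level_le {f : ℕ → ℕ} {N : ℕ} (hf : ∀ i, f i ≤ 2 * N) (ℓ i : ℕ) :
    (level f N ℓ).1 i ≤ 2 * (level f N ℓ).2.1 := by
  cases ℓ with
  | zero => exact hf i
  | succ ℓ =>
    have := red_le (level f N ℓ).1 (level f N ℓ).2.1 i
    simp only [level]
    omega

theorem sortSuffixes_run {W N : ℕ} {s : State} {f : ℕ → ℕ}
    (hW : (2 * N + 1) * (2 * N + 1) < 2 ^ W) (hW' : 100 * N + 20 < 2 ^ W) (hN : 1 ≤ N)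
    (h10 : s.reg 10 = N) (hf : IsWord f N) (hfK : ∀ i, f i ≤ 2 * N) (hS : ∀ i, s.mem 2 i = f i)
    (h18 : ∀ v, s.mem 18 v = 0) :
    Run W sortSuffixes (300000 * N) s fun s' => s'.reg 10 = N ∧ (∀ i ≤ N + 2, s'.mem 2 i = f i) ∧
      ∃ L, IsSuffixArray f N L ∧ Holds (s'.mem 5) L := by
  refine Run.assign 0 (by simp (disch := omega)) (T₂ := 300000 * N - 10) ?_
    (by simp [Expr.cost]; omega)
  refine Run.assign 0 (by simp (disch := omega)) (T₂ := 300000 * N - 20) ?_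
    (by simp [Expr.cost]; omega)
  refine Run.seq (T₁ := 6 * 20010 * N + 10) (T₂ := 6 * 20010 * N + 20) (Q' := fun s' =>
    ∃ ℓ, StackInv f N ℓ s' ∧ (level f N ℓ).2.1 = 1) ?_ ?_ (by omega)
  · refine Run.loop (fun s' => ∃ ℓ, StackInv f N ℓ s' ∧ 1 ≤ (level f N ℓ).2.1 ∧
        ∀ x, (level f N ℓ).2.2 + (level f N ℓ).2.1 + 3 ≤ x → s'.mem 2 x = 0)
      -- A round costs at most 20010 times the current length, loop test included, and leaves at
      -- most 5/6 of the length: the factor 6 is the sum of the geometric series.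
      (fun s' => 6 * 20010 * s'.reg 10) ?_ ?_ ?_ ?_
    · refine ⟨0, ⟨by simpa [level] using h10, by simp [level], by simp, by simpa using h18, ?_, by simp⟩,
        hN, fun x hx => ?_⟩
      · rintro j hj i -
        obtain rfl : j = 0 := by omega
        simpa [level] using hS i
      · simp only [level] at hx
        simpa [hS] using hf.zero x (by omega)
    · rintro s' hf' ⟨ℓ, hI, h1, h0⟩ he
      obtain ⟨b₁, b₂, b₃⟩ := hI.bounds
      have e10 := hI.len
      have hgt : 1 < s'.reg 10 := by simpa (disch := omega) using he
      have hw := hI.word ℓ le_rfl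
      have hl := level_off_le (f := f) (N := N) (Nat.lt_succ_self ℓ)
      have hlt := redLen_lt (N := (level f N ℓ).2.1) (by omega)
      have hsq : (2 * (level f N ℓ).2.1 + 1) * (2 * (level f N ℓ).2.1 + 1) ≤
          (2 * N + 1) * (2 * N + 1) := Nat.mul_le_mul (by omega) (by omega)
      refine ⟨20000 * (level f N ℓ).2.1, (reduceStep_run (N := (level f N ℓ).2.1)
        (off := (level f N ℓ).2.2) (ℓ := ℓ) (f := (level f N ℓ).1) (by omega) (by omega) (by omega)
        (by omega) hI.len hI.off hI.depth hw (level_le hfK ℓ) h0 hI.cnt).mono le_rfl ?_⟩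
      rintro s₁ f₁ ⟨c₁, c₂, c₃, c₄, c₅, c₆, c₇, c₈, c₉⟩
      refine ⟨⟨ℓ + 1, ⟨c₁, c₂, c₃, c₉, fun j hj i hi => ?_, fun j hj => ?_⟩, ?_, c₆⟩, ?_⟩
      · rcases Nat.lt_or_ge ℓ j with h | h
        · obtain rfl : j = ℓ + 1 := by omega
          exact c₄ i hi
        · rw [c₅ _ ?_, hI.word j h i hi]
          rcases h.eq_or_lt with rfl | h
          · omega
          · have := level_off_le (f := f) (N := N) h
            omega
      · rcases Nat.lt_or_ge j ℓ with h | h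
        · rw [c₈ j (by omega)]; exact hI.lens j h
        · obtain rfl : j = ℓ := by omega
          exact ⟨c₇, by omega⟩
      · simp only [level]; unfold redLen; omega
      · simp only [c₁, e10, Expr.cost, lt_def, Expr.one_def]
        have : 6 * redLen (level f N ℓ).2.1 ≤ 5 * (level f N ℓ).2.1 := by unfold redLen; omega
        omega
    · simp [h10, Expr.cost]
    · rintro s' hf' ⟨ℓ, hI, h1, -⟩ he
      have hgt : ¬ 1 < s'.reg 10 := by simpa (disch := omega) using he
      have := hI.len
      exact ⟨ℓ, hI, by omega⟩
  · rintro s₁ f₁ ⟨ℓ, hI, h1⟩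
    refine Run.store 0 0 (by simp (disch := omega)) (by simp (disch := omega))
      (T₂ := 6 * 20010 * N + 10) ?_ (by simp [Expr.cost]; omega)
    refine Run.loop (fun s' => ∃ ℓ, StackInv f N ℓ s' ∧
        ∃ L, IsSuffixArray (level f N ℓ).1 (level f N ℓ).2.1 L ∧ Holds (s'.mem 5) L)
      -- On the way back each round enlarges the length by at least a sixth of the new length, and
      -- the potential is what is missing to N.
      (fun s' => 6 * 20010 * (N - s'.reg 10)) ?_ ?_ ?_ ?_
    · refine ⟨ℓ, ⟨by simpa using hI.len, by simpa using hI.off, by simpa using hI.depth,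
        by simpa using hI.cnt, by simpa using hI.word, by simpa using hI.lens⟩, [0], ?_, ?_⟩
      · rw [h1]; exact ⟨by simp, by simp⟩
      · intro i hi
        obtain rfl : i = 0 := by simpa using hi
        simp
    · rintro s' hf' ⟨ℓ', hI', L, hL, hL5⟩ he
      obtain ⟨b₁, b₂, b₃⟩ := hI'.bounds
      have hgt : 0 < s'.reg 12 := by
        have : s'.reg 12 ≠ 0 := by simpa (disch := omega) [Nat.pos_iff_ne_zero] using he
        omega
      rw [hI'.depth] at hgt
      obtain ⟨ℓ, rfl⟩ : ∃ ℓ, ℓ' = ℓ + 1 := ⟨ℓ' - 1, by omega⟩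
      have h2 := hI'.lens ℓ (by omega)
      have hlt := redLen_lt h2.2
      have h6 : 6 * redLen (level f N ℓ).2.1 ≤ 5 * (level f N ℓ).2.1 := by unfold redLen; omega
      have e10 := hI'.len
      have e11 := hI'.off
      have hb : (level f N ℓ).2.2 + 18 * (level f N ℓ).2.1 ≤ 18 * N ∧ (level f N ℓ).2.1 ≤ N := by
        -- A state with the registers of the level below is made up only in order to apply
        -- `StackInv.bounds` to that level.
        have hI₀ : StackInv f N ℓ ⟨fun r => if r = 10 then (level f N ℓ).2.1 else
            if r = 11 then (level f N ℓ).2.2 else ℓ, s'.mem⟩ :=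
          ⟨by simp, by simp, by simp, hI'.cnt, fun j hj => hI'.word j (by omega),
            fun j hj => hI'.lens j (by omega)⟩
        exact ⟨hI₀.bounds.1, hI₀.bounds.2.2⟩
      simp only [level] at e10 e11 b₁ b₂ b₃ hL
      have hsq : (2 * (level f N ℓ).2.1 + 1) * (2 * (level f N ℓ).2.1 + 1) ≤
          (2 * N + 1) * (2 * N + 1) := Nat.mul_le_mul (by omega) (by omega)
      refine ⟨20000 * (level f N ℓ).2.1, (mergeStep_run (N := (level f N ℓ).2.1)
        (off := (level f N ℓ).2.2) (ℓ := ℓ) (f := (level f N ℓ).1) (by omega) (by omega) (by omega)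
        h2.2 e10 e11 hI'.depth h2.1 (hI'.word ℓ (by omega)) (level_isWord hf ℓ) (level_le hfK ℓ)
        hI'.cnt hL hL5).mono le_rfl ?_⟩
      rintro s₂ f₂ ⟨c₁, c₂, c₃, c₄, L', hL', hL5'⟩
      refine ⟨⟨ℓ, ⟨c₁, c₂, c₃, c₄, fun j hj => ?_, fun j hj => ?_⟩, L', hL', hL5'⟩, ?_⟩
      · rw [f₂.mem 2 rfl]; exact hI'.word j (by omega)
      · rw [f₂.mem 7 rfl]; exact hI'.lens j (by omega)
      · simp only [c₁, e10, Expr.cost, lt_def, Expr.zero_def]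
        omega
    · simp [Expr.cost]; omega
    · rintro s' hf' ⟨ℓ', hI', L, hL, hL5⟩ he
      have hgt : s'.reg 12 = 0 := by
        simpa (disch := omega) [Nat.pos_iff_ne_zero] using he
      rw [hI'.depth] at hgt
      subst hgt
      exact ⟨hI'.len, fun i hi => by simpa [level] using hI'.word 0 le_rfl i (by simpa [level] using hi),
        L, hL, hL5⟩

/-- Compute the ranks (starting with 0) of the suffixes in the array 9. -/
def invert : Prog :=
  14 ≔ 0 ;; .loop (lt (.reg 14) (.reg 10)) (.store 9 (.load 5 (.reg 14)) (.reg 14) ;; 14 ≔ .reg 14 + 1)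

/-- The arrays 5 and 9 contain the suffix array of `f` and its inverse. -/
structure SaInv (f : ℕ → ℕ) (N : ℕ) (s : State) : Prop where
  sa : ∀ r < N, s.mem 5 r < N ∧ s.mem 9 (s.mem 5 r) = r
  rk : ∀ i < N, s.mem 9 i < N ∧ s.mem 5 (s.mem 9 i) = i
  sorted : ∀ a b, a < b → b < N → sufLt f (s.mem 5 a) (s.mem 5 b)

theorem invert_run {W N : ℕ} {s : State} {f : ℕ → ℕ} {L : List ℕ} (hW : 100 * N + 20 < 2 ^ W)
    (h10 : s.reg 10 = N) (hL : IsSuffixArray f N L) (h5 : Holds (s.mem 5) L) :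
    Run W invert (100 * (N + 1)) s (SaInv f N) := by
  have hlen : L.length = N := by simpa using hL.perm.length_eq
  have hlt : ∀ r < N, s.mem 5 r < N := fun r hr => by
    rw [h5 r (by omega)]
    exact List.mem_range.1 (hL.perm.mem_iff.1 (List.getElem_mem _))
  have hP := List.pairwise_iff_getElem.1 hL.sorted
  have hs : ∀ a b, a < b → b < N → sufLt f (s.mem 5 a) (s.mem 5 b) := fun a b hab hb => by
    rw [h5 a (by omega), h5 b (by omega)]
    exact hP a b (by omega) (by omega) hab
  refine Run.assign 0 (by simp (disch := omega)) (T₂ := 100 * N + 90) ?_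
    (by simp [Expr.cost]; omega)
  refine Run.loop_den (fun s' => s'.reg 14 ≤ N ∧ ∀ r < s'.reg 14, s'.mem 9 (s.mem 5 r) = r)
    (fun s' => N - s'.reg 14) (by simp) rfl ?_ ?_ ?_
  · rintro s' hf ⟨hk, hI⟩ he
    have e10 : s'.reg 10 = N := by rw [hf.reg 10 rfl]; simpa using h10
    have e5 : s'.mem 5 = s.mem 5 := by rw [hf.mem 5 rfl]; simp
    generalize hkk : s'.reg 14 = k at *
    have hkN : k < N := by simpa (disch := omega) [hkk, e10] using he
    simp (disch := omega) [Prog.den, hkk, e5]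
    refine ⟨⟨hkN, fun r hr => ?_⟩, by omega⟩
    by_cases hrk : r = k
    · simp [hrk]
    · have hne : s.mem 5 r ≠ s.mem 5 k := fun h => by
        have := hs r k (by omega) hkN
        rw [h] at this
        exact sufLt.irrefl this
      simpa [hne] using hI r (by omega)
  · simp [Prog.bound, Expr.cost]; omega
  · rintro s' hf ⟨hk, hI⟩ he
    have e10 : s'.reg 10 = N := by rw [hf.reg 10 rfl]; simpa using h10
    have e5 : s'.mem 5 = s.mem 5 := by rw [hf.mem 5 rfl]; simp
    have : ¬ s'.reg 14 < N := by simpa (disch := omega) [e10] using he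
    refine ⟨fun r hr => by rw [e5]; exact ⟨hlt r hr, hI r (by omega)⟩, fun i hi => ?_,
      by rw [e5]; exact hs⟩
    obtain ⟨r, hr, rfl⟩ := List.mem_iff_getElem.1 (hL.perm.mem_iff.2 (List.mem_range.2 hi))
    rw [← h5 r hr, e5, hI r (by omega)]
    exact ⟨by omega, rfl⟩

/-- An agreement beyond the end of one suffix would force the other one to end at the same distance.
This keeps all comparisons of Kasai's algorithm inside the padded word. -/
theorem agree_bound {f : ℕ → ℕ} {N i j h : ℕ} (hf : IsWord f N) (hi : i ≤ N) (hj : j ≤ N)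
    (hij : i ≠ j) (ha : ∀ l < h, f (j + l) = f (i + l)) : i + h ≤ N := by
  by_contra hn
  have h₁ := ha (N - i) (by omega)
  rw [hf.zero (i + (N - i)) (by omega), hf.eq_zero_iff] at h₁
  have h₂ := ha (N - j) (by omega)
  rw [hf.zero (j + (N - j)) (by omega), eq_comm, hf.eq_zero_iff] at h₂
  omega

/-- One comparison of Kasai's algorithm. -/
def kasaiStep : Prog :=
  28 ≔ .load 9 (.reg 14) ;;
  .cond (.reg 28)
    (29 ≔ .load 5 (.reg 28 - 1) ;;
      .cond (eq (.load 2 (.reg 29 + .reg 15)) (.load 2 (.reg 14 + .reg 15)))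
        (15 ≔ .reg 15 + 1)
        (.store 10 (.reg 28) (.reg 15) ;; 14 ≔ .reg 14 + 1 ;; 15 ≔ .reg 15 - 1))
    (14 ≔ .reg 14 + 1 ;; 15 ≔ 0)

/-- Compute the lengths of the longest common prefixes of neighbours in the suffix array. -/
def kasai : Prog := 14 ≔ 0 ;; 15 ≔ 0 ;; .loop (lt (.reg 14) (.reg 10)) kasaiStep

theorem kasai_run {W N : ℕ} {s : State} {f : ℕ → ℕ} (hW : 100 * N + 20 < 2 ^ W)
    (h10 : s.reg 10 = N) (hf : IsWord f N) (hS : ∀ i ≤ N + 2, s.mem 2 i = f i) (hI : SaInv f N s) :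
    Run W kasai (1000 * (N + 1)) s fun s' => ∀ r, r + 1 < N →
      IsLce f (s.mem 5 r) (s.mem 5 (r + 1)) (s'.mem 10 (r + 1)) := by
  refine Run.assign 0 (by simp (disch := omega)) (T₂ := 1000 * N + 990) ?_
    (by simp [Expr.cost]; omega)
  refine Run.assign 0 (by simp (disch := omega)) (T₂ := 1000 * N + 980) ?_
    (by simp [Expr.cost]; omega)
  refine Run.loop_den (fun s' => s'.reg 14 ≤ N ∧ s'.reg 15 ≤ N ∧
    (1 ≤ s'.reg 15 → s'.reg 14 < N ∧ 1 ≤ s.mem 9 (s'.reg 14) ∧ ∀ l < s'.reg 15,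
      f (s.mem 5 (s.mem 9 (s'.reg 14) - 1) + l) = f (s'.reg 14 + l)) ∧
    ∀ i < s'.reg 14, 1 ≤ s.mem 9 i → IsLce f (s.mem 5 (s.mem 9 i - 1)) i (s'.mem 10 (s.mem 9 i)))
    -- Amortization: a match raises the agreement by 1, and advancing the position lowers it by at
    -- most 1 but counts double. Where the rank is 0 the agreement is already 0 by the invariant, so
    -- resetting it loses nothing.
    (fun s' => 2 * (N - s'.reg 14) + (N - s'.reg 15)) ?_ rfl ?_ ?_ ?_
  · exact ⟨by simp, by simp, by simp, by simp⟩
  · rintro s' hf' ⟨hi, hh, hA, hV⟩ he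
    have e10 : s'.reg 10 = N := by rw [hf'.reg 10 rfl]; simpa using h10
    have e5 : s'.mem 5 = s.mem 5 := by rw [hf'.mem 5 rfl]; simp
    have e9 : s'.mem 9 = s.mem 9 := by rw [hf'.mem 9 rfl]; simp
    have e2 : s'.mem 2 = s.mem 2 := by rw [hf'.mem 2 rfl]; simp
    generalize hii : s'.reg 14 = i at *
    generalize hhh : s'.reg 15 = h at *
    have hiN : i < N := by simpa (disch := omega) [hii, e10] using he
    obtain ⟨hr₁, hr₂⟩ := hI.rk i hiN
    by_cases h0 : s.mem 9 i = 0
    · have hh0 : h = 0 := by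
        by_contra hne
        have := (hA (by omega)).2.1
        omega
      simp (disch := omega) [kasaiStep, Prog.den, hii, e9, h0]
      refine ⟨⟨by omega, fun i' hi' => ?_⟩, by omega⟩
      rcases Nat.lt_or_eq_of_le hi' with h' | rfl
      · exact hV i' h'
      · omega
    obtain ⟨hj₁, hj₂⟩ := hI.sa (s.mem 9 i - 1) (by omega)
    have hij : i ≠ s.mem 5 (s.mem 9 i - 1) := fun h' => by
      rw [← h'] at hj₂; omega
    have hag : ∀ l < h, f (s.mem 5 (s.mem 9 i - 1) + l) = f (i + l) := fun l hl =>
      (hA (by omega)).2.2 l hl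
    have hb₁ := agree_bound hf hiN.le hj₁.le hij hag
    have hb₂ := agree_bound hf hj₁.le hiN.le hij.symm (fun l hl => (hag l hl).symm)
    have s₁ := hS (i + h) (by omega)
    have s₂ := hS (s.mem 5 (s.mem 9 i - 1) + h) (by omega)
    by_cases hc : f (s.mem 5 (s.mem 9 i - 1) + h) = f (i + h)
    · have hag' : ∀ l < h + 1, f (s.mem 5 (s.mem 9 i - 1) + l) = f (i + l) := fun l hl => by
        rcases Nat.lt_succ_iff_lt_or_eq.1 hl with h' | rfl
        · exact hag l h'
        · exact hc
      have hb₃ := agree_bound hf hiN.le hj₁.le hij hag'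
      simp (disch := omega) [kasaiStep, Prog.den, hii, hhh, e9, e5, e2, h0, s₁, s₂, hc]
      exact ⟨⟨by omega, by omega, ⟨by omega, by omega, fun l hl => hag' l (by omega)⟩, hV⟩, by omega⟩
    · have hl : IsLce f (s.mem 5 (s.mem 9 i - 1)) i h := ⟨hag, hc⟩
      simp (disch := omega) [kasaiStep, Prog.den, hii, hhh, e9, e5, e2, h0, s₁, s₂, hc]
      refine ⟨⟨by omega, by omega, fun h2 => ?_, fun i' hi' h1 => ?_⟩, by omega⟩
      · exact kasai_step hf hI.sorted hI.rk hI.sa hiN (by omega) hl (by omega)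
      · rcases Nat.lt_or_eq_of_le hi' with h' | rfl
        · have hne : s.mem 9 i' ≠ s.mem 9 i := fun h'' => by
            have := (hI.rk i' (by omega)).2
            rw [h'', hr₂] at this
            omega
          simpa [hne] using hV i' h' h1
        · simpa using hl
  · simp [kasaiStep, Prog.bound, Expr.cost]; omega
  · rintro s' hf' ⟨hi, hh, hA, hV⟩ he r hr
    have e10 : s'.reg 10 = N := by rw [hf'.reg 10 rfl]; simpa using h10
    have : ¬ s'.reg 14 < N := by simpa (disch := omega) [e10] using he
    obtain ⟨h₁, h₂⟩ := hI.sa (r + 1) hr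
    have := hV _ (show s.mem 5 (r + 1) < s'.reg 14 by omega) (by omega)
    rwa [h₂, Nat.add_sub_cancel] at this

end WordRAM

/-! ## Range minimum queries -/

namespace WordRAM
open Suffix

/-- Left shift. -/
def shl (e₁ e₂ : Expr) : Expr := .op .shl e₁ e₂
/-- Right shift. -/
def shr (e₁ e₂ : Expr) : Expr := .op .shr e₁ e₂

@[simp] theorem shl_def (e₁ e₂ : Expr) : shl e₁ e₂ = .op .shl e₁ e₂ := rfl
@[simp] theorem shr_def (e₁ e₂ : Expr) : shr e₁ e₂ = .op .shr e₁ e₂ := rfl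

/-- Choose the block size `b` in the register 40, with `2 ^ b` in the register 41. -/
def chooseBlock : Prog :=
  40 ≔ 1 ;; 41 ≔ 2 ;; .loop (lt (2 * .reg 41) (4 * .reg 10 + 1)) (40 ≔ .reg 40 + 1 ;; 41 ≔ 2 * .reg 41)

/-- The block size is a logarithm of 4 N. Then tables indexed by masks of b bits have linear size,
and so does a table of b + 1 levels over `N / b` blocks. -/
theorem chooseBlock_run {W N : ℕ} {s : State} (hW : 100 * N + 20 < 2 ^ W) (hN : 1 ≤ N)
    (h10 : s.reg 10 = N) :
    Run W chooseBlock (100 * (N + 1)) s fun s' => ∃ b, 1 ≤ b ∧ 2 ^ b ≤ 4 * N ∧ 4 * N < 2 ^ (b + 1) ∧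
      s'.reg 40 = b ∧ s'.reg 41 = 2 ^ b := by
  refine Run.assign 1 (by simp (disch := omega)) (T₂ := 100 * N + 90) ?_ (by simp [Expr.cost]; omega)
  refine Run.assign 2 (by simp (disch := omega)) (T₂ := 100 * N + 80) ?_ (by simp [Expr.cost]; omega)
  refine Run.loop_den (fun s' => ∃ b, 1 ≤ b ∧ b ≤ 2 ^ b ∧ 2 ^ b ≤ 4 * N ∧ s'.reg 40 = b ∧
    s'.reg 41 = 2 ^ b) (fun s' => 4 * N - s'.reg 41) ?_ rfl ?_ ?_ ?_
  · exact ⟨1, by simp; omega⟩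
  · rintro s' hf ⟨b, hb, hbp, hbN, h40, h41⟩ he
    have e10 : s'.reg 10 = N := by rw [hf.reg 10 rfl]; simpa using h10
    have hp : 2 ^ (b + 1) = 2 * 2 ^ b := by ring
    have hlt : 2 * 2 ^ b < 4 * N + 1 := by simpa (disch := omega) [h41, e10] using he
    simp (disch := omega) [Prog.den, h40, h41]
    exact ⟨by omega, by omega⟩
  · simp [Prog.bound, Expr.cost]; omega
  · rintro s' hf ⟨b, hb, hbp, hbN, h40, h41⟩ he
    have e10 : s'.reg 10 = N := by rw [hf.reg 10 rfl]; simpa using h10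
    have hp : 2 ^ (b + 1) = 2 * 2 ^ b := by ring
    have hlt : ¬ 2 * 2 ^ b < 4 * N + 1 := by simpa (disch := omega) [h41, e10] using he
    exact ⟨b, hb, hbN, by omega, h40, h41⟩

/-- Tabulate the index of the lowest bit. -/
def lowBits : Prog :=
  14 ≔ 1 ;; .loop (lt (.reg 14) (.reg 41))
    (.cond (.reg 14 % 2) (.store 11 (.reg 14) 0)
      (.store 11 (.reg 14) (.load 11 (.reg 14 / 2) + 1)) ;; 14 ≔ .reg 14 + 1)

/-- `q` is the index of the lowest bit of `x`. -/
def IsLowBit (x q : ℕ) : Prop := x.testBit q = true ∧ ∀ q' < q, x.testBit q' = false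

theorem IsLowBit.lt {x q : ℕ} (h : IsLowBit x q) : q < x :=
  Nat.lt_two_pow_self.trans_le (Nat.ge_two_pow_of_testBit h.1)

theorem lowBits_run {W N b : ℕ} {s : State} (hW : 100 * N + 20 < 2 ^ W)
    (hb : 2 ^ b ≤ 4 * N) (h41 : s.reg 41 = 2 ^ b) :
    Run W lowBits (200 * (N + 1)) s fun s' => ∀ x, 0 < x → x < 2 ^ b → IsLowBit x (s'.mem 11 x) := by
  refine Run.assign 1 (by simp (disch := omega)) (T₂ := 200 * N + 190) ?_ (by simp [Expr.cost]; omega)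
  refine Run.loop_den (fun s' => 1 ≤ s'.reg 14 ∧ ∀ x, 0 < x → x < s'.reg 14 →
    IsLowBit x (s'.mem 11 x)) (fun s' => 2 ^ b - s'.reg 14) ?_ rfl ?_ ?_ ?_
  · exact ⟨by simp, fun x h₁ h₂ => by simp at h₂; omega⟩
  · rintro s' hf ⟨h1, hI⟩ he
    have e41 : s'.reg 41 = 2 ^ b := by rw [hf.reg 41 rfl]; simpa using h41
    generalize hkk : s'.reg 14 = k at *
    have hlt : k < 2 ^ b := by simpa (disch := omega) [hkk, e41] using he
    by_cases h2 : k % 2 = 0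
    · have hlow := hI (k / 2) (by omega) (by omega)
      have := hlow.lt
      simp (disch := omega) [Prog.den, hkk, h2]
      refine ⟨fun x hx hxk => ?_, by omega⟩
      by_cases hxk' : x = k
      · subst hxk'
        simp only [if_true]
        refine ⟨?_, fun q' hq' => ?_⟩
        · rw [Nat.testBit_succ]; exact hlow.1
        · rcases q' with _ | q'
          · simp [Nat.testBit_zero, h2]
          · rw [Nat.testBit_succ]; exact hlow.2 q' (by omega)
      · simpa [hxk'] using hI x hx (by omega)
    · simp (disch := omega) [Prog.den, hkk, h2]
      refine ⟨fun x hx hxk => ?_, by omega⟩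
      by_cases hxk' : x = k
      · subst hxk'
        simp only [if_true]
        exact ⟨by simp [Nat.testBit_zero]; omega, by simp⟩
      · simpa [hxk'] using hI x hx (by omega)
  · simp [Prog.bound, Expr.cost]; omega
  · rintro s' hf ⟨h1, hI⟩ he
    have e41 : s'.reg 41 = 2 ^ b := by rw [hf.reg 41 rfl]; simpa using h41
    have hlt : ¬ s'.reg 14 < 2 ^ b := by simpa (disch := omega) [e41] using he
    exact fun x h₁ h₂ => hI x h₁ (by omega)

/-- Tabulate the binary logarithm. -/
def logs : Prog :=
  .store 17 1 0 ;; 14 ≔ 2 ;; .loop (lt (.reg 14) (.reg 10 + 1))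
    (.store 17 (.reg 14) (.load 17 (.reg 14 / 2) + 1) ;; 14 ≔ .reg 14 + 1)

theorem logs_run {W N : ℕ} {s : State} (hW : 100 * N + 20 < 2 ^ W) (h10 : s.reg 10 = N) :
    Run W logs (100 * (N + 1)) s fun s' => ∀ x, 1 ≤ x → x ≤ N → s'.mem 17 x = Nat.log 2 x := by
  refine Run.store 1 0 (by simp (disch := omega)) (by simp (disch := omega)) (T₂ := 100 * N + 90) ?_
    (by simp [Expr.cost]; omega)
  refine Run.assign 2 (by simp (disch := omega)) (T₂ := 100 * N + 80) ?_ (by simp [Expr.cost]; omega)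
  refine Run.loop_den (fun s' => 2 ≤ s'.reg 14 ∧ ∀ x, 1 ≤ x → x < s'.reg 14 →
    s'.mem 17 x = Nat.log 2 x) (fun s' => N + 1 - s'.reg 14) ?_ rfl ?_ ?_ ?_
  · refine ⟨by simp, fun x h₁ h₂ => ?_⟩
    obtain rfl : x = 1 := by simp at h₂; omega
    simp
  · rintro s' hf ⟨h1, hI⟩ he
    have e10 : s'.reg 10 = N := by rw [hf.reg 10 rfl]; simpa using h10
    generalize hkk : s'.reg 14 = k at *
    have hlt : k < N + 1 := by simpa (disch := omega) [hkk, e10] using he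
    have hl := hI (k / 2) (by omega) (by omega)
    have hl' := Nat.log_le_self 2 (k / 2)
    have hlk : Nat.log 2 k = Nat.log 2 (k / 2) + 1 := Nat.log_of_one_lt_of_le (by omega) h1
    rw [← hl] at hlk hl'
    clear hl
    simp (disch := omega) [Prog.den, hkk]
    refine ⟨⟨by omega, fun x hx hxk => ?_⟩, by omega⟩
    by_cases hxk' : x = k
    · simp [hxk', hlk]
    · simpa [hxk'] using hI x hx (by omega)
  · simp [Prog.bound, Expr.cost]; omega
  · rintro s' hf ⟨h1, hI⟩ he
    have e10 : s'.reg 10 = N := by rw [hf.reg 10 rfl]; simpa using h10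
    have hlt : ¬ s'.reg 14 < N + 1 := by simpa (disch := omega) [e10] using he
    exact fun x h₁ h₂ => hI x h₁ (by omega)

/-! ### Blocks -/

theorem succ_mod {i b : ℕ} (hb : 1 ≤ b) (h : (i + 1) % b ≠ 0) : (i + 1) % b = i % b + 1 := by
  have h₁ := Nat.div_add_mod i b
  have h₂ := Nat.mod_lt i hb
  rcases Nat.lt_or_ge (i % b + 1) b with h₃ | h₃
  · conv_lhs => rw [← h₁, add_assoc, mul_comm, Nat.mul_add_mod_of_lt h₃]
  · exfalso; apply h
    have : i + 1 = b * (i / b + 1) := by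
      rw [mul_add, mul_one]; omega
    rw [this, Nat.mul_mod_right]

/-- `m` is the set of the positions, relative to the beginning of the block of `i`, of the strict
suffix minima of `V` in the part up to `i` of the block of `i`. -/
def IsMask (V : ℕ → ℕ) (b i m : ℕ) : Prop :=
  ∀ q, m.testBit q = true ↔ q ≤ i % b ∧ ∀ x, i - i % b + q < x → x ≤ i → V (i - i % b + q) < V x

theorem IsMask.lt {V : ℕ → ℕ} {b i m : ℕ} (h : IsMask V b i m) (hb : 1 ≤ b) : m < 2 ^ b := by
  refine Nat.lt_pow_two_of_testBit _ fun q hq => ?_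
  by_contra hc
  have := ((h q).1 (by simpa using hc)).1
  have := Nat.mod_lt i hb
  omega

/-- A query inside a block. -/
theorem IsMask.isMin {V : ℕ → ℕ} {b l r m t : ℕ} (h : IsMask V b r m) (hl : r - r % b ≤ l)
    (hlb : l % b = l - (r - r % b)) (ht : IsLowBit (m / 2 ^ (l % b)) t) :
    IsMin V l (r + 1) (V (l + t)) := by
  have hr := Nat.mod_le r b
  obtain ⟨h₁, h₂⟩ := ht
  rw [Nat.testBit_div_two_pow, h] at h₁
  have e : ∀ q, r - r % b + (q + l % b) = l + q := fun q => by omega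
  rw [e] at h₁
  -- A position between l and l + t is no strict suffix minimum, so a later entry is at most as
  -- large. Following such entries to the right ends at l + t or beyond it, where no value is below
  -- that at l + t.
  have key : ∀ n x, r - x ≤ n → l ≤ x → x < l + t → V (l + t) ≤ V x := by
    intro n
    induction n with
    | zero => intro x hx hlx hxt; omega
    | succ n ih =>
      intro x hx hlx hxt
      have h₃ := h₂ (x - l) (by omega)
      rw [Nat.testBit_div_two_pow] at h₃
      have h₄ := mt (h (x - l + l % b)).2 (by simp [h₃])
      rw [e, show l + (x - l) = x by omega] at h₄
      push Not at h₄
      obtain ⟨x', hx', hxr', hV⟩ := h₄ (by omega)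
      rcases lt_trichotomy x' (l + t) with hlt | rfl | hgt
      · exact (ih x' (by omega) (by omega) hlt).trans hV
      · exact hV
      · exact ((h₁.2 x' hgt hxr').le).trans hV
  refine ⟨⟨l + t, by omega, by omega, rfl⟩, fun x hx hxr => ?_⟩
  rcases lt_trichotomy x (l + t) with hlt | rfl | hgt
  · exact key _ x le_rfl hx hlt
  · exact le_rfl
  · exact (h₁.2 x hgt (by omega)).le

/-- The position r is always a suffix minimum of its own part, and its bit survives the shift. -/
theorem IsMask.pos {V : ℕ → ℕ} {b l r m : ℕ} (h : IsMask V b r m) (hlr : l % b ≤ r % b) :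
    0 < m / 2 ^ (l % b) := by
  have : (m / 2 ^ (l % b)).testBit (r % b - l % b) = true := by
    rw [Nat.testBit_div_two_pow, h]
    have := Nat.mod_le r b
    exact ⟨by omega, fun x _ _ => by omega⟩
  rcases Nat.eq_zero_or_pos (m / 2 ^ (l % b)) with h0 | h0
  · rw [h0] at this; simp at this
  · exact h0

/-- One step of the computation of the suffix minima. -/
def maskStep : Prog :=
  .cond (.reg 14 % .reg 40) .skip (42 ≔ 0 ;; 43 ≔ 0) ;;
  28 ≔ .load 13 (.reg 42 - 1) ;;
  .cond (lt 0 (.reg 42) * lt (.load 10 (.reg 14)) (.load 10 (.reg 28) + 1))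
    (42 ≔ .reg 42 - 1 ;; 43 ≔ .op .xor (.reg 43) (shl 1 (.reg 28 % .reg 40)))
    (.store 13 (.reg 42) (.reg 14) ;; 42 ≔ .reg 42 + 1 ;;
      43 ≔ .op .or (.reg 43) (shl 1 (.reg 14 % .reg 40)) ;;
      .store 12 (.reg 14) (.reg 43) ;; 14 ≔ .reg 14 + 1)

/-- Compute the sets of the suffix minima of all parts of the blocks. -/
def masks : Prog := 14 ≔ 0 ;; 42 ≔ 0 ;; 43 ≔ 0 ;; .loop (lt (.reg 14) (.reg 10)) maskStep

/-- The list `T` contains suffix minima of the block of `i` up to `i - 1`, and all that are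
smaller than the entry at `i`. -/
structure IsStack (V : ℕ → ℕ) (b i m : ℕ) (T : List ℕ) : Prop where
  bits : ∀ q, m.testBit q = true ↔ i - i % b + q ∈ T
  bound : ∀ y ∈ T, i - i % b ≤ y ∧ y < i
  sorted : T.Pairwise fun y z => y < z ∧ V y < V z
  isMin : ∀ y ∈ T, ∀ x, y < x → x < i → V y < V x
  compl : ∀ y, i - i % b ≤ y → y < i → y ∉ T → (∃ x, y < x ∧ x < i ∧ V x ≤ V y) ∨ V i ≤ V y

theorem IsStack.nil {V : ℕ → ℕ} {b i : ℕ} (h : i % b = 0) : IsStack V b i 0 [] :=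
  ⟨by simp, by simp, by simp, by simp, fun y h₁ h₂ => by omega⟩

theorem IsStack.lt {V : ℕ → ℕ} {b i m : ℕ} {T : List ℕ} (h : IsStack V b i m T) (hb : 1 ≤ b) :
    m < 2 ^ b := by
  refine Nat.lt_pow_two_of_testBit _ fun q hq => ?_
  by_contra hc
  have := h.bound _ ((h.bits q).1 (by simpa using hc))
  have := Nat.mod_lt i hb
  have := Nat.mod_le i b
  omega

/-- An entry that is not below `V i` ceases to be a strict suffix minimum once i is included; this
is the second alternative of `compl`. Its bit is known to be set, so the exclusive or clears it. -/
theorem IsStack.pop {V : ℕ → ℕ} {b i m y : ℕ} {T : List ℕ} (h : IsStack V b i m (T ++ [y]))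
    (hb : 1 ≤ b) (hV : V i ≤ V y) : IsStack V b i (m ^^^ 2 ^ (y % b)) T := by
  have hmod := Nat.mod_le i b
  have hyb := h.bound y (by simp)
  have hyT : y ∉ T := fun hy => by
    have := (List.pairwise_append.1 h.sorted).2.2 y hy y (by simp)
    omega
  have hym : i - i % b + y % b = y := by
    have hlt := Nat.mod_lt i hb
    have h₁ := Nat.div_add_mod i b
    have h₂ : y = b * (i / b) + (y - (i - i % b)) := by omega
    have h₃ : y % b = y - (i - i % b) := by
      conv_lhs => rw [h₂, mul_comm]
      exact Nat.mul_add_mod_of_lt (by omega)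
    omega
  refine ⟨fun q => ?_, fun z hz => h.bound z (by simp [hz]), (List.pairwise_append.1 h.sorted).1,
    fun z hz => h.isMin z (by simp [hz]), fun z h₁ h₂ h₃ => ?_⟩
  · have hq := h.bits q
    rw [Nat.testBit_xor, Nat.testBit_two_pow]
    by_cases hqy : y % b = q
    · have : i - i % b + q = y := by omega
      rw [this] at hq ⊢
      simp only [List.mem_append, List.mem_singleton, or_true, iff_true] at hq
      simp [hq, hqy, hyT]
    · have : i - i % b + q ≠ y := by omega
      simp only [List.mem_append, List.mem_singleton, this, or_false] at hq
      simp [hq, hqy]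
  · by_cases hzy : z = y
    · subst hzy; exact .inr hV
    · exact h.compl z h₁ h₂ (by simp [h₃, hzy])

/-- Once all entries of the stack are below `V i`, they remain suffix minima, the position i joins
them, and `compl` excludes every other position. -/
theorem IsStack.push {V : ℕ → ℕ} {b i m : ℕ} {T : List ℕ} (h : IsStack V b i m T)
    (hT : ∀ y ∈ T, V y < V i) : IsMask V b i (m ||| 2 ^ (i % b)) := by
  have hmod := Nat.mod_le i b
  intro q
  rw [Nat.testBit_or, Nat.testBit_two_pow, Bool.or_eq_true, h.bits, decide_eq_true_eq]
  constructor
  · rintro (hq | rfl)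
    · have hb := h.bound _ hq
      refine ⟨by omega, fun x h₁ h₂ => ?_⟩
      rcases h₂.eq_or_lt with rfl | h₂
      · exact hT _ hq
      · exact h.isMin _ hq x h₁ h₂
    · exact ⟨le_rfl, fun x h₁ h₂ => by omega⟩
  · rintro ⟨h₁, h₂⟩
    by_cases hqi : i % b = q
    · exact .inr hqi
    · left
      by_contra hq
      rcases h.compl _ (by omega) (by omega) hq with ⟨x, h₃, h₄, h₅⟩ | h₃
      · have := h₂ x h₃ h₄.le; omega
      · have := h₂ i (by omega) le_rfl; omega

theorem IsStack.next {V : ℕ → ℕ} {b i m : ℕ} {T : List ℕ} (h : IsStack V b i m T) (hb : 1 ≤ b)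
    (hT : ∀ y ∈ T, V y < V i) (hi : (i + 1) % b ≠ 0) :
    IsStack V b (i + 1) (m ||| 2 ^ (i % b)) (T ++ [i]) := by
  have hmod := Nat.mod_le i b
  have hs := succ_mod hb hi
  have e : i + 1 - (i + 1) % b = i - i % b := by omega
  constructor
  · intro q
    rw [e, Nat.testBit_or, Nat.testBit_two_pow, Bool.or_eq_true, h.bits, decide_eq_true_eq,
      List.mem_append, List.mem_singleton]
    exact or_congr_right (by omega)
  · rw [e]
    intro y hy
    rcases List.mem_append.1 hy with hy | hy
    · have := h.bound y hy; omega
    · obtain rfl := List.mem_singleton.1 hy; omega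
  · refine List.pairwise_append.2 ⟨h.sorted, by simp, fun y hy z hz => ?_⟩
    obtain rfl := List.mem_singleton.1 hz
    exact ⟨(h.bound y hy).2, hT y hy⟩
  · intro y hy x h₁ h₂
    rcases List.mem_append.1 hy with hy' | hy'
    · rcases Nat.lt_succ_iff_lt_or_eq.1 h₂ with h₂ | rfl
      · exact h.isMin y hy' x h₁ h₂
      · exact hT y hy'
    · obtain rfl := List.mem_singleton.1 hy'; omega
  · rw [e]
    intro y h₁ h₂ h₃
    simp only [List.mem_append, List.mem_singleton, not_or] at h₃
    rcases h.compl y h₁ (by omega) h₃.1 with ⟨x, h₄, h₅, h₆⟩ | h₄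
    · exact .inl ⟨x, h₄, by omega, h₆⟩
    · exact .inl ⟨i, by omega, by omega, h₄⟩

theorem masks_run {W N b : ℕ} {s : State} {V : ℕ → ℕ} (hW : 100 * N + 20 < 2 ^ W)
    (h10 : s.reg 10 = N) (h40 : s.reg 40 = b) (hb : 1 ≤ b) (hbN : 2 ^ b ≤ 4 * N)
    (hV : s.mem 10 = V) (hVN : ∀ i < N, V i ≤ N) :
    Run W masks (1000 * (N + 1)) s fun s' => ∀ i < N, IsMask V b i (s'.mem 12 i) := by
  have hlow : ∀ q, q < b → 2 ^ q ≤ 4 * N := fun q hq =>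
    (Nat.pow_le_pow_right (by omega) hq.le).trans hbN
  have hbN' : b ≤ 4 * N := Nat.lt_two_pow_self.le.trans hbN
  refine Run.assign 0 (by simp (disch := omega)) (T₂ := 1000 * N + 990) ?_ (by simp [Expr.cost]; omega)
  refine Run.assign 0 (by simp (disch := omega)) (T₂ := 1000 * N + 980) ?_ (by simp [Expr.cost]; omega)
  refine Run.assign 0 (by simp (disch := omega)) (T₂ := 1000 * N + 970) ?_ (by simp [Expr.cost]; omega)
  refine Run.loop_den (fun s' => s'.reg 14 ≤ N ∧ s'.reg 42 ≤ s'.reg 14 ∧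
    (s'.reg 14 < N → s'.reg 14 % b ≠ 0 → ∃ T, IsStack V b (s'.reg 14) (s'.reg 43) T ∧
      T.length = s'.reg 42 ∧ Holds (s'.mem 13) T) ∧ ∀ i < s'.reg 14, IsMask V b i (s'.mem 12 i))
    -- Each position is pushed once and popped at most once: a push lowers the measure by 2 - 1, a
    -- pop by 1, and clearing the stack does not raise it.
    (fun s' => 2 * (N - s'.reg 14) + s'.reg 42) ?_ rfl ?_ ?_ ?_
  · exact ⟨by simp, by simp, by simp, by simp⟩
  · rintro s' hf' ⟨hi, hspi, hT, hM⟩ he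
    have e10 : s'.reg 10 = N := by rw [hf'.reg 10 rfl]; simpa using h10
    have e40 : s'.reg 40 = b := by rw [hf'.reg 40 rfl]; simpa using h40
    have em10 : s'.mem 10 = V := by rw [hf'.mem 10 rfl]; simpa using hV
    generalize hii : s'.reg 14 = i at *
    have hiN : i < N := by simpa (disch := omega) [hii, e10] using he
    have hmodb := Nat.mod_lt i hb
    have hmod := Nat.mod_le i b
    -- the state after clearing the stack at the beginning of a block
    obtain ⟨s₁, hs₁, T, hst, hTl, hT13, r14, r42, r40, m10, m12, m13⟩ : ∃ s₁ : State,
        (Prog.cond (.reg 14 % .reg 40) .skip (42 ≔ 0 ;; 43 ≔ 0)).den W s' = s₁ ∧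
        ∃ T, IsStack V b i (s₁.reg 43) T ∧ T.length = s₁.reg 42 ∧ Holds (s₁.mem 13) T ∧
        s₁.reg 14 = i ∧ s₁.reg 42 ≤ s'.reg 42 ∧ s₁.reg 40 = b ∧ s₁.mem 10 = V ∧
        s₁.mem 12 = s'.mem 12 ∧ s₁.mem 13 = s'.mem 13 := by
      by_cases h0 : i % b = 0
      · refine ⟨_, rfl, [], ?_⟩
        simp (disch := omega) [Prog.den, hii, e40, h0, em10, IsStack.nil h0]
        exact Holds.nil _
      · obtain ⟨T, h₁, h₂, h₃⟩ := hT hiN h0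
        refine ⟨_, rfl, T, ?_⟩
        simp (disch := omega) [Prog.den, hii, e40, h0, em10, h₁, h₂, h₃]
    rw [maskStep, Prog.den, hs₁]
    generalize hmm : s₁.reg 43 = m at *
    generalize hsp : s₁.reg 42 = sp at *
    have hmlt := hst.lt hb
    have hpi := hlow (i % b) hmodb
    have hVi := hVN i hiN
    have e₀ : (28 ≔ Expr.load 13 (.reg 42 - 1)).den W s₁ = s₁.setReg 28 (s₁.mem 13 (sp - 1)) := by
      simp (disch := omega) [Prog.den, hsp]
    rw [Prog.den, e₀]
    rcases List.eq_nil_or_concat T with rfl | ⟨T', y, rfl⟩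
    · have hsp0 : sp = 0 := by simpa using hTl.symm
      have e : (Prog.cond (lt 0 (.reg 42) * lt (.load 10 (.reg 14)) (.load 10 (.reg 28) + 1))
        (42 ≔ .reg 42 - 1 ;; 43 ≔ .op .xor (.reg 43) (shl 1 (.reg 28 % .reg 40)))
        (.store 13 (.reg 42) (.reg 14) ;; 42 ≔ .reg 42 + 1 ;;
          43 ≔ .op .or (.reg 43) (shl 1 (.reg 14 % .reg 40)) ;;
          .store 12 (.reg 14) (.reg 43) ;; 14 ≔ .reg 14 + 1)).den W
          (s₁.setReg 28 (s₁.mem 13 (sp - 1))) =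
          (((((s₁.setReg 28 (s₁.mem 13 (sp - 1))).setMem 13 sp i).setReg 42 (sp + 1)).setReg 43
            (m ||| 2 ^ (i % b))).setMem 12 i (m ||| 2 ^ (i % b))).setReg 14 (i + 1) := by
        -- The product of the two comparisons serves as a conjunction. With an empty stack register
        -- 28 holds a meaningless value, but the first factor is 0.
        have c : (Expr.eval W (s₁.setReg 28 (s₁.mem 13 (sp - 1)))
            (lt 0 (.reg 42) * lt (.load 10 (.reg 14)) (.load 10 (.reg 28) + 1))) = 0 := by
          simp (disch := omega) [hsp, hsp0, Op.eval]
        rw [Prog.den, if_pos c]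
        simp (disch := omega) [Prog.den, hsp, r14, r40, hmm, Nat.one_mul]
      rw [e]
      have hlt' : ∀ y ∈ ([] : List ℕ), V y < V i := by simp
      simp [hsp0, m12]
      refine ⟨⟨by omega, fun h₁ h₂ => ⟨_, hst.next hb hlt' h₂, by simp, ?_⟩, fun i' hi' => ?_⟩,
        by omega⟩
      · exact (Holds.nil (s₁.mem 13)).concat (fun x hx => by simp at hx) (by simp)
      · rcases Nat.lt_or_eq_of_le hi' with h' | rfl
        · simpa [h'.ne] using hM i' h'
        · simpa using hst.push hlt'
    · simp only [List.concat_eq_append] at hst hTl hT13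
      have hsp0 : sp = T'.length + 1 := by simpa using hTl.symm
      have hy : s₁.mem 13 (sp - 1) = y := by
        rw [hT13 (sp - 1) (by simp; omega)]
        simp [hsp0]
      have hyb := hst.bound y (by simp)
      have hVy := hVN y (by omega)
      have hpy := hlow (y % b) (Nat.mod_lt y hb)
      have hym := Nat.mod_le y b
      rw [hy]
      by_cases hc : V i ≤ V y
      · have e : (Prog.cond (lt 0 (.reg 42) * lt (.load 10 (.reg 14)) (.load 10 (.reg 28) + 1))
          (42 ≔ .reg 42 - 1 ;; 43 ≔ .op .xor (.reg 43) (shl 1 (.reg 28 % .reg 40)))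
          (.store 13 (.reg 42) (.reg 14) ;; 42 ≔ .reg 42 + 1 ;;
            43 ≔ .op .or (.reg 43) (shl 1 (.reg 14 % .reg 40)) ;;
            .store 12 (.reg 14) (.reg 43) ;; 14 ≔ .reg 14 + 1)).den W
            (s₁.setReg 28 y) =
            ((s₁.setReg 28 y).setReg 42 (sp - 1)).setReg 43 (m ^^^ 2 ^ (y % b)) := by
          have c : (Expr.eval W (s₁.setReg 28 y)
              (lt 0 (.reg 42) * lt (.load 10 (.reg 14)) (.load 10 (.reg 28) + 1))) = 1 := by
            simp (disch := omega) [hsp, hsp0, r14, m10, Nat.lt_succ_iff, hc]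
          rw [Prog.den, if_neg (by rw [c]; omega)]
          simp (disch := omega) [Prog.den, hsp, r14, r40, hmm, Nat.one_mul]
        rw [e]
        simp [m12, r14]
        refine ⟨⟨hi, by omega, fun _ _ => ⟨T', hst.pop hb hc, by omega, ?_⟩, hM⟩, by omega⟩
        intro x hx
        have := hT13 x (by simp; omega)
        simpa [hx] using this
      · have e : (Prog.cond (lt 0 (.reg 42) * lt (.load 10 (.reg 14)) (.load 10 (.reg 28) + 1))
          (42 ≔ .reg 42 - 1 ;; 43 ≔ .op .xor (.reg 43) (shl 1 (.reg 28 % .reg 40)))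
          (.store 13 (.reg 42) (.reg 14) ;; 42 ≔ .reg 42 + 1 ;;
            43 ≔ .op .or (.reg 43) (shl 1 (.reg 14 % .reg 40)) ;;
            .store 12 (.reg 14) (.reg 43) ;; 14 ≔ .reg 14 + 1)).den W
            (s₁.setReg 28 y) =
            (((((s₁.setReg 28 y).setMem 13 sp i).setReg 42 (sp + 1)).setReg 43
            (m ||| 2 ^ (i % b))).setMem 12 i (m ||| 2 ^ (i % b))).setReg 14 (i + 1) := by
          have c : (Expr.eval W (s₁.setReg 28 y)
              (lt 0 (.reg 42) * lt (.load 10 (.reg 14)) (.load 10 (.reg 28) + 1))) = 0 := by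
            simp (disch := omega) [hsp, hsp0, r14, m10, Nat.lt_succ_iff, hc]
          rw [Prog.den, if_pos c]
          simp (disch := omega) [Prog.den, hsp, r14, r40, hmm, Nat.one_mul]
        rw [e]
        have hlt' : ∀ z ∈ T' ++ [y], V z < V i := fun z hz => by
          rcases List.mem_append.1 hz with hz | hz
          · have := (List.pairwise_append.1 hst.sorted).2.2 z hz y (by simp)
            omega
          · obtain rfl := List.mem_singleton.1 hz; omega
        simp [m12]
        refine ⟨⟨by omega, by omega, fun h₁ h₂ => ⟨_, hst.next hb hlt' h₂, by simp; omega, ?_⟩,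
          fun i' hi' => ?_⟩, by omega⟩
        · refine hT13.concat (fun x hx => ?_) (by simp [hsp0])
          have : x ≠ sp := by simp at hx; omega
          simp [this]
        · rcases Nat.lt_or_eq_of_le hi' with h' | rfl
          · simpa [h'.ne] using hM i' h'
          · simpa using hst.push hlt'
  · simp [maskStep, Prog.bound, Expr.cost]; omega
  · rintro s' hf' ⟨hi, hspi, hT, hM⟩ he
    have e10 : s'.reg 10 = N := by rw [hf'.reg 10 rfl]; simpa using h10
    have hiN : ¬ s'.reg 14 < N := by simpa (disch := omega) [e10] using he
    exact fun i h => hM i (by omega)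

end WordRAM

/-! ### The sparse table and the queries -/

namespace WordRAM
open Suffix

/-- The tables for the queries inside the blocks. -/
structure BlockTables (V : ℕ → ℕ) (N b : ℕ) (s : State) : Prop where
  pos : 1 ≤ b
  pow_le : 2 ^ b ≤ 4 * N
  lt_pow : 4 * N < 2 ^ (b + 1)
  le : ∀ i < N, V i ≤ N
  reg_len : s.reg 10 = N
  reg_size : s.reg 40 = b
  val : s.mem 10 = V
  lowBit : ∀ x, 0 < x → x < 2 ^ b → IsLowBit x (s.mem 11 x)
  mask : ∀ i < N, IsMask V b i (s.mem 12 i)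

/-- The minimum of a range inside of a block. -/
def inBlock (l r : Expr) : Expr := .load 10 (l + .load 11 (shr (.load 12 r) (l % .reg 40)))

/-- Shifting the mask of r by the offset of l discards the positions before l; the lowest remaining
bit is the distance from l to the leftmost suffix minimum, where the range attains its minimum. -/
theorem BlockTables.inBlock {V : ℕ → ℕ} {W N b l r : ℕ} {s : State} (h : BlockTables V N b s)
    (hW : 100 * N + 20 < 2 ^ W) {el er : Expr} (hl : el.eval W s = l) (hr : er.eval W s = r)
    (hlr : l ≤ r) (hrN : r < N) (hb : l / b = r / b) :
    IsMin V l (r + 1) ((inBlock el er).eval W s) := by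
  have hp := h.pos
  have hpow := h.pow_le
  have h₁ := Nat.div_add_mod l b
  have h₂ := Nat.div_add_mod r b
  rw [hb] at h₁
  have hM := h.mask r hrN
  have hlt := hM.lt h.pos
  have hpos := hM.pos (l := l) (by omega)
  have hdiv : s.mem 12 r / 2 ^ (l % b) ≤ s.mem 12 r := Nat.div_le_self _ _
  have hlow := h.lowBit _ hpos (by omega)
  have hmin := hM.isMin (l := l) (by omega) (by omega) hlow
  have hlow_lt := hlow.lt
  have e : (WordRAM.inBlock el er).eval W s = V (l + s.mem 11 (s.mem 12 r / 2 ^ (l % b))) := by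
    simp (disch := omega) [WordRAM.inBlock, hl, hr, h.reg_size, h.val]
  rw [e]
  exact hmin

/-- The minima of the blocks. -/
def blockMinima : Prog :=
  44 ≔ .reg 10 / .reg 40 ;; 14 ≔ 0 ;; .loop (lt (.reg 14) (.reg 44))
    (.store 16 (.reg 14) (inBlock (.reg 14 * .reg 40) (.reg 14 * .reg 40 + (.reg 40 - 1))) ;;
      14 ≔ .reg 14 + 1)

theorem BlockTables.of_frame {V : ℕ → ℕ} {N b : ℕ} {s s' : State} {p : Prog}
    (h : BlockTables V N b s) (hf : Frame p s s') (h10 : p.wreg 10 = false)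
    (h40 : p.wreg 40 = false) (m10 : p.wmem 10 = false) (m11 : p.wmem 11 = false)
    (m12 : p.wmem 12 = false) : BlockTables V N b s' where
  pos := h.pos
  pow_le := h.pow_le
  lt_pow := h.lt_pow
  le := h.le
  reg_len := by rw [hf.reg 10 h10, h.reg_len]
  reg_size := by rw [hf.reg 40 h40, h.reg_size]
  val := by rw [hf.mem 10 m10, h.val]
  lowBit := by rw [hf.mem 11 m11]; exact h.lowBit
  mask := by rw [hf.mem 12 m12]; exact h.mask

/-- Complete blocks suffice, because an incomplete last block never lies strictly between the blocks
of two positions. -/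
theorem blockMinima_run {V : ℕ → ℕ} {W N b : ℕ} {s : State} (h : BlockTables V N b s)
    (hW : 100 * N + 20 < 2 ^ W) :
    Run W blockMinima (100 * (N + 1)) s fun s' => s'.reg 44 = N / b ∧
      ∀ k < N / b, IsMin V (k * b) ((k + 1) * b) (s'.mem 16 k) := by
  have hdN : N / b ≤ N := Nat.div_le_self _ _
  have hbN : b ≤ 4 * N := Nat.lt_two_pow_self.le.trans h.pow_le
  have h10 := h.reg_len
  have h40 := h.reg_size
  refine Run.assign (N / b) (by simp (disch := omega) [h10, h40]) (T₂ := 100 * N + 90) ?_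
    (by simp [Expr.cost]; omega)
  refine Run.assign 0 (by simp (disch := omega)) (T₂ := 100 * N + 80) ?_ (by simp [Expr.cost]; omega)
  refine Run.loop_den (fun s' => s'.reg 14 ≤ N / b ∧
    ∀ k < s'.reg 14, IsMin V (k * b) ((k + 1) * b) (s'.mem 16 k))
    (fun s' => N / b - s'.reg 14) ?_ rfl ?_ ?_ ?_
  · exact ⟨by simp, by simp⟩
  · rintro s' hf ⟨hx, hI⟩ he
    have hB : BlockTables V N b s' := by
      have h' : BlockTables V N b ((s.setReg 44 (N / b)).setReg 14 0) :=
        ⟨h.pos, h.pow_le, h.lt_pow, h.le, h.reg_len, h.reg_size, h.val, h.lowBit, h.mask⟩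
      exact h'.of_frame hf rfl rfl rfl rfl rfl
    have e44 : s'.reg 44 = N / b := by rw [hf.reg 44 rfl]; simp
    have e40 := hB.reg_size
    have hp := hB.pos
    generalize hkk : s'.reg 14 = k at *
    have hlt : k < N / b := by simpa (disch := omega) [hkk, e44] using he
    have hkb : (k + 1) * b ≤ N := (Nat.mul_le_mul_right _ hlt).trans (Nat.div_mul_le_self _ _)
    have hkb' : (k + 1) * b = k * b + b := by ring
    have hmin := hB.inBlock hW (el := .reg 14 * .reg 40) (er := .reg 14 * .reg 40 + (.reg 40 - 1))
      (l := k * b) (r := k * b + (b - 1)) (by simp (disch := omega) [hkk, e40])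
      (by simp (disch := omega) [hkk, e40]) (by omega) (by omega) (by
        rw [Nat.mul_div_cancel _ hp, mul_comm, Nat.mul_add_div hp, Nat.div_eq_of_lt (by omega)]; rfl)
    generalize hee : WordRAM.inBlock (.reg 14 * .reg 40) (.reg 14 * .reg 40 + (.reg 40 - 1)) = e at *
    simp (disch := omega) [Prog.den, hkk]
    refine ⟨⟨by omega, fun k' hk' => ?_⟩, by omega⟩
    by_cases hkk' : k' = k
    · subst hkk'
      have : (k' + 1) * b = k' * b + (b - 1) + 1 := by omega
      simpa [this] using hmin
    · simpa [hkk'] using hI k' (by omega)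
  · simp [Prog.bound, Expr.cost, WordRAM.inBlock]; omega
  · rintro s' hf ⟨hx, hI⟩ he
    have e44 : s'.reg 44 = N / b := by rw [hf.reg 44 rfl]; simp
    have hlt : ¬ s'.reg 14 < N / b := by simpa (disch := omega) [e44] using he
    exact ⟨e44, fun k hk => hI k (by omega)⟩

/-- The sparse table for the minima of the blocks. -/
def sparseTable : Prog :=
  14 ≔ .reg 44 ;; .loop (lt (.reg 14) ((.reg 40 + 1) * .reg 44))
    (27 ≔ .load 16 (.reg 14 - .reg 44) ;;
      28 ≔ .load 16 (.reg 14 - .reg 44 + shl 1 (.reg 14 / .reg 44 - 1)) ;;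
      .cond (lt (.reg 28) (.reg 27)) (.store 16 (.reg 14) (.reg 28))
        (.store 16 (.reg 14) (.reg 27)) ;;
      14 ≔ .reg 14 + 1)

/-- A single loop fills level after level, each entry being the minimum of two entries one level
below. Entries whose range would exceed the last block get meaningless values and are excluded in
the conclusion. The levels up to b suffice, since `2 ^ j ≤ N / b` and `4 * N < 2 ^ (b + 1)` force j
≤ b; they fill at most 2 N cells. -/
theorem sparseTable_run {V : ℕ → ℕ} {W N b : ℕ} {s : State} (h : BlockTables V N b s)
    (hW : 100 * N + 20 < 2 ^ W) (h44 : s.reg 44 = N / b)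
    (h16 : ∀ k < N / b, IsMin V (k * b) ((k + 1) * b) (s.mem 16 k)) :
    Run W sparseTable (100 * (N + 1)) s fun s' => ∀ j k, k + 2 ^ j ≤ N / b →
      IsMin V (k * b) ((k + 2 ^ j) * b) (s'.mem 16 (j * (N / b) + k)) := by
  have hdN : N / b ≤ N := Nat.div_le_self _ _
  have hbN : b ≤ 4 * N := Nat.lt_two_pow_self.le.trans h.pow_le
  have hmul : (b + 1) * (N / b) ≤ 2 * N := by
    have := Nat.mul_div_le N b
    rw [add_mul]; omega
  have h40 := h.reg_size
  refine Run.assign (N / b) (by simp (disch := omega) [h44]) (T₂ := 100 * N + 90) ?_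
    (by simp [Expr.cost]; omega)
  refine Run.loop_den (fun s' => N / b ≤ s'.reg 14 ∧
    ∀ j k, j * (N / b) + k < s'.reg 14 → k + 2 ^ j ≤ N / b →
      IsMin V (k * b) ((k + 2 ^ j) * b) (s'.mem 16 (j * (N / b) + k)))
    (fun s' => 2 * N - s'.reg 14) ?_ rfl ?_ ?_ ?_
  · refine ⟨by simp, fun j k h₁ h₂ => ?_⟩
    have hj : j = 0 := by
      rcases Nat.eq_zero_or_pos j with h0 | h0
      · exact h0
      · have : 1 * (N / b) ≤ j * (N / b) := Nat.mul_le_mul_right _ h0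
        simp at h₁; omega
    subst hj
    simpa using h16 k (by simpa using h₁)
  · rintro s' hf ⟨hx, hI⟩ he
    have e44 : s'.reg 44 = N / b := by rw [hf.reg 44 rfl]; simp [h44]
    have e40 : s'.reg 40 = b := by rw [hf.reg 40 rfl]; simp [h40]
    generalize hd : N / b = d at *
    generalize hkk : s'.reg 14 = x at *
    have hlt : x < (b + 1) * d := by
      have c : (Expr.eval W s' (lt (.reg 14) ((.reg 40 + 1) * .reg 44))) =
        if x < (b + 1) * d then 1 else 0 := by simp (disch := omega) [hkk, e44, e40]
      by_contra hc
      rw [c, if_neg hc] at he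
      exact he rfl
    have hd0 : 0 < d := by
      rcases Nat.eq_zero_or_pos d with h0 | h0
      · simp [h0] at hlt
      · exact h0
    have hxd : x / d < b + 1 := (Nat.div_lt_iff_lt_mul hd0).2 hlt
    have hxd1 : 1 ≤ x / d := (Nat.one_le_div_iff hd0).2 hx
    have hpow : 2 ^ (x / d - 1) ≤ 4 * N := (Nat.pow_le_pow_right (by omega) (by omega)).trans h.pow_le
    have hdx : x / d ≤ x := Nat.div_le_self _ _
    set u := s'.mem 16 (x - d) with hu
    set v := s'.mem 16 (x - d + 2 ^ (x / d - 1)) with hv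
    have e : (27 ≔ Expr.load 16 (.reg 14 - .reg 44) ;;
      28 ≔ .load 16 (.reg 14 - .reg 44 + shl 1 (.reg 14 / .reg 44 - 1)) ;;
      .cond (lt (.reg 28) (.reg 27)) (.store 16 (.reg 14) (.reg 28))
        (.store 16 (.reg 14) (.reg 27)) ;;
      14 ≔ .reg 14 + 1).den W s' =
      (((s'.setReg 27 u).setReg 28 v).setMem 16 x (min u v)).setReg 14 (x + 1) := by
      by_cases hc : v < u
      · have : min u v = v := min_eq_right hc.le
        simp (disch := omega) [Prog.den, hkk, e44, ← hu, ← hv, hc, this, Nat.one_mul]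
      · have : min u v = u := min_eq_left (by omega)
        simp (disch := omega) [Prog.den, hkk, e44, ← hu, ← hv, hc, this, Nat.one_mul]
    rw [e]
    simp only [State.setReg_reg, State.setReg_mem, State.setMem_mem, State.setMem_reg, if_true,
      true_and]
    refine ⟨⟨by omega, fun j k h₁ h₂ => ?_⟩, by omega⟩
    by_cases hjk : j * d + k = x
    · rw [if_pos hjk]
      have hpos := Nat.two_pow_pos j
      have hkd : k < d := by omega
      have hj : x / d = j := by
        rw [← hjk, mul_comm, Nat.mul_add_div hd0, Nat.div_eq_of_lt hkd]; rfl
      obtain ⟨j', rfl⟩ : ∃ j', j = j' + 1 := ⟨j - 1, by omega⟩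
      have hpos' := Nat.two_pow_pos j'
      have hp2 : 2 ^ (j' + 1) = 2 * 2 ^ j' := by ring
      have hxd' : x - d = j' * d + k := by rw [← hjk, add_mul]; omega
      rw [hj, Nat.add_sub_cancel, hxd', add_assoc] at hv
      rw [hxd'] at hu
      have m₁ := hI j' k (by omega) (by omega)
      have m₂ := hI j' (k + 2 ^ j') (by rw [← hjk, add_mul]; omega) (by omega)
      rw [← hu] at m₁
      rw [← hv] at m₂
      have hk2 : k + 2 ^ (j' + 1) = k + 2 ^ j' + 2 ^ j' := by omega
      rw [hk2]
      exact m₁.union m₂ (Nat.mul_le_mul_right _ (by omega)) le_rfl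
        (Nat.mul_le_mul_right _ (by omega))
    · rw [if_neg hjk]
      exact hI j k (by omega) h₂
  · simp [Prog.bound, Expr.cost]; omega
  · rintro s' hf ⟨hx, hI⟩ he j k hjk
    have e44 : s'.reg 44 = N / b := by rw [hf.reg 44 rfl]; simp [h44]
    have e40 : s'.reg 40 = b := by rw [hf.reg 40 rfl]; simp [h40]
    have hlt : (b + 1) * (N / b) ≤ s'.reg 14 := by
      have c : (Expr.eval W s' (lt (.reg 14) ((.reg 40 + 1) * .reg 44))) =
        if s'.reg 14 < (b + 1) * (N / b) then 1 else 0 := by simp (disch := omega) [e44, e40]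
      by_contra hc
      rw [c, if_pos (by omega)] at he
      exact absurd he one_ne_zero
    refine hI j k ?_ hjk
    have hj : j < b + 1 := by
      refine (Nat.pow_lt_pow_iff_right (le_refl 2)).1 (lt_of_le_of_lt ?_ h.lt_pow)
      omega
    have hpos := Nat.two_pow_pos j
    have : (j + 1) * (N / b) ≤ (b + 1) * (N / b) := Nat.mul_le_mul_right _ hj
    rw [add_mul] at this
    omega

/-- The tables for range minimum queries. -/
structure MinTables (V : ℕ → ℕ) (N b : ℕ) (s : State) : Prop extends BlockTables V N b s where
  reg_count : s.reg 44 = N / b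
  sparse : ∀ j k, k + 2 ^ j ≤ N / b →
      IsMin V (k * b) ((k + 2 ^ j) * b) (s.mem 16 (j * (N / b) + k))
  log : ∀ x, 1 ≤ x → x ≤ N → s.mem 17 x = Nat.log 2 x

/-- Preprocessing for range minimum queries in the array 10. -/
def prepareMin : Prog := chooseBlock ;; lowBits ;; logs ;; masks ;; blockMinima ;; sparseTable

theorem prepareMin_run {V : ℕ → ℕ} {W N : ℕ} {s : State} (hN : 1 ≤ N)
    (hW : 100 * N + 20 < 2 ^ W) (h10 : s.reg 10 = N) (hV : s.mem 10 = V)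
    (hVN : ∀ i < N, V i ≤ N) :
    Run W prepareMin (2000 * (N + 1)) s fun s' => ∃ b, MinTables V N b s' := by
  refine Run.seq (chooseBlock_run hW hN h10) (T₂ := 1900 * (N + 1)) ?_ (by omega)
  rintro s₁ f₁ ⟨b, hb, hpow, hlt, h40, h41⟩
  have a10 : s₁.reg 10 = N := by rw [f₁.reg 10 rfl, h10]
  have a10' : s₁.mem 10 = V := by rw [f₁.mem 10 rfl, hV]
  refine Run.seq (lowBits_run hW hpow h41) (T₂ := 1700 * (N + 1)) ?_ (by omega)
  intro s₂ f₂ hlow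
  refine Run.seq (logs_run hW (by rw [f₂.reg 10 rfl, a10])) (T₂ := 1600 * (N + 1)) ?_ (by omega)
  intro s₃ f₃ hlog
  refine Run.seq (masks_run hW (b := b) (V := V) (by rw [f₃.reg 10 rfl, f₂.reg 10 rfl, a10])
    (by rw [f₃.reg 40 rfl, f₂.reg 40 rfl, h40]) hb hpow
    (by rw [f₃.mem 10 rfl, f₂.mem 10 rfl, a10']) hVN) (T₂ := 600 * (N + 1)) ?_ (by omega)
  intro s₄ f₄ hmask
  have hB : BlockTables V N b s₄ := ⟨hb, hpow, hlt, hVN,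
    by rw [f₄.reg 10 rfl, f₃.reg 10 rfl, f₂.reg 10 rfl, a10],
    by rw [f₄.reg 40 rfl, f₃.reg 40 rfl, f₂.reg 40 rfl, h40],
    by rw [f₄.mem 10 rfl, f₃.mem 10 rfl, f₂.mem 10 rfl, a10'],
    by rw [f₄.mem 11 rfl, f₃.mem 11 rfl]; exact hlow, hmask⟩
  refine Run.seq (blockMinima_run hB hW) (T₂ := 500 * (N + 1)) ?_ (by omega)
  rintro s₅ f₅ ⟨h44, h16⟩
  have hB' := hB.of_frame f₅ rfl rfl rfl rfl rfl
  refine (sparseTable_run hB' hW h44 h16).mono (by omega) fun s₆ f₆ hsp =>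
    ⟨b, hB'.of_frame f₆ rfl rfl rfl rfl rfl, by rw [f₆.reg 44 rfl, h44], hsp, ?_⟩
  rw [f₆.mem 17 rfl, f₅.mem 17 rfl, f₄.mem 17 rfl]
  exact hlog

theorem MinTables.of_frame {V : ℕ → ℕ} {N b : ℕ} {s s' : State} {p : Prog}
    (h : MinTables V N b s) (hf : Frame p s s') (h10 : p.wreg 10 = false)
    (h40 : p.wreg 40 = false) (h44 : p.wreg 44 = false) (m10 : p.wmem 10 = false)
    (m11 : p.wmem 11 = false) (m12 : p.wmem 12 = false) (m16 : p.wmem 16 = false)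
    (m17 : p.wmem 17 = false) : MinTables V N b s' where
  toBlockTables := h.toBlockTables.of_frame hf h10 h40 m10 m11 m12
  reg_count := by rw [hf.reg 44 h44, h.reg_count]
  sparse := by rw [hf.mem 16 m16]; exact h.sparse
  log := by rw [hf.mem 17 m17]; exact h.log

/-- Put the minimum of the registers 52 and 55 into the register 52. -/
def takeMin : Prog := .cond (lt (.reg 55) (.reg 52)) (52 ≔ .reg 55) .skip

theorem takeMin_run {W : ℕ} {s : State} (hW : 1 < 2 ^ W) :
    Run W takeMin 7 s fun s' => s'.reg 52 = min (s.reg 52) (s.reg 55) := by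
  refine Run.den rfl (by simp [takeMin, Prog.bound, Expr.cost]) ?_
  by_cases h : s.reg 55 < s.reg 52
  · simp (disch := omega) [takeMin, Prog.den, h, min_eq_right h.le]
  · simp (disch := omega) [takeMin, Prog.den, h, min_eq_left (not_lt.1 h)]

/-- Put the minimum of the entries from the register 50 to the register 51 of the array 10 into the
register 52. -/
def queryMin : Prog :=
  53 ≔ .reg 50 / .reg 40 ;; 54 ≔ .reg 51 / .reg 40 ;;
  .cond (eq (.reg 53) (.reg 54)) (52 ≔ inBlock (.reg 50) (.reg 51))
    (52 ≔ inBlock (.reg 50) (.reg 53 * .reg 40 + (.reg 40 - 1)) ;;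
      55 ≔ inBlock (.reg 54 * .reg 40) (.reg 51) ;; 
      57 ≔ .reg 54 - (.reg 53 + 1) ;;
      .cond (.reg 57)
        (takeMin ;; 58 ≔ .load 17 (.reg 57) ;;
          55 ≔ .load 16 (.reg 58 * .reg 44 + (.reg 53 + 1)) ;; takeMin ;;
          55 ≔ .load 16 (.reg 58 * .reg 44 + (.reg 54 - shl 1 (.reg 58))) ;; takeMin)
        takeMin)

theorem Run.cond_true {W T : ℕ} {e : Expr} {p q : Prog} {s : State} {Q : State → Prop}
    (he : e.eval W s ≠ 0) {T₁ : ℕ} (h : Run W p T₁ s Q) (hT : e.cost + 1 + T₁ ≤ T) :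
    Run W (.cond e p q) T s Q := by
  obtain ⟨t, s', h₁, h₂, h₃⟩ := h
  exact ⟨_, s', .cond_true _ _ _ _ _ _ he h₁, by omega, h₃⟩

theorem Run.cond_false {W T : ℕ} {e : Expr} {p q : Prog} {s : State} {Q : State → Prop}
    (he : e.eval W s = 0) {T₁ : ℕ} (h : Run W q T₁ s Q) (hT : e.cost + 1 + T₁ ≤ T) :
    Run W (.cond e p q) T s Q := by
  obtain ⟨t, s', h₁, h₂, h₃⟩ := h
  exact ⟨_, s', .cond_false _ _ _ _ _ _ he h₁, by omega, h₃⟩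

/-- For positions in different blocks the range consists of the end of one block, the beginning of
another, and the blocks in between. The latter are covered by two stretches of `2 ^ j` blocks, whose
overlap does not affect the minimum. -/
theorem queryMin_run {V : ℕ → ℕ} {W N b l r : ℕ} {s : State} (h : MinTables V N b s)
    (hW : 100 * N + 20 < 2 ^ W) (h50 : s.reg 50 = l) (h51 : s.reg 51 = r) (hlr : l ≤ r)
    (hr : r < N) : Run W queryMin 200 s fun s' => IsMin V l (r + 1) (s'.reg 52) := by
  have h40 := h.reg_size
  have hb := h.pos
  have hlb : l / b ≤ l := Nat.div_le_self _ _
  have hrb : r / b ≤ r := Nat.div_le_self _ _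
  have hbN : b ≤ 4 * N := Nat.lt_two_pow_self.le.trans h.pow_le
  have hdiv : l / b ≤ r / b := Nat.div_le_div_right hlr
  refine Run.assign (l / b) (by simp (disch := omega) [h50, h40]) (T₂ := 190) ?_ (by simp [Expr.cost])
  refine Run.assign (r / b) (by simp (disch := omega) [h51, h40]) (T₂ := 180) ?_ (by simp [Expr.cost])
  generalize hs₁ : (s.setReg 53 (l / b)).setReg 54 (r / b) = s₁
  have h₁ : MinTables V N b s₁ := by
    subst hs₁
    refine h.of_frame (p := queryMin) ?_ rfl rfl rfl rfl rfl rfl rfl rfl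
    exact ((Frame.refl _ _).setReg _ rfl).setReg _ rfl
  have a50 : s₁.reg 50 = l := by subst hs₁; simpa using h50
  have a51 : s₁.reg 51 = r := by subst hs₁; simpa using h51
  have a53 : s₁.reg 53 = l / b := by subst hs₁; simp
  have a54 : s₁.reg 54 = r / b := by subst hs₁; simp
  clear hs₁ h
  by_cases hlr' : l / b = r / b
  · refine Run.cond_true (by simp (disch := omega) [a53, a54, hlr']) (T₁ := 100) ?_ (by simp [Expr.cost])
    have := h₁.inBlock hW (el := .reg 50) (er := .reg 51) a50 a51 hlr hr hlr'
    refine Run.den rfl (by simp [Prog.bound, Expr.cost, inBlock]) ?_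
    generalize inBlock (.reg 50) (.reg 51) = e at *
    simpa [Prog.den] using this
  have e₁ := Nat.div_add_mod l b
  have e₂ := Nat.div_add_mod r b
  have m₁ := Nat.mod_lt l hb
  have m₂ := Nat.mod_lt r hb
  have hmul : (l / b + 1) * b ≤ r / b * b := Nat.mul_le_mul_right _ (by omega)
  have hmul' : (l / b + 1) * b = l / b * b + b := by ring
  rw [mul_comm] at e₁ e₂
  have a40 := h₁.reg_size
  have a44 := h₁.reg_count
  refine Run.cond_false (by simp (disch := omega) [a53, a54, hlr']) (T₁ := 150) ?_ (by simp [Expr.cost])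
  have v₁ := h₁.inBlock hW (el := .reg 50) (er := .reg 53 * .reg 40 + (.reg 40 - 1))
    (l := l) (r := l / b * b + (b - 1)) a50 (by simp (disch := omega) [a53, a40]) (by omega)
    (by omega) (by
      rw [mul_comm, Nat.mul_add_div hb, Nat.div_eq_of_lt (by omega : b - 1 < b)]; rfl)
  generalize hx₁ : (inBlock (.reg 50) (.reg 53 * .reg 40 + (.reg 40 - 1))).eval W s₁ = x₁ at v₁
  refine Run.assign x₁ hx₁ (T₂ := 130) ?_ (by simp [inBlock, Expr.cost])
  have h₂ : MinTables V N b (s₁.setReg 52 x₁) :=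
    h₁.of_frame (p := queryMin) ((Frame.refl _ _).setReg _ rfl) rfl rfl rfl rfl rfl rfl rfl rfl
  have v₂ := h₂.inBlock hW (el := .reg 54 * .reg 40) (er := .reg 51)
    (l := r / b * b) (r := r) (by simp (disch := omega) [a54, a40]) (by simp [a51]) (by omega)
    (by omega) (by rw [Nat.mul_div_cancel _ hb])
  generalize hx₂ : (inBlock (.reg 54 * .reg 40) (.reg 51)).eval W (s₁.setReg 52 x₁) = x₂ at v₂
  refine Run.assign x₂ hx₂ (T₂ := 110) ?_ (by simp [inBlock, Expr.cost])
  refine Run.assign (r / b - (l / b + 1)) (by simp (disch := omega) [a53, a54]) (T₂ := 100) ?_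
    (by simp [Expr.cost])
  have f₁ : l / b * b + (b - 1) + 1 = (l / b + 1) * b := by omega
  rw [f₁] at v₁
  by_cases hc : r / b = l / b + 1
  · refine Run.cond_false (by simp [hc]) (T₁ := 7) ?_ (by simp [Expr.cost])
    refine (takeMin_run (by omega)).mono le_rfl fun s' _ h' => ?_
    rw [h']
    simpa using v₁.union v₂ (by omega) (by rw [hc]) (by omega)
  · refine Run.cond_true (by simp; omega) (T₁ := 90) ?_ (by simp [Expr.cost])
    refine Run.seq (takeMin_run (by omega)) (T₂ := 80) ?_ (by omega)
    intro s₂ g₂ q₂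
    simp only [State.setReg_reg] at q₂
    have c17 : s₂.mem 17 = s₁.mem 17 := by rw [g₂.mem 17 rfl]; rfl
    have c16 : s₂.mem 16 = s₁.mem 16 := by rw [g₂.mem 16 rfl]; rfl
    have c57 : s₂.reg 57 = r / b - (l / b + 1) := by rw [g₂.reg 57 rfl]; simp
    have c44 : s₂.reg 44 = N / b := by rw [g₂.reg 44 rfl]; simpa using a44
    have c53 : s₂.reg 53 = l / b := by rw [g₂.reg 53 rfl]; simpa using a53
    have c54 : s₂.reg 54 = r / b := by rw [g₂.reg 54 rfl]; simpa using a54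
    generalize hj : Nat.log 2 (r / b - (l / b + 1)) = j
    have hlog := h₁.log (r / b - (l / b + 1)) (by omega) (by omega)
    rw [hj] at hlog
    have hj₁ : 2 ^ j ≤ r / b - (l / b + 1) := by rw [← hj]; exact Nat.pow_log_le_self 2 (by omega)
    have hj₂ : r / b - (l / b + 1) < 2 * 2 ^ j := by
      have := Nat.lt_pow_succ_log_self (b := 2) (by omega) (r / b - (l / b + 1))
      rw [hj] at this
      simpa [pow_succ, mul_comm] using this
    have hdN : r / b ≤ N / b := Nat.div_le_div_right hr.le
    have hjb : j ≤ b := by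
      have : j < b + 1 := (Nat.pow_lt_pow_iff_right (le_refl 2)).1 (by have := h₁.lt_pow; omega)
      omega
    have hjN : j * (N / b) ≤ N := (Nat.mul_le_mul_right _ hjb).trans (Nat.mul_div_le _ _)
    have v₃ := h₁.sparse j (l / b + 1) (by omega)
    have v₄ := h₁.sparse j (r / b - 2 ^ j) (by omega)
    refine Run.assign j (by simp (disch := omega) [c57, c17, hlog]) (T₂ := 70) ?_ (by simp [Expr.cost])
    refine Run.assign (s₁.mem 16 (j * (N / b) + (l / b + 1)))
      (by simp (disch := omega) [c44, c53, c16]) (T₂ := 60) ?_ (by simp [Expr.cost])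
    refine Run.seq (takeMin_run (by omega)) (T₂ := 50) ?_ (by omega)
    intro s₃ g₃ q₃
    simp [q₂] at q₃
    have d16 : s₃.mem 16 = s₁.mem 16 := by rw [g₃.mem 16 rfl]; simp [c16]
    have d44 : s₃.reg 44 = N / b := by rw [g₃.reg 44 rfl]; simpa using c44
    have d54 : s₃.reg 54 = r / b := by rw [g₃.reg 54 rfl]; simpa using c54
    have d58 : s₃.reg 58 = j := by rw [g₃.reg 58 rfl]; simp
    refine Run.assign (s₁.mem 16 (j * (N / b) + (r / b - 2 ^ j)))
      (by simp (disch := omega) [d44, d54, d16, d58, Nat.one_mul]) (T₂ := 30) ?_ (by simp [Expr.cost])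
    refine (takeMin_run (by omega)).mono (by omega) fun s' _ h' => ?_
    simp [q₃] at h'
    rw [h']
    have hsub : r / b - 2 ^ j + 2 ^ j = r / b := by omega
    rw [hsub] at v₄
    have v₅ := v₃.union v₄ (Nat.mul_le_mul_right _ (by omega)) (Nat.mul_le_mul_right _ (by omega))
      (Nat.mul_le_mul_right _ (by omega))
    have v₆ := (v₁.union v₅ (by omega) le_rfl (by omega)).union v₂ (by omega) le_rfl (by omega)
    convert v₆ using 1
    generalize s₁.mem 16 (j * (N / b) + (l / b + 1)) = y
    generalize s₁.mem 16 (j * (N / b) + (r / b - 2 ^ j)) = z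
    omega

/-! ### Longest common extensions -/

/-- The tables for queries for longest common extensions in the word `f` of length `N`. -/
structure LceTables (f : ℕ → ℕ) (N : ℕ) (s : State) : Prop where
  word : IsWord f N
  inv : SaInv f N s
  min : ∃ V b, MinTables V N b s ∧
    ∀ r, r + 1 < N → IsLce f (s.mem 5 r) (s.mem 5 (r + 1)) (V (r + 1))

/-- Preprocessing of the word in the array 2, of the length in the register 10. -/
def prepareLce : Prog :=
  sortSuffixes ;; invert ;; kasai ;; .store 10 0 0 ;; prepareMin

theorem prepareLce_run {W N : ℕ} {s : State} {f : ℕ → ℕ} (hN : 1 ≤ N)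
    (h10 : s.reg 10 = N) (hS : ∀ i, s.mem 2 i = f i) (hf : IsWord f N) (hfK : ∀ i, f i ≤ 2 * N)
    (hW₁ : (2 * N + 1) * (2 * N + 1) < 2 ^ W) (hW₂ : 100 * N + 20 < 2 ^ W)
    (h18 : ∀ v, s.mem 18 v = 0) :
    Run W prepareLce (400000 * N) s (LceTables f N) := by
  refine Run.seq (sortSuffixes_run hW₁ hW₂ hN h10 hf hfK hS h18) (T₂ := 20000 * N) ?_ (by omega)
  rintro s₁ f₁ ⟨a10, a2, L, hL, a5⟩
  refine Run.seq (invert_run hW₂ a10 hL a5) (T₂ := 9000 * N) ?_ (by omega)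
  intro s₂ f₂ hI
  have b10 : s₂.reg 10 = N := by rw [f₂.reg 10 rfl, a10]
  refine Run.seq (kasai_run hW₂ b10 hf (fun i hi => by rw [f₂.mem 2 rfl]; exact a2 i hi) hI)
    (T₂ := 6000 * N) ?_ (by omega)
  intro s₃ f₃ hK
  have c5 : s₃.mem 5 = s₂.mem 5 := f₃.mem 5 rfl
  have c9 : s₃.mem 9 = s₂.mem 9 := f₃.mem 9 rfl
  -- Entry 0 belongs to no pair of neighbours and is not determined by Kasai's algorithm; it is
  -- cleared so that all entries are bounded by N.
  refine Run.store 0 0 (by simp (disch := omega)) (by simp (disch := omega)) (T₂ := 5000 * N) ?_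
    (by simp [Expr.cost]; omega)
  refine (prepareMin_run hN hW₂ (V := (s₃.setMem 10 0 0).mem 10) (by
    simpa [f₃.reg 10 rfl] using b10) rfl ?_).mono (by omega) ?_
  · rintro (_ | i) hi
    · simp
    · have h₁ := (hI.sa i (by omega)).1
      have h₂ := (hI.sa (i + 1) hi).1
      have h₃ := hK i hi
      have hne : s₂.mem 5 (i + 1) ≠ s₂.mem 5 i := fun h => by
        have := hI.sorted i (i + 1) (by omega) hi
        rw [h] at this
        exact sufLt.irrefl this
      have := agree_bound hf h₂.le h₁.le hne h₃.1
      simp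
      omega
  · rintro s₄ f₄ ⟨b, hb⟩
    have d5 : s₄.mem 5 = s₂.mem 5 := by
      rw [f₄.mem 5 rfl, State.setMem_mem_ne _ _ _ _ _ (by omega), c5]
    have d9 : s₄.mem 9 = s₂.mem 9 := by
      rw [f₄.mem 9 rfl, State.setMem_mem_ne _ _ _ _ _ (by omega), c9]
    refine ⟨hf, ⟨?_, ?_, ?_⟩, _, b, hb, fun r hr => ?_⟩
    · rw [d5, d9]; exact hI.sa
    · rw [d5, d9]; exact hI.rk
    · rw [d5]; exact hI.sorted
    · rw [d5]; simpa using hK r hr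

/-- Put the length of the longest common extension of the positions in the registers 60 and 61 into
the register 52. -/
def queryLce : Prog :=
  50 ≔ .load 9 (.reg 60) ;; 51 ≔ .load 9 (.reg 61) ;;
  .cond (lt (.reg 51) (.reg 50)) (52 ≔ .reg 50 ;; 50 ≔ .reg 51 + 1 ;; 51 ≔ .reg 52)
    (50 ≔ .reg 50 + 1) ;;
  queryMin

/-- The relevant entries begin one behind the smaller rank, as each entry concerns a suffix and its
predecessor. -/
theorem queryLce_run {W N i j : ℕ} {s : State} {f : ℕ → ℕ} (h : LceTables f N s)
    (hW : 100 * N + 20 < 2 ^ W) (h60 : s.reg 60 = i) (h61 : s.reg 61 = j) (hi : i < N) (hj : j < N)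
    (hij : i ≠ j) : Run W queryLce 300 s fun s' => IsLce f i j (s'.reg 52) := by
  obtain ⟨V, b, hM, hV⟩ := h.min
  obtain ⟨hi₁, hi₂⟩ := h.inv.rk i hi
  obtain ⟨hj₁, hj₂⟩ := h.inv.rk j hj
  have hne : s.mem 9 i ≠ s.mem 9 j := fun h' => hij (by rw [← hi₂, ← hj₂, h'])
  refine Run.assign (s.mem 9 i) (by simp [h60]) (T₂ := 290) ?_ (by simp [Expr.cost])
  refine Run.assign (s.mem 9 j) (by simp [h61]) (T₂ := 280) ?_ (by simp [Expr.cost])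
  have hM' : MinTables V N b ((s.setReg 50 (s.mem 9 i)).setReg 51 (s.mem 9 j)) :=
    hM.of_frame (p := queryLce) (((Frame.refl _ _).setReg _ rfl).setReg _ rfl)
      rfl rfl rfl rfl rfl rfl rfl rfl
  refine Run.seq (Q' := fun s' => s'.reg 50 = min (s.mem 9 i) (s.mem 9 j) + 1 ∧
    s'.reg 51 = max (s.mem 9 i) (s.mem 9 j)) (T₁ := 30) (T₂ := 200)
    (Run.den rfl (by simp [Prog.bound, Expr.cost]) ?_) ?_ (by omega)
  · rcases lt_or_gt_of_ne hne with hlt | hlt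
    · simp (disch := omega) [Prog.den, hlt.not_gt, min_eq_left hlt.le, max_eq_right hlt.le]
    · simp (disch := omega) [Prog.den, hlt, min_eq_right hlt.le, max_eq_left hlt.le]
  · rintro s₁ f₁ ⟨h50, h51⟩
    refine (queryMin_run (hM'.of_frame f₁ rfl rfl rfl rfl rfl rfl rfl rfl) hW h50 h51 (by omega)
      (by omega)).mono le_rfl fun s₂ _ hm => ?_
    have key := isLce_of_isMin h.inv.sorted hV (a := min (s.mem 9 i) (s.mem 9 j))
      (b := max (s.mem 9 i) (s.mem 9 j)) (by omega) (by omega) hm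
    rcases lt_or_gt_of_ne hne with hlt | hlt
    · rwa [min_eq_left hlt.le, max_eq_right hlt.le, hi₂, hj₂] at key
    · rw [min_eq_right hlt.le, max_eq_left hlt.le, hi₂, hj₂] at key
      exact key.symm

theorem LceTables.of_frame {f : ℕ → ℕ} {N : ℕ} {s s' : State} {p : Prog} (h : LceTables f N s)
    (hf : Frame p s s') (h10 : p.wreg 10 = false)
    (h40 : p.wreg 40 = false) (h44 : p.wreg 44 = false) (m5 : p.wmem 5 = false)
    (m9 : p.wmem 9 = false) (m10 : p.wmem 10 = false)
    (m11 : p.wmem 11 = false) (m12 : p.wmem 12 = false) (m16 : p.wmem 16 = false)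
    (m17 : p.wmem 17 = false) : LceTables f N s' := by
  obtain ⟨V, b, hM, hV⟩ := h.min
  refine ⟨h.word, ⟨?_, ?_, ?_⟩, V, b, hM.of_frame hf h10 h40 h44 m10 m11 m12 m16 m17, ?_⟩
  · rw [hf.mem 5 m5, hf.mem 9 m9]; exact h.inv.sa
  · rw [hf.mem 5 m5, hf.mem 9 m9]; exact h.inv.rk
  · rw [hf.mem 5 m5]; exact h.inv.sorted
  · rw [hf.mem 5 m5]; exact hV

end WordRAM

/-! ## Alignments of prefixes -/

namespace PatternMatching

/-- The prefix of length `i` of the pattern `a`, whose variables are at the positions satisfying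
`v`, has an instance which differs from the prefix of length `p` of the word `w` in at most `d`
positions. -/
inductive Reach (w a : ℕ → ℕ) (v : ℕ → Prop) : ℕ → ℕ → ℕ → Prop
  | zero (d : ℕ) : Reach w a v d 0 0
  | var {d i q p : ℕ} : v i → q ≤ p → Reach w a v d i q → Reach w a v d (i + 1) p
  | eq {d i p : ℕ} : ¬ v i → a i = w p → Reach w a v d i p → Reach w a v d (i + 1) (p + 1)
  | ne {d i p : ℕ} : ¬ v i → Reach w a v d i p → Reach w a v (d + 1) (i + 1) (p + 1)

/-! ### Decomposition of alignments into runs of variables and runs of letters. -/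

section Reach
variable {w a : ℕ → ℕ} {v : ℕ → Prop} {d d' i j g p q t : ℕ}

theorem Reach.mono (h : Reach w a v d i p) (hd : d ≤ d') : Reach w a v d' i p := by
  induction h generalizing d' with
  | zero d => exact .zero _
  | var hv hq _ ih => exact .var hv hq (ih hd)
  | eq hv he _ ih => exact .eq hv he (ih hd)
  | ne hv _ ih =>
    obtain ⟨d', rfl⟩ : ∃ e, d' = e + 1 := ⟨d' - 1, by omega⟩
    exact .ne hv (ih (by omega))

theorem Reach.mono_right (h : Reach w a v d (i + 1) p) (hv : v i) (hp : p ≤ q) :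
    Reach w a v d (i + 1) q := by
  cases h with
  | var _ hq h => exact .var hv (hq.trans hp) h
  | eq hv' => exact absurd hv hv'
  | ne hv' => exact absurd hv hv'

theorem Reach.vars (h : Reach w a v d i p) (hij : i ≤ j) (hv : ∀ k, i ≤ k → k < j → v k) :
    Reach w a v d j p := by
  induction j, hij using Nat.le_induction with
  | base => exact h
  | succ j hj ih => exact .var (hv j hj (by omega)) le_rfl (ih fun k h₁ h₂ => hv k h₁ (by omega))

/-- Either all variables of the run have empty images, or one that has not can give back a letter.
-/
theorem Reach.vars_inv (hij : i ≤ j) (hv : ∀ k, i ≤ k → k < j → v k) (h : Reach w a v d j p) :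
    Reach w a v d i p ∨ ∃ p', p = p' + 1 ∧ Reach w a v d j p' := by
  induction j, hij using Nat.le_induction with
  | base => exact .inl h
  | succ j hj ih =>
    have hvj := hv j hj (by omega)
    cases h with
    | var _ hq h =>
      rcases hq.eq_or_lt with rfl | hq
      · rcases ih (fun k h₁ h₂ => hv k h₁ (by omega)) h with h' | ⟨p', rfl, h'⟩
        · exact .inl h'
        · exact .inr ⟨p', rfl, .var hvj le_rfl h'⟩
      · exact .inr ⟨p - 1, by omega, .var hvj (by omega) h⟩
    | eq hv' => exact absurd hvj hv'
    | ne hv' => exact absurd hvj hv'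

/-- The number of mismatches of the factors of length `t` at `g` and `q`. -/
def mism (w a : ℕ → ℕ) (g q t : ℕ) : ℕ := Nat.count (fun k => a (g + k) ≠ w (q + k)) t

theorem mism_mono (h : i ≤ j) : mism w a g q i ≤ mism w a g q j := Nat.count_monotone _ h

theorem mism_eq (h : a (g + t) = w (q + t)) : mism w a g q (t + 1) = mism w a g q t := by
  simp [mism, Nat.count_succ, h]

theorem mism_ne (h : a (g + t) ≠ w (q + t)) : mism w a g q (t + 1) = mism w a g q t + 1 := by
  simp [mism, Nat.count_succ, h]

theorem mism_add (h : ∀ k < j, a (g + (t + k)) = w (q + (t + k))) :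
    mism w a g q (t + j) = mism w a g q t := by
  induction j with
  | zero => rfl
  | succ j ih => rw [← add_assoc, mism_eq (h j (by omega)), ih fun k hk => h k (by omega)]

theorem Reach.letters (h : Reach w a v d g q) (hv : ∀ k < t, ¬ v (g + k)) :
    Reach w a v (d + mism w a g q t) (g + t) (q + t) := by
  induction t with
  | zero => exact h
  | succ t ih =>
    have hi := ih fun k hk => hv k (by omega)
    by_cases he : a (g + t) = w (q + t)
    · rw [mism_eq he]
      exact .eq (hv t (by omega)) he hi
    · rw [mism_ne he]
      exact .ne (hv t (by omega)) hi

theorem Reach.letters_inv (hv : ∀ k < t, ¬ v (g + k)) (h : Reach w a v d (g + t) p) :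
    ∃ q e, p = q + t ∧ Reach w a v e g q ∧ e + mism w a g q t ≤ d := by
  induction t generalizing d p with
  | zero => exact ⟨p, d, rfl, h, le_rfl⟩
  | succ t ih =>
    have hvt := hv t (by omega)
    rw [← add_assoc] at h
    cases h with
    | var hv' => exact absurd hv' hvt
    | eq _ he h =>
      obtain ⟨q, e, rfl, h₁, h₂⟩ := ih (fun k hk => hv k (by omega)) h
      exact ⟨q, e, rfl, h₁, by rwa [mism_eq he]⟩
    | ne _ h =>
      obtain ⟨q, e, rfl, h₁, h₂⟩ := ih (fun k hk => hv k (by omega)) h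
      refine ⟨q, e, rfl, h₁, ?_⟩
      by_cases he : a (g + t) = w (q + t)
      · rw [mism_eq he]; omega
      · rw [mism_ne he]; omega

/-- Every position is the end of a maximal run of positions with a given property. -/
theorem exists_run_start (P : ℕ → Prop) (j : ℕ) :
    ∃ i t, j = i + t ∧ (∀ k < t, P (i + k)) ∧ (i = 0 ∨ ¬ P (i - 1)) := by
  induction j with
  | zero => exact ⟨0, 0, rfl, by simp, .inl rfl⟩
  | succ j ih =>
    by_cases hP : P j
    · obtain ⟨i, t, rfl, h₁, h₂⟩ := ih
      refine ⟨i, t + 1, rfl, fun k hk => ?_, h₂⟩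
      rcases Nat.lt_succ_iff_lt_or_eq.1 hk with h | rfl
      · exact h₁ k h
      · exact hP
    · exact ⟨j + 1, 0, rfl, by simp, .inr hP⟩

/-- A nonempty run of variables ends before `g`. -/
structure Closed (v : ℕ → Prop) (g : ℕ) : Prop where
  pos : 0 < g
  var : v (g - 1)
  not_var : ¬ v g

/-- The variable directly in front of g absorbs the additional letters. -/
theorem Closed.mono_right (hg : Closed v g) (h : Reach w a v d g p) (hp : p ≤ q) :
    Reach w a v d g q := by
  obtain ⟨g, rfl⟩ : ∃ g', g = g' + 1 := ⟨g - 1, by have := hg.pos; omega⟩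
  exact h.mono_right hg.var hp

/-- The first position from `i` on which is not a variable is `j`. -/
structure IsNext (v : ℕ → Prop) (i j : ℕ) : Prop where
  le : i ≤ j
  not_var : ¬ v j
  var : ∀ k, i ≤ k → k < j → v k

theorem IsNext.closed (h : IsNext v (i + 1) j) (hv : v i) : Closed v j := by
  have := h.le
  refine ⟨by omega, ?_, h.not_var⟩
  by_cases hj : j = i + 1
  · simpa [hj] using hv
  · exact h.var _ (by omega) (by omega)

/-- The largest position after a run of variables that aligns with `p` with at most `d` mismatches
is `g`; `0` if there is none. -/
structure IsTop (w a : ℕ → ℕ) (v : ℕ → Prop) (d p g : ℕ) : Prop where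
  mem : g = 0 ∨ Closed v g ∧ Reach w a v d g p
  le : ∀ g', Closed v g' → Reach w a v d g' p → g' ≤ g

/-- The least number of mismatches for the prefixes of lengths `g` and `q`. -/
noncomputable def minDist (w a : ℕ → ℕ) (v : ℕ → Prop) (g q : ℕ) : ℕ :=
  sInf {d | Reach w a v d g q}

theorem minDist_reach (h : Reach w a v d g q) : Reach w a v (minDist w a v g q) g q :=
  Nat.sInf_mem (s := {d | Reach w a v d g q}) ⟨d, h⟩

theorem minDist_le (h : Reach w a v d g q) : minDist w a v g q ≤ d :=
  Nat.sInf_le (s := {d | Reach w a v d g q}) h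

/-- The least number of mismatches if the prefixes of lengths `g` and `q` are aligned and are
followed by `t` letters. -/
noncomputable def runCost (w a : ℕ → ℕ) (v : ℕ → Prop) (g q t : ℕ) : ℕ :=
  minDist w a v g q + mism w a g q t

theorem runCost_mono (h : i ≤ j) : runCost w a v g q i ≤ runCost w a v g q j :=
  Nat.add_le_add_left (mism_mono h) _

/-- The alignment of `g` and `q` can be continued by `t` letters. -/
structure Valid (v : ℕ → Prop) (m n g q t : ℕ) : Prop where
  le_m : g + t ≤ m
  le_n : q + t ≤ n
  letter : ∀ k < t, ¬ v (g + k)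

/-! ### The exploration of runs of letters, one layer for each number of mismatches. -/

variable {m n : ℕ} {nx E E' GP CI GP' CI' : ℕ → ℕ} {ok ok' ci : ℕ}

/-- The end of a run of letters has been registered. -/
structure Done (v : ℕ → Prop) (m n : ℕ) (nx E : ℕ → ℕ) (ok g q t : ℕ) : Prop where
  var : v (g + t) → nx (g + t + 1) ≤ E (q + t)
  last : g + t = m → q + t = n → ok ≠ 0

theorem Done.mono (h : Done v m n nx E ok g q t) (hE : ∀ q, E q ≤ E' q)
    (hok : ok ≠ 0 → ok' ≠ 0) : Done v m n nx E' ok' g q t :=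
  ⟨fun hv => (h.var hv).trans (hE _), fun h₁ h₂ => hok (h.last h₁ h₂)⟩

/-- The run of letters that follows the alignment of `g` and `q` has been explored for at most `d`
mismatches. -/
structure Job (w a : ℕ → ℕ) (v : ℕ → Prop) (m n : ℕ) (nx E : ℕ → ℕ) (ok d g q ci : ℕ) : Prop where
  top : IsTop w a v d q g
  -- The value g = 0 means that there is no alignment, except at q = 0, where the empty prefixes are
  -- aligned.
  explored : q = 0 ∨ 0 < g → ci = 0 → ∀ t, Valid v m n g q t → runCost w a v g q t ≤ d
  wait : ci ≠ 0 → (q = 0 ∨ 0 < g) ∧ ∃ t, ci = g + t + 1 ∧ Valid v m n g q (t + 1) ∧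
    a (g + t) ≠ w (q + t) ∧ runCost w a v g q t = d
  done : q = 0 ∨ 0 < g → ∀ t, Valid v m n g q t → runCost w a v g q t ≤ d →
    Done v m n nx E ok g q t

theorem Job.mono (h : Job w a v m n nx E ok d g q ci) (hE : ∀ q, E q ≤ E' q)
    (hok : ok ≠ 0 → ok' ≠ 0) : Job w a v m n nx E' ok' d g q ci :=
  ⟨h.top, h.explored, h.wait, fun h₁ t h₂ h₃ => (h.done h₁ t h₂ h₃).mono hE hok⟩

/-- The invariant of the algorithm when the positions less than `p` have been processed for at most
`d` mismatches. -/
structure LayerInv (w a : ℕ → ℕ) (v : ℕ → Prop) (m n : ℕ) (nx : ℕ → ℕ) (d p : ℕ)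
    (GP CI E : ℕ → ℕ) (g ok : ℕ) : Prop where
  -- `GP q` is the pattern position plus 1, so that 0 stands for no job yet; `CI q` is where the run
  -- resumes behind a mismatch, or 0 if nothing is left; `E q` is the largest position registered at
  -- q.
  cur : ∀ q < p, ∃ g', GP q = g' + 1 ∧ Job w a v m n nx E ok d g' q (CI q)
  -- From p on, the data are still those of the previous layer.
  old : ∀ q, p ≤ q → q ≤ n → d = 0 ∧ GP q = 0 ∨
    ∃ e g', d = e + 1 ∧ GP q = g' + 1 ∧ Job w a v m n nx E ok e g' q (CI q)
  sound : ∀ q ≤ n, E q = 0 ∨ Closed v (E q) ∧ Reach w a v d (E q) q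
  first : v 0 → nx 0 ≤ E 0
  run : p = 0 ∧ g = 0 ∨ ∃ p', p = p' + 1 ∧ IsTop w a v d p' g
  found : ok ≠ 0 → Reach w a v d m n

theorem IsTop.reach (h : IsTop w a v d q g) (hq : q = 0 ∨ 0 < g) : Reach w a v d g q := by
  rcases h.mem with h₀ | h₀
  · obtain rfl : q = 0 := by omega
    subst h₀
    exact .zero d
  · exact h₀.2

theorem LayerInv.init (hnx : IsNext v 0 (nx 0)) (hE : E 0 = nx 0) (hE' : ∀ q, 0 < q → E q = 0) :
    LayerInv w a v m n nx 0 0 (fun _ => 0) (fun _ => 0) E 0 0 where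
  cur := by simp
  old := by simp
  sound q _ := by
    rcases Nat.eq_zero_or_pos q with rfl | hq
    · rw [hE]
      rcases Nat.eq_zero_or_pos (nx 0) with h0 | h0
      · exact .inl h0
      · exact .inr ⟨⟨h0, hnx.var _ (by omega) (by omega), hnx.not_var⟩,
          (Reach.zero 0).vars (by omega) hnx.var⟩
    · exact .inl (hE' q hq)
  first _ := hE.ge
  run := .inl ⟨rfl, rfl⟩
  found := by simp

/-- Nothing is reset except the running top position: what is attainable with d mismatches is
attainable with d + 1, and the jobs just completed become the old ones. -/
theorem LayerInv.nextLayer (h : LayerInv w a v m n nx d (n + 1) GP CI E g ok) :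
    LayerInv w a v m n nx (d + 1) 0 GP CI E 0 ok where
  cur := by simp
  old q _ hq := by
    obtain ⟨g', h₁, h₂⟩ := h.cur q (by omega)
    exact .inr ⟨d, g', rfl, h₁, h₂⟩
  sound q hq := (h.sound q hq).imp_right fun h => ⟨h.1, h.2.mono (by omega)⟩
  first := h.first
  run := .inl ⟨rfl, rfl⟩
  found hok := (h.found hok).mono (by omega)

/-- A run of letters that leads to an alignment of `i` and `p` comes from an explored run, or else
there is an alignment of `q < p` with a position that is separated from `i` by a variable. -/
theorem LayerInv.letters (h : LayerInv w a v m n nx d p GP CI E g ok) (hi : 0 < i)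
    (hv : ¬ v (i - 1)) (him : i ≤ m) (hr : Reach w a v d i q) (hqn : q ≤ n) (hqp : q ≤ p) :
    (∃ g' q', q' < q ∧ Closed v g' ∧ i < g' ∧ Reach w a v d g' q') ∨
    ∃ g' q' t, i = g' + t ∧ q = q' + t ∧ Done v m n nx E ok g' q' t := by
  obtain ⟨i₀, t, rfl, hl, hs⟩ := exists_run_start (fun k => ¬ v k) i
  have ht : 0 < t := by
    rcases Nat.eq_zero_or_pos t with rfl | ht
    · rcases hs with hs | hs
      · omega
      · exact absurd hv hs
    · exact ht
  obtain ⟨q₀, e, rfl, hr₀, he⟩ := hr.letters_inv hl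
  obtain ⟨G, hG, hJ⟩ := h.cur q₀ (by omega)
  have hmd := minDist_le hr₀
  have hr₁ : Reach w a v d i₀ q₀ := hr₀.mono (by omega)
  have hact : (i₀ = 0 ∧ q₀ = 0) ∨ Closed v i₀ := by
    rcases Nat.eq_zero_or_pos i₀ with h0 | h0
    · left
      subst h0
      cases hr₀
      exact ⟨rfl, rfl⟩
    · right
      refine ⟨h0, ?_, by simpa using hl 0 ht⟩
      rcases hs with hs | hs
      · omega
      · exact not_not.1 hs
  have hle : i₀ ≤ G := by
    rcases hact with hz | hc
    · omega
    · exact hJ.top.le _ hc hr₁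
  -- If the top position G at q₀ is the start of the run, its job has registered the end. Otherwise
  -- G lies behind the whole run, since the variable in front of G cannot be one of the letters.
  rcases hle.eq_or_lt with rfl | hlt
  · right
    refine ⟨i₀, q₀, t, rfl, rfl, hJ.done ?_ t ⟨him, hqn, hl⟩ ?_⟩
    · rcases hact with hz | hc
      · exact .inl hz.2
      · exact .inr hc.pos
    · unfold runCost; omega
  · left
    rcases hJ.top.mem with h0 | ⟨hc, hrG⟩
    · omega
    refine ⟨G, q₀, by omega, hc, ?_, hrG⟩
    by_contra hn
    exact hl (G - 1 - i₀) (by omega) (by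
      rw [show i₀ + (G - 1 - i₀) = G - 1 by omega]; exact hc.var)

/-- Consider an attainable G that follows a run of variables beginning at i. If a variable of the
run can give back a letter, G is attainable at p - 1 and thus at most g. Otherwise i is aligned with
p. For i = 0 the position was registered in `E 0` at the outset. For i > 0 a run of letters ends
here, and by `LayerInv.letters` either its end has put G into `E p`, or a closed position behind i,
hence at least G, is attainable for a shorter prefix and bounded by g. -/
theorem LayerInv.isTop (h : LayerInv w a v m n nx d p GP CI E g ok) (hpn : p ≤ n)
    (hvm : ∀ i, m ≤ i → ¬ v i) (hnx : ∀ i ≤ m, IsNext v i (nx i)) :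
    IsTop w a v d p (max g (E p)) := by
  constructor
  · rcases le_total g (E p) with hle | hle
    · rw [max_eq_right hle]; exact h.sound p hpn
    · rw [max_eq_left hle]
      rcases h.run with hr | ⟨p', rfl, hr⟩
      · exact .inl hr.2
      · exact hr.mem.imp_right fun hr => ⟨hr.1, hr.1.mono_right hr.2 (by omega)⟩
  · intro G hG hr
    have hprev : ∀ p' G', p' < p → Closed v G' → Reach w a v d G' p' → G ≤ G' → G ≤ max g (E p) := by
      intro p' G' hp' hc hr' hle
      rcases h.run with h0 | ⟨p₁, rfl, ht⟩
      · omega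
      · have := ht.le G' hc (hc.mono_right hr' (by omega))
        omega
    obtain ⟨i, t, rfl, hvt, hs⟩ := exists_run_start v G
    have ht : 0 < t := by
      rcases Nat.eq_zero_or_pos t with rfl | ht
      · rcases hs with hs | hs
        · exact absurd hG.pos (by omega)
        · exact absurd hG.var hs
      · exact ht
    have hvk : ∀ k, i ≤ k → k < i + t → v k := fun k h₁ h₂ => by
      have := hvt (k - i) (by omega)
      rwa [show i + (k - i) = k by omega] at this
    have him : i < m := by
      by_contra hn
      exact hvm i (by omega) (hvk i le_rfl (by omega))
    have hnext : nx (i + 1) = i + t := by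
      have hn := hnx (i + 1) him
      rcases lt_trichotomy (nx (i + 1)) (i + t) with hlt | heq | hgt
      · exact absurd (hvk _ (by have := hn.le; omega) hlt) hn.not_var
      · exact heq
      · exact absurd (hn.var _ (by omega) hgt) hG.not_var
    rcases Reach.vars_inv (by omega) hvk hr with hi | ⟨p', rfl, hr'⟩
    · rcases Nat.eq_zero_or_pos i with rfl | hi0
      · cases hi
        have := h.first (hvk 0 le_rfl (by omega))
        have hn := hnx 0 (by omega)
        have : t ≤ nx 0 := by
          by_contra hc
          exact hn.not_var (hvk _ (by omega) (by omega))
        omega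
      · have hvi : ¬ v (i - 1) := by
          rcases hs with hs | hs
          · omega
          · exact hs
        rcases h.letters hi0 hvi him.le hi hpn le_rfl with
          ⟨g', q', hq', hc, hig, hr'⟩ | ⟨g', q', t', rfl, rfl, hD⟩
        · refine hprev q' g' hq' hc hr' ?_
          by_contra hn
          exact hc.not_var (hvk g' (by omega) (by omega))
        · have := hD.var (hvk _ le_rfl (by omega))
          omega
    · exact hprev p' _ (by omega) hG hr' le_rfl

/-- If the pattern ends with a variable, then m is the top position at n, and its empty run of
letters has set the flag. If it ends with a letter, `LayerInv.letters` applies, and its first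
alternative would require a variable behind the end of the pattern. -/
theorem LayerInv.complete (h : LayerInv w a v m n nx d (n + 1) GP CI E g ok)
    (hvm : ∀ i, m ≤ i → ¬ v i) (hm : 0 < m) (hr : Reach w a v d m n) : ok ≠ 0 := by
  by_cases hv : v (m - 1)
  · obtain ⟨G, hG, hJ⟩ := h.cur n (by omega)
    have hc : Closed v m := ⟨hm, hv, hvm m le_rfl⟩
    have hle := hJ.top.le m hc hr
    have hGm : G = m := by
      rcases hJ.top.mem with h0 | ⟨h0, _⟩
      · omega
      · by_contra hne
        exact hvm (G - 1) (by omega) h0.var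
    subst hGm
    refine (hJ.done (.inr hm) 0 ⟨le_rfl, le_rfl, by simp⟩ ?_).last rfl rfl
    exact minDist_le hr
  · rcases h.letters hm hv le_rfl hr le_rfl (by omega) with
      ⟨g', q', hq', hc, hig, hr'⟩ | ⟨g', q', t', h₁, h₂, hD⟩
    · exact absurd hc.var (hvm _ (by omega))
    · exact hD.last h₁.symm h₂.symm

/-- Where the exploration of a run of letters starts or continues. -/
structure Start (w a : ℕ → ℕ) (v : ℕ → Prop) (m n : ℕ) (nx E : ℕ → ℕ) (ok d g q t : ℕ) : Prop where
  act : q = 0 ∨ 0 < g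
  valid : Valid v m n g q t
  cost : runCost w a v g q t = d
  done : ∀ k < t, Done v m n nx E ok g q k

theorem Start.reach (h : Start w a v m n nx E ok d g q t) (ht : IsTop w a v d q g) :
    Reach w a v d (g + t) (q + t) := by
  have := (minDist_reach (ht.reach h.act)).letters h.valid.letter
  rwa [← h.cost]

/-- Matching letters cost nothing, and as neither a variable nor the end of the pattern is passed,
there is nothing to register on the way. -/
theorem Start.walk {l : ℕ} (h : Start w a v m n nx E ok d g q t)
    (hl : ∀ k < l, g + t + k < m ∧ q + t + k < n ∧ ¬ v (g + t + k) ∧ a (g + t + k) = w (q + t + k)) :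
    Start w a v m n nx E ok d g q (t + l) where
  act := h.act
  valid := by
    have h₁ := h.valid.le_m
    have h₂ := h.valid.le_n
    refine ⟨?_, ?_, fun k hk => ?_⟩
    · rcases Nat.eq_zero_or_pos l with h0 | h0
      · omega
      · have := hl (l - 1) (by omega); omega
    · rcases Nat.eq_zero_or_pos l with h0 | h0
      · omega
      · have := hl (l - 1) (by omega); omega
    · rcases Nat.lt_or_ge k t with h' | h'
      · exact h.valid.letter k h'
      · have := (hl (k - t) (by omega)).2.2.1
        rwa [show g + t + (k - t) = g + k by omega] at this
  cost := by
    rw [← h.cost, runCost, runCost, mism_add fun k hk => ?_]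
    have := (hl k hk).2.2.2
    simpa only [add_assoc] using this
  done k hk := by
    rcases Nat.lt_or_ge k t with h' | h'
    · exact h.done k h'
    · have := hl (k - t) (by omega)
      rw [show g + t + (k - t) = g + k by omega] at this
      exact ⟨fun hv => absurd hv this.2.2.1, fun h₁ => by omega⟩

theorem LayerInv.step {g' ci : ℕ} (h : LayerInv w a v m n nx d p GP CI E g ok)
    (hGP : ∀ q ≠ p, GP' q = GP q) (hGP' : GP' p = g' + 1)
    (hCI : ∀ q ≠ p, CI' q = CI q) (hCI' : CI' p = ci)
    (hE : ∀ q, E q ≤ E' q) (hok : ok ≠ 0 → ok' ≠ 0)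
    (hsound : ∀ q ≤ n, E' q = 0 ∨ Closed v (E' q) ∧ Reach w a v d (E' q) q)
    (hfound : ok' ≠ 0 → Reach w a v d m n)
    (hJ : Job w a v m n nx E' ok' d g' p ci) :
    LayerInv w a v m n nx d (p + 1) GP' CI' E' g' ok' where
  cur q hq := by
    by_cases hqp : q = p
    · subst hqp; exact ⟨g', hGP', hCI' ▸ hJ⟩
    · obtain ⟨g'', h₁, h₂⟩ := h.cur q (by omega)
      exact ⟨g'', by rw [hGP q hqp, h₁], by rw [hCI q hqp]; exact h₂.mono hE hok⟩
  old q hpq hqn := by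
    rcases h.old q (by omega) hqn with ⟨h₁, h₂⟩ | ⟨e, g'', h₁, h₂, h₃⟩
    · exact .inl ⟨h₁, by rw [hGP q (by omega), h₂]⟩
    · exact .inr ⟨e, g'', h₁, by rw [hGP q (by omega), h₂], by
        rw [hCI q (by omega)]; exact h₃.mono hE hok⟩
  sound := hsound
  first hv := (h.first hv).trans (hE 0)
  run := .inr ⟨p, rfl, hJ.top⟩
  found := hfound

/-- The job for the position `p` is new. -/
theorem LayerInv.start_new {g' : ℕ} (h : LayerInv w a v m n nx d p GP CI E g ok) (hpn : p ≤ n)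
    (ht : IsTop w a v d p g') (hvm : ∀ i, m ≤ i → ¬ v i) (hne : GP p ≠ g' + 1)
    (hact : p = 0 ∨ 0 < g') : Start w a v m n nx E ok d g' p 0 where
  act := hact
  valid := by
    refine ⟨?_, hpn, by simp⟩
    rcases ht.mem with h0 | ⟨h0, _⟩
    · omega
    · by_contra hn
      exact hvm (g' - 1) (by omega) h0.var
  cost := by
    have hr := ht.reach hact
    have hle := minDist_le hr
    show minDist w a v g' p + 0 = d
    rcases h.old p le_rfl hpn with ⟨h₁, -⟩ | ⟨e, g'', rfl, h₂, h₃⟩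
    · omega
    -- If fewer mismatches sufficed, this position would have been attainable in the previous layer
    -- and hence its top position, so the job would not be new.
    · by_contra hcon
      have hr' : Reach w a v e g' p := (minDist_reach hr).mono (by omega)
      have hle' : g'' ≤ g' := by
        rcases h₃.top.mem with h0 | ⟨h0, h1⟩
        · omega
        · exact ht.le _ h0 (h1.mono (by omega))
      have hle'' : g' ≤ g'' := by
        rcases ht.mem with h0 | ⟨h0, h1⟩
        · omega
        · exact h₃.top.le _ h0 hr'
      exact hne (by rw [h₂]; omega)
  done k hk := by omega

/-- The job for the position `p` is continued. -/
theorem LayerInv.start_old {g' : ℕ} (h : LayerInv w a v m n nx d p GP CI E g ok) (hpn : p ≤ n)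
    (hGP : GP p = g' + 1) (hCI : CI p ≠ 0) :
    ∃ t, CI p = g' + t ∧ Start w a v m n nx E ok d g' p t := by
  rcases h.old p le_rfl hpn with ⟨h₁, h₂⟩ | ⟨e, g'', rfl, h₂, h₃⟩
  · omega
  · obtain rfl : g'' = g' := by omega
    obtain ⟨hact, t, ht, hv, hne, hc⟩ := h₃.wait hCI
    refine ⟨t + 1, ht, hact, hv, ?_, fun k hk => ?_⟩
    -- The mismatch at which the job waited uses up the additional one that the new layer allows.
    · rw [runCost, mism_ne hne, ← hc, runCost]; omega
    · refine h₃.done hact k ⟨?_, ?_, fun j hj => hv.letter j (by omega)⟩ ?_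
      · have := hv.le_m; omega
      · have := hv.le_n; omega
      · rw [← hc]; exact runCost_mono (by omega)

/-- Nothing is to be done for the position `p`. -/
theorem LayerInv.step_idle {g' : ℕ} (h : LayerInv w a v m n nx d p GP CI E g ok) (hpn : p ≤ n)
    (ht : IsTop w a v d p g') (hGP : ∀ q ≠ p, GP' q = GP q) (hGP' : GP' p = g' + 1)
    (hCI : ∀ q ≠ p, CI' q = CI q) (hCI' : CI' p = 0)
    (hc : GP p = g' + 1 ∧ CI p = 0 ∨ p ≠ 0 ∧ g' = 0) :
    LayerInv w a v m n nx d (p + 1) GP' CI' E g' ok := by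
  refine h.step hGP hGP' hCI hCI' (fun _ => le_rfl) id h.sound h.found ?_
  rcases hc with ⟨h₁, h₂⟩ | h₁
  · rcases h.old p le_rfl hpn with ⟨h₃, h₄⟩ | ⟨e, g'', rfl, h₃, h₄⟩
    · omega
    · obtain rfl : g'' = g' := by omega
      rw [h₂] at h₄
      exact ⟨ht, fun hact h0 t hv => (h₄.explored hact h0 t hv).trans (by omega), by simp,
        fun hact t hv _ => h₄.done hact t hv (h₄.explored hact rfl t hv)⟩
  · exact ⟨ht, fun h => by omega, by simp, fun h => by omega⟩

/-- The run of letters ends with the pattern. -/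
theorem LayerInv.step_last {g' t : ℕ} (h : LayerInv w a v m n nx d p GP CI E g ok)
    (ht : IsTop w a v d p g') (hs : Start w a v m n nx E ok d g' p t)
    (hvm : ∀ i, m ≤ i → ¬ v i) (hGP : ∀ q ≠ p, GP' q = GP q) (hGP' : GP' p = g' + 1)
    (hCI : ∀ q ≠ p, CI' q = CI q) (hCI' : CI' p = 0)
    (hm : g' + t = m) (hok : ok' = if p + t = n then 1 else ok) :
    LayerInv w a v m n nx d (p + 1) GP' CI' E g' ok' := by
  have hok' : ok ≠ 0 → ok' ≠ 0 := fun h0 => by rw [hok]; split <;> omega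
  have hle : ∀ k, Valid v m n g' p k → k ≤ t := fun k hk => by have := hk.le_m; omega
  refine h.step hGP hGP' hCI hCI' (fun _ => le_rfl) hok' h.sound ?_ ⟨ht, fun _ _ k hk => ?_,
    by simp, fun _ k hk _ => ?_⟩
  · intro h0
    by_cases hn : p + t = n
    · rw [← hm, ← hn]; exact hs.reach ht
    · rw [hok, if_neg hn] at h0; exact h.found h0
  · rw [← hs.cost]; exact runCost_mono (hle k hk)
  · rcases (hle k hk).eq_or_lt with rfl | hlt
    · exact ⟨fun hv => absurd hv (hvm _ (by omega)), fun _ h₂ => by rw [hok, if_pos h₂]; omega⟩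
    · exact (hs.done k hlt).mono (fun _ => le_rfl) hok'

/-- The run of letters ends with a variable. -/
theorem LayerInv.step_var {g' t : ℕ} (h : LayerInv w a v m n nx d p GP CI E g ok)
    (ht : IsTop w a v d p g') (hs : Start w a v m n nx E ok d g' p t)
    (hnx : ∀ i ≤ m, IsNext v i (nx i)) (hGP : ∀ q ≠ p, GP' q = GP q) (hGP' : GP' p = g' + 1)
    (hCI : ∀ q ≠ p, CI' q = CI q) (hCI' : CI' p = 0)
    (hm : g' + t < m) (hv : v (g' + t))
    (hE : ∀ q, E' q = if q = p + t then max (E q) (nx (g' + t + 1)) else E q) :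
    LayerInv w a v m n nx d (p + 1) GP' CI' E' g' ok := by
  have hE' : ∀ q, E q ≤ E' q := fun q => by rw [hE]; split <;> omega
  have hle : ∀ k, Valid v m n g' p k → k ≤ t := fun k hk => by
    by_contra hn
    exact hk.letter t (by omega) hv
  refine h.step hGP hGP' hCI hCI' hE' id ?_ h.found ⟨ht, fun _ _ k hk => ?_,
    by simp, fun _ k hk _ => ?_⟩
  · intro q hq
    rw [hE]
    split
    · next hqt =>
      rcases le_total (E q) (nx (g' + t + 1)) with hle | hle
      · rw [max_eq_right hle]
        have hn := hnx (g' + t + 1) (by omega)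
        refine .inr ⟨hn.closed hv, ?_⟩
        rw [hqt]
        exact (Reach.var hv le_rfl (hs.reach ht)).vars hn.le hn.var
      · rw [max_eq_left hle]; exact h.sound q hq
    · exact h.sound q hq
  · rw [← hs.cost]; exact runCost_mono (hle k hk)
  · rcases (hle k hk).eq_or_lt with rfl | hlt
    · exact ⟨fun _ => by rw [hE, if_pos rfl]; omega, fun h₁ => by omega⟩
    · exact (hs.done k hlt).mono hE' id

/-- The run of letters is interrupted by a mismatch or ends with the word. -/
theorem LayerInv.step_letter {g' t : ℕ} (h : LayerInv w a v m n nx d p GP CI E g ok)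
    (ht : IsTop w a v d p g') (hs : Start w a v m n nx E ok d g' p t)
    (hGP : ∀ q ≠ p, GP' q = GP q) (hGP' : GP' p = g' + 1)
    (hCI : ∀ q ≠ p, CI' q = CI q) (hCI' : CI' p = if p + t < n then g' + t + 1 else 0)
    (hm : g' + t < m) (hv : ¬ v (g' + t)) (hne : p + t < n → a (g' + t) ≠ w (p + t)) :
    LayerInv w a v m n nx d (p + 1) GP' CI' E g' ok := by
  -- A longer run would include the mismatch at t, and the cost up to t is already d.
  have hlt : ∀ k, Valid v m n g' p k → runCost w a v g' p k ≤ d → k ≤ t := fun k hk hc => by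
    by_contra hn
    have h₁ := hk.le_n
    have h₂ := runCost_mono (w := w) (a := a) (v := v) (g := g') (q := p) (show t + 1 ≤ k by omega)
    rw [runCost, mism_ne (hne (by omega)), ← add_assoc] at h₂
    have h₃ := hs.cost
    rw [runCost] at h₃
    omega
  refine h.step hGP hGP' hCI hCI' (fun _ => le_rfl) id h.sound h.found ⟨ht, fun _ h0 k hk => ?_,
    fun h0 => ⟨hs.act, t, ?_⟩, fun _ k hk hc => ?_⟩
  · have h₁ : ¬ p + t < n := fun hc => by rw [if_pos hc] at h0; omega
    have h₂ := hk.le_n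
    rw [← hs.cost]; exact runCost_mono (by omega)
  · have h₁ : p + t < n := by
      by_contra hc
      exact h0 (if_neg hc)
    refine ⟨if_pos h₁, ⟨by omega, by omega, fun k hk => ?_⟩, hne h₁, hs.cost⟩
    rcases Nat.lt_succ_iff_lt_or_eq.1 hk with h' | rfl
    · exact hs.valid.letter k h'
    · exact hv
  · rcases (hlt k hk hc).eq_or_lt with rfl | hlt
    · exact ⟨fun h' => absurd h' hv, fun h₁ => by omega⟩
    · exact hs.done k hlt

end Reach

end PatternMatching

/-! ## The distance of a pattern and a word -/

namespace PatternMatching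

/-- Regularity is stated by counting with the Boolean equality of the sum type; turning a count into
membership needs this equality to be lawful. -/
instance {A X : Type} [DecidableEq A] [DecidableEq X] : LawfulBEq (A ⊕ X) where
  eq_of_beq {y z} h := by
    rcases y with y | y <;> rcases z with z | z <;> simp_all [BEq.beq, Sum.instBEq.beq]
  rfl {y} := by rcases y with y | y <;> simp [BEq.beq, Sum.instBEq.beq]

section
variable {A X : Type}

theorem subst_append (h : X → List A) (α β : Pattern A X) :
    subst h (α ++ β) = subst h α ++ subst h β := List.flatMap_append

theorem subst_congr {h h' : X → List A} {α : Pattern A X}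
    (hh : ∀ x, Sum.inr x ∈ α → h x = h' x) : subst h α = subst h' α := by
  induction α with
  | nil => rfl
  | cons y α ih =>
    simp only [subst, List.flatMap_cons] at ih ⊢
    rw [ih fun x hx => hh x (by simp [hx])]
    rcases y with y | y
    · rfl
    · simp [hh y (by simp)]

variable [DecidableEq A]

theorem hamming_append {u v u' v' : List A} (h : u.length = v.length) :
    hamming (u ++ u') (v ++ v') = hamming u v + hamming u' v' := by
  simp [hamming, List.zip_append h]

theorem hamming_self (u : List A) : hamming u u = 0 := by
  induction u with
  | nil => rfl
  | cons y u ih => simpa [hamming] using ih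

theorem hamming_singleton (y z : A) : hamming [y] [z] = if y = z then 0 else 1 := by
  by_cases h : y = z <;> simp [hamming, h]

/-- The sequences `f` and `a` encode the word `w` and the pattern `α`; `v` holds for the positions
of the variables. -/
structure Encodes (w : List A) (α : Pattern A X) (f a : ℕ → ℕ) (v : ℕ → Prop) : Prop where
  letter : ∀ (i : ℕ) (hi : i < α.length) (b : A), α[i] = Sum.inl b →
    ¬ v i ∧ ∀ (p : ℕ) (hp : p < w.length), a i = f p ↔ b = w[p]
  var : ∀ (i : ℕ) (hi : i < α.length) (x : X), α[i] = Sum.inr x → v i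

variable {w : List A} {α : Pattern A X} {f a : ℕ → ℕ} {v : ℕ → Prop}

theorem Encodes.reach (he : Encodes w α f a v) (h : X → List A) :
    ∀ i ≤ α.length, (subst h (α.take i)).length ≤ w.length →
      Reach f a v (hamming (subst h (α.take i)) (w.take (subst h (α.take i)).length)) i
        (subst h (α.take i)).length := by
  intro i
  induction i with
  | zero => intro _ _; exact .zero _
  | succ i ih =>
    intro hi
    have hi' : i < α.length := hi
    have ht : α.take (i + 1) = α.take i ++ [α[i]] := (List.take_concat_get' α i hi').symm
    rw [ht, subst_append]
    generalize hu : subst h (α.take i) = u at *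
    intro hw
    rw [List.length_append] at hw ⊢
    have ih' := ih (by omega) (by omega)
    have hlen : (w.take u.length).length = u.length := by simp; omega
    rw [List.take_add, hamming_append hlen.symm]
    rcases hα : α[i] with b | x
    · obtain ⟨hv, hb⟩ := he.letter i hi' b hα
      have hs : subst h [Sum.inl b] = [b] := by simp [subst]
      rw [hα, hs] at hw
      simp only [List.length_singleton] at hw
      rw [hs, List.length_singleton]
      have hdrop : (w.drop u.length).take 1 = [w[u.length]] := by
        rw [List.drop_eq_getElem_cons hw]; rfl
      rw [hdrop, hamming_singleton]
      split
      · next hbw => exact .eq hv ((hb _ hw).2 hbw) ih'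
      · exact .ne hv ih'
    · exact .var (he.var i hi' x hα) (by omega) (ih'.mono (by omega))

/-- Every variable is mapped to the factor of the word with which it is aligned, without mismatches.
By regularity it does not occur earlier, so redefining the substitution there leaves the image of
the preceding prefix unchanged. -/
theorem Encodes.exists_subst [DecidableEq X] (he : Encodes w α f a v) (hα : IsRegular α) {d i p : ℕ}
    (hr : Reach f a v d i p) (hi : i ≤ α.length) (hp : p ≤ w.length) :
    ∃ h : X → List A, (subst h (α.take i)).length = p ∧
      hamming (subst h (α.take i)) (w.take p) ≤ d := by
  induction hr with
  | zero d => exact ⟨fun _ => [], by simp [subst], by simp [subst, hamming]⟩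
  | @var d i q p hv hq hr ih =>
    obtain ⟨h, h₁, h₂⟩ := ih (by omega) (by omega)
    have hi' : i < α.length := hi
    have ht : α.take (i + 1) = α.take i ++ [α[i]] := (List.take_concat_get' α i hi').symm
    rcases hαi : α[i] with b | x
    · exact absurd hv (he.letter i hi' b hαi).1
    · have hx : Sum.inr x ∉ α.take i := fun hmem => by
        have h₃ := (List.take_sublist (i + 1) α).count_le (Sum.inr x)
        rw [ht, hαi, List.count_append, List.count_singleton_self] at h₃
        have h₄ := List.count_pos_iff.2 hmem
        have := hα x
        omega
      set y := (w.drop q).take (p - q) with hy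
      have hyl : y.length = p - q := by simp [hy]; omega
      have hcong : subst (Function.update h x y) (α.take i) = subst h (α.take i) :=
        subst_congr fun z hz => by
          have : z ≠ x := by rintro rfl; exact hx hz
          simp [this]
      have hs : subst (Function.update h x y) [Sum.inr x] = y := by
        show Function.update h x y x ++ [] = y
        rw [List.append_nil, Function.update_self]
      refine ⟨Function.update h x y, ?_, ?_⟩
      · rw [ht, hαi, subst_append, hcong, hs, List.length_append, h₁, hyl]; omega
      · have hw : w.take p = w.take q ++ y := by
          rw [hy, ← List.take_add]; congr 1; omega
        rw [ht, hαi, subst_append, hcong, hs, hw, hamming_append (by rw [h₁, List.length_take]; omega),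
          hamming_self]
        exact h₂
  | @eq d i p hv hab hr ih =>
    obtain ⟨h, h₁, h₂⟩ := ih (by omega) (by omega)
    have hi' : i < α.length := hi
    have hp' : p < w.length := hp
    have ht : α.take (i + 1) = α.take i ++ [α[i]] := (List.take_concat_get' α i hi').symm
    rcases hαi : α[i] with b | x
    · have hs : subst h [Sum.inl b] = [b] := by simp [subst]
      refine ⟨h, ?_, ?_⟩
      · rw [ht, hαi, subst_append, hs, List.length_append, h₁]; rfl
      · rw [ht, hαi, subst_append, hs, ← List.take_concat_get' w p hp',
          hamming_append (by rw [h₁, List.length_take]; omega), hamming_singleton,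
          if_pos (((he.letter i hi' b hαi).2 p hp').1 hab)]
        exact h₂
    · exact absurd (he.var i hi' x hαi) hv
  | @ne d i p hv hr ih =>
    obtain ⟨h, h₁, h₂⟩ := ih (by omega) (by omega)
    have hi' : i < α.length := hi
    have hp' : p < w.length := hp
    have ht : α.take (i + 1) = α.take i ++ [α[i]] := (List.take_concat_get' α i hi').symm
    rcases hαi : α[i] with b | x
    · have hs : subst h [Sum.inl b] = [b] := by simp [subst]
      refine ⟨h, ?_, ?_⟩
      · rw [ht, hαi, subst_append, hs, List.length_append, h₁]; rfl
      · rw [ht, hαi, subst_append, hs, ← List.take_concat_get' w p hp',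
          hamming_append (by rw [h₁, List.length_take]; omega), hamming_singleton]
        split <;> omega
    · exact absurd (he.var i hi' x hαi) hv

/-- The distance is the least number of mismatches for which `α` can be aligned with `w`. -/
theorem Encodes.reach_iff [DecidableEq X] (he : Encodes w α f a v) (hα : IsRegular α)
    (hadm : ∃ h : X → List A, Admissible α w h) (d : ℕ) :
    Reach f a v d α.length w.length ↔ patDist α w ≤ d := by
  constructor
  · intro hr
    obtain ⟨h, h₁, h₂⟩ := he.exists_subst hα hr le_rfl le_rfl
    rw [List.take_length] at h₁
    rw [List.take_length, List.take_length] at h₂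
    have hle : patDist α w ≤ hamming (subst h α) w := Nat.sInf_le ⟨h, h₁, rfl⟩
    exact hle.trans h₂
  · intro hd
    -- Over the empty set the infimum would be 0 without being attained; admissibility excludes
    -- this.
    have hne : {d : ℕ | ∃ h : X → List A, Admissible α w h ∧ d = hamming (subst h α) w}.Nonempty :=
      let ⟨h, hh⟩ := hadm
      ⟨_, h, hh, rfl⟩
    obtain ⟨h, h₁, h₂⟩ := Nat.sInf_mem hne
    have h₃ := he.reach h α.length le_rfl
    rw [List.take_length, h₁, List.take_length, ← h₂] at h₃
    exact (h₃ le_rfl).mono hd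

end

end PatternMatching

/-! ## The matching program -/

namespace WordRAM
open Suffix PatternMatching

/-- The encoded word `w` of length `n`, a separator, and the encoded pattern `a` of length `m`. -/
def joined (w a : ℕ → ℕ) (n m i : ℕ) : ℕ :=
  if i < n then w i else if i = n then 2 * n + 1 else if i < n + 1 + m then a (i - (n + 1)) else 0

/-- The bounds for the symbols of an encoded instance. -/
structure Symbols (w a : ℕ → ℕ) (n m : ℕ) : Prop where
  m_pos : 0 < m
  m_le : m ≤ n
  word_pos : ∀ i < n, 0 < w i
  word_le : ∀ i < n, w i ≤ n
  pat_pos : ∀ i < m, 0 < a i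
  pat_le : ∀ i, a i ≤ 2 * n
  pat_zero : ∀ i, m ≤ i → a i = 0

/-! ### Extensions in the word joined with the pattern. -/

section Joined
variable {w a : ℕ → ℕ} {n m i p l : ℕ}

theorem Symbols.isWord (h : Symbols w a n m) : IsWord (joined w a n m) (n + 1 + m) where
  pos i hi := by
    unfold joined
    split
    · next h₁ => exact h.word_pos i h₁
    · split
      · omega
      · exact h.pat_pos _ (by omega)
  zero i hi := by simp [joined, show ¬ i < n by omega, show i ≠ n by omega, show ¬ i < n + 1 + m by omega]

theorem Symbols.joined_le (h : Symbols w a n m) : joined w a n m i ≤ 2 * n + 1 := by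
  unfold joined
  split
  · next h₁ => have := h.word_le i h₁; omega
  · split
    · omega
    · split
      · have := h.pat_le (i - (n + 1)); omega
      · omega

theorem joined_word (h : i < n) : joined w a n m i = w i := by simp [joined, h]

theorem joined_sep : joined w a n m n = 2 * n + 1 := by simp [joined]

theorem Symbols.joined_pat (h : Symbols w a n m) : joined w a n m (n + 1 + i) = a i := by
  have h₁ : ¬ n + 1 + i < n := by omega
  have h₂ : n + 1 + i ≠ n := by omega
  by_cases h₃ : n + 1 + i < n + 1 + m
  · simp [joined, h₁, h₂, h₃]
  · simp [joined, h₁, h₂, h₃, h.pat_zero i (by omega)]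

/-- The extension stops by itself at every obstacle: letters of the word lie between 1 and n,
variables are larger than n, the separator 2 n + 1 exceeds every symbol of the pattern, and zeros
follow the pattern. So its length is that of the matching run of letters. -/
theorem Symbols.lce (h : Symbols w a n m) (hi : i < m) (hp : p < n)
    (hl : IsLce (joined w a n m) p (n + 1 + i) l) :
    (∀ k < l, i + k < m ∧ p + k < n ∧ ¬ n < a (i + k) ∧ a (i + k) = w (p + k)) ∧
      (p + l < n → i + l < m → a (i + l) ≠ w (p + l)) := by
  constructor
  · intro k
    induction k with
    | zero =>
      intro hk
      have := hl.1 0 hk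
      rw [add_zero, joined_word hp, add_zero, h.joined_pat] at this
      have hw := h.word_le p hp
      exact ⟨hi, hp, by rw [add_zero]; omega, by rw [add_zero, add_zero, this]⟩
    | succ k ih =>
      intro hk
      obtain ⟨h₁, h₂, -, -⟩ := ih (by omega)
      have := hl.1 (k + 1) hk
      rw [add_assoc (n + 1), h.joined_pat] at this
      have hle := h.pat_le (i + (k + 1))
      have hpn : p + (k + 1) < n := by
        by_contra hn
        rw [show p + (k + 1) = n by omega, joined_sep] at this
        omega
      rw [joined_word hpn] at this
      have hw := h.word_le _ hpn
      have hw' := h.word_pos _ hpn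
      refine ⟨?_, hpn, by omega, this.symm⟩
      by_contra hn
      rw [h.pat_zero _ (by omega)] at this
      omega
  · intro hpl hil he
    apply hl.2
    rw [joined_word hpl, add_assoc (n + 1), h.joined_pat, he]

end Joined

/-- Put the word, a separator and the pattern into the array 2. -/
def joinWords : Prog :=
  10 ≔ .reg 0 + 1 + .reg 1 ;; 14 ≔ 0 ;;
  .loop (lt (.reg 14) (.reg 0)) (.store 2 (.reg 14) (.load 0 (.reg 14)) ;; 14 ≔ .reg 14 + 1) ;;
  .store 2 (.reg 0) (2 * .reg 0 + 1) ;; 14 ≔ 0 ;;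
  .loop (lt (.reg 14) (.reg 1))
    (.store 2 (.reg 0 + 1 + .reg 14) (.load 1 (.reg 14)) ;; 14 ≔ .reg 14 + 1)

theorem joinWords_run {W n m : ℕ} {s : State} {w a : ℕ → ℕ} (h : Symbols w a n m)
    (hW : 1000 * n + 1000 < 2 ^ W) (h0 : s.reg 0 = n) (h1 : s.reg 1 = m) (m0 : s.mem 0 = w)
    (m1 : s.mem 1 = a) (m2 : ∀ i, s.mem 2 i = 0) :
    Run W joinWords (100 * n + 100) s fun s' => s'.reg 10 = n + 1 + m ∧
      ∀ i, s'.mem 2 i = joined w a n m i := by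
  have hm := h.m_le
  refine Run.assign (n + 1 + m) (by simp (disch := omega) [h0, h1]) (T₂ := 100 * n + 90) ?_
    (by simp [Expr.cost]; omega)
  refine Run.assign 0 (by simp (disch := omega)) (T₂ := 100 * n + 80) ?_ (by simp [Expr.cost]; omega)
  refine Run.seq (T₁ := 20 * n + 10) (T₂ := 50 * n + 50) (Q' := fun s' =>
    ∀ i, s'.mem 2 i = if i < n then w i else 0) ?_ ?_ (by omega)
  · refine Run.loop_den (fun s' => s'.reg 14 ≤ n ∧ ∀ i, s'.mem 2 i = if i < s'.reg 14 then w i else 0)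
      (fun s' => n - s'.reg 14) ⟨by simp, by simpa using m2⟩ rfl ?_ ?_ ?_
    · rintro s' hf ⟨hk, hI⟩ he
      have e0 : s'.reg 0 = n := by rw [hf.reg 0 rfl]; simpa using h0
      have em0 : s'.mem 0 = w := by rw [hf.mem 0 rfl]; simpa using m0
      generalize hkk : s'.reg 14 = k at *
      have hlt : k < n := by simpa (disch := omega) [hkk, e0] using he
      simp (disch := omega) [Prog.den, hkk, em0]
      refine ⟨⟨by omega, fun i => ?_⟩, by omega⟩
      rcases lt_trichotomy i k with h' | rfl | h'
      · simp [hI, h', h'.ne, h'.le]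
      · simp
      · simp [hI, h'.ne', h'.not_ge, h'.not_gt]
    · simp [Prog.bound, Expr.cost]; omega
    · rintro s' hf ⟨hk, hI⟩ he
      have e0 : s'.reg 0 = n := by rw [hf.reg 0 rfl]; simpa using h0
      have hlt : ¬ s'.reg 14 < n := by simpa (disch := omega) [e0] using he
      rw [show s'.reg 14 = n by omega] at hI
      exact hI
  intro s₁ f₁ q₁
  have c0 : s₁.reg 0 = n := by rw [f₁.reg 0 rfl]; simpa using h0
  have c1 : s₁.reg 1 = m := by rw [f₁.reg 1 rfl]; simpa using h1
  have c10 : s₁.reg 10 = n + 1 + m := by rw [f₁.reg 10 rfl]; simp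
  have cm1 : s₁.mem 1 = a := by rw [f₁.mem 1 rfl]; simpa using m1
  refine Run.store n (2 * n + 1) (by simpa using c0) (by simp (disch := omega) [c0])
    (T₂ := 50 * n + 40) ?_ (by simp [Expr.cost]; omega)
  refine Run.assign 0 (by simp (disch := omega)) (T₂ := 50 * n + 30) ?_ (by simp [Expr.cost]; omega)
  refine Run.loop_den (fun s' => s'.reg 14 ≤ m ∧ ∀ i, s'.mem 2 i =
      if i < n then w i else if i = n then 2 * n + 1 else
        if i < n + 1 + s'.reg 14 then a (i - (n + 1)) else 0)
    (fun s' => m - s'.reg 14) ⟨by simp, fun i => ?_⟩ rfl ?_ ?_ ?_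
  · simp [q₁]
    by_cases hin : i = n
    · simp [hin]
    · by_cases hlt : i < n
      · simp [hlt, hin]
      · simp [hin, hlt, show ¬ i ≤ n by omega]
  · rintro s' hf ⟨hk, hI⟩ he
    have e0 : s'.reg 0 = n := by rw [hf.reg 0 rfl]; simpa using c0
    have e1 : s'.reg 1 = m := by rw [hf.reg 1 rfl]; simpa using c1
    have em1 : s'.mem 1 = a := by
      rw [hf.mem 1 rfl, State.setReg_mem, State.setMem_mem_ne _ _ _ _ _ (by omega), cm1]
    generalize hkk : s'.reg 14 = k at *
    have hlt : k < m := by simpa (disch := omega) [hkk, e1] using he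
    simp (disch := omega) [Prog.den, hkk, em1, e0]
    refine ⟨⟨by omega, fun i => ?_⟩, by omega⟩
    rcases lt_trichotomy i (n + 1 + k) with h' | rfl | h'
    · simp [hI, h', h'.ne, show i < n + 1 + (k + 1) by omega]
    · simp [show ¬ n + 1 + k < n by omega, show n + 1 + k ≠ n by omega]
    · simp [hI, h'.ne', show ¬ i < n + 1 + k by omega, show ¬ i < n + 1 + (k + 1) by omega]
  · simp [Prog.bound, Expr.cost]; omega
  · rintro s' hf ⟨hk, hI⟩ he
    have e1 : s'.reg 1 = m := by rw [hf.reg 1 rfl]; simpa using c1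
    have hlt : ¬ s'.reg 14 < m := by simpa (disch := omega) [e1] using he
    rw [show s'.reg 14 = m by omega] at hI
    exact ⟨by rw [hf.reg 10 rfl]; simpa using c10, hI⟩

/-- Tabulate the next positions without a variable in the array 24. -/
def nextLetters : Prog :=
  14 ≔ .reg 1 ;; .store 24 (.reg 1) (.reg 1) ;;
  .loop (.reg 14) (14 ≔ .reg 14 - 1 ;;
    .cond (lt (.reg 0) (.load 1 (.reg 14))) (.store 24 (.reg 14) (.load 24 (.reg 14 + 1)))
      (.store 24 (.reg 14) (.reg 14)))

theorem nextLetters_run {W n m : ℕ} {s : State} {w a : ℕ → ℕ} (h : Symbols w a n m)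
    (hW : 1000 * n + 1000 < 2 ^ W) (h0 : s.reg 0 = n) (h1 : s.reg 1 = m) (m1 : s.mem 1 = a) :
    Run W nextLetters (100 * n + 100) s fun s' =>
      ∀ i ≤ m, IsNext (fun k => n < a k) i (s'.mem 24 i) := by
  have hm := h.m_le
  refine Run.assign m (by simp [h1]) (T₂ := 100 * n + 90) ?_ (by simp [Expr.cost]; omega)
  refine Run.store m m (by simp [h1]) (by simp [h1]) (T₂ := 100 * n + 80) ?_
    (by simp [Expr.cost]; omega)
  refine Run.loop_den (fun s' => s'.reg 14 ≤ m ∧ ∀ i, s'.reg 14 ≤ i → i ≤ m →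
      IsNext (fun k => n < a k) i (s'.mem 24 i))
    (fun s' => s'.reg 14) ⟨by simp, fun i h₁ h₂ => ?_⟩ rfl ?_ ?_ ?_
  · obtain rfl : i = m := by simp at h₁; omega
    simp
    exact ⟨le_rfl, by simp [h.pat_zero _ le_rfl], fun k h₁ h₂ => by omega⟩
  · rintro s' hf ⟨hk, hI⟩ he
    have e0 : s'.reg 0 = n := by rw [hf.reg 0 rfl]; simpa using h0
    have em1 : s'.mem 1 = a := by
      rw [hf.mem 1 rfl, State.setMem_mem_ne _ _ _ _ _ (by omega)]; exact m1
    simp only [Expr.eval_reg] at he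
    obtain ⟨k, hkk⟩ : ∃ k, s'.reg 14 = k + 1 := ⟨s'.reg 14 - 1, by omega⟩
    rw [hkk] at hk hI
    by_cases hv : n < a k
    · simp (disch := omega) [Prog.den, hkk, em1, e0, hv]
      refine ⟨by omega, fun i h₁ h₂ => ?_⟩
      by_cases hik : i = k
      · subst hik
        have hn := hI (i + 1) le_rfl hk
        simp
        refine ⟨by have := hn.le; omega, hn.not_var, fun x h₃ h₄ => ?_⟩
        by_cases hx : x = i
        · rw [hx]; exact hv
        · exact hn.var x (by omega) h₄
      · simpa [hik] using hI i (by omega) h₂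
    · simp (disch := omega) [Prog.den, hkk, em1, e0, hv]
      refine ⟨by omega, fun i h₁ h₂ => ?_⟩
      by_cases hik : i = k
      · subst hik
        simp
        exact ⟨le_rfl, hv, fun x h₃ h₄ => by omega⟩
      · simpa [hik] using hI i (by omega) h₂
  · simp [Prog.bound, Expr.cost]; omega
  · rintro s' hf ⟨hk, hI⟩ he
    exact fun i hi => hI i (by simp at he; omega) hi

/-! ### One layer -/

/-- The data that do not change after the preprocessing. -/
structure Ready (w a nx : ℕ → ℕ) (n m : ℕ) (s : State) : Prop where
  symbols : Symbols w a n m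
  next : ∀ i ≤ m, IsNext (fun k => n < a k) i (nx i)
  reg_n : s.reg 0 = n
  reg_m : s.reg 1 = m
  mem_pat : s.mem 1 = a
  mem_next : s.mem 24 = nx
  tables : LceTables (joined w a n m) (n + 1 + m) s

/-- Find the start of the job for the position in the register 63. -/
def selectJob : Prog :=
  .cond (lt (.reg 64) (.load 21 (.reg 63))) (64 ≔ .load 21 (.reg 63)) .skip ;;
  .cond (eq (.reg 64 + 1) (.load 22 (.reg 63)))
    (66 ≔ .load 23 (.reg 63) ;; 67 ≔ .reg 66)
    (.store 22 (.reg 63) (.reg 64 + 1) ;; 66 ≔ .reg 64 ;; 67 ≔ eq (.reg 63) 0 + .reg 64) ;;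
  .store 23 (.reg 63) 0

/-- Extend the run of letters as far as possible. -/
def walkLetters : Prog :=
  60 ≔ .reg 63 + (.reg 66 - .reg 64) ;; 52 ≔ 0 ;;
  .cond (lt (.reg 66) (.reg 1) * lt (.reg 60) (.reg 0)) (61 ≔ .reg 0 + 1 + .reg 66 ;; queryLce) .skip ;;
  60 ≔ .reg 60 + .reg 52 ;; 66 ≔ .reg 66 + .reg 52

/-- Register the end of the run of letters. -/
def finishJob : Prog :=
  .cond (eq (.reg 66) (.reg 1)) (.cond (eq (.reg 60) (.reg 0)) (65 ≔ 1) .skip)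
    (.cond (lt (.reg 0) (.load 1 (.reg 66)))
      (67 ≔ .load 24 (.reg 66 + 1) ;;
        .cond (lt (.load 21 (.reg 60)) (.reg 67)) (.store 21 (.reg 60) (.reg 67)) .skip)
      (.cond (lt (.reg 60) (.reg 0)) (.store 23 (.reg 63) (.reg 66 + 1)) .skip))

/-- Process one position. -/
def layerStep : Prog :=
  selectJob ;; .cond (.reg 67) (walkLetters ;; finishJob) .skip ;; 63 ≔ .reg 63 + 1

/-! ### The program carries out the steps of the layer invariant. -/

section Layer
variable {w a nx : ℕ → ℕ} {n m W d p : ℕ} {s : State}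

theorem Ready.of_frame {s' : State} {q : Prog} (h : Ready w a nx n m s) (hf : Frame q s s')
    (h0 : q.wreg 0 = false) (h1 : q.wreg 1 = false) (h10 : q.wreg 10 = false)
    (h40 : q.wreg 40 = false) (h44 : q.wreg 44 = false) (m1 : q.wmem 1 = false)
    (m24 : q.wmem 24 = false) (m5 : q.wmem 5 = false)
    (m9 : q.wmem 9 = false) (m10 : q.wmem 10 = false)
    (m11 : q.wmem 11 = false) (m12 : q.wmem 12 = false) (m16 : q.wmem 16 = false)
    (m17 : q.wmem 17 = false) : Ready w a nx n m s' where
  symbols := h.symbols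
  next := h.next
  reg_n := by rw [hf.reg 0 h0, h.reg_n]
  reg_m := by rw [hf.reg 1 h1, h.reg_m]
  mem_pat := by rw [hf.mem 1 m1, h.mem_pat]
  mem_next := by rw [hf.mem 24 m24, h.mem_next]
  tables := h.tables.of_frame hf h10 h40 h44 m5 m9 m10 m11 m12 m16 m17

/-- The invariant for the current state of the machine. -/
abbrev StateInv (w a nx : ℕ → ℕ) (n m d p : ℕ) (s : State) : Prop :=
  LayerInv w a (fun k => n < a k) m n nx d p (s.mem 22) (s.mem 23) (s.mem 21) (s.reg 64) (s.reg 65)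

theorem Symbols.not_var (h : Symbols w a n m) (i : ℕ) (hi : m ≤ i) : ¬ n < a i := by
  rw [h.pat_zero i hi]; omega

/-- Register 64 passes from the top position at p - 1 to the one at p. Register 67 tells whether
there is a run to explore: an unchanged job is resumed if it was waiting, and a new one starts
unless g = 0 with p ≠ 0. -/
theorem selectJob_run (h : Ready w a nx n m s) (hW : 1000 * n + 1000 < 2 ^ W)
    (hI : StateInv w a nx n m d p s) (hp : p ≤ n) (h63 : s.reg 63 = p) :
    Run W selectJob 100 s fun s' => IsTop w a (fun k => n < a k) d p (s'.reg 64) ∧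
      s'.reg 64 ≤ m ∧
      (∀ q ≠ p, s'.mem 22 q = s.mem 22 q) ∧ s'.mem 22 p = s'.reg 64 + 1 ∧
      (∀ q ≠ p, s'.mem 23 q = s.mem 23 q) ∧ s'.mem 23 p = 0 ∧
      (s'.reg 67 = 0 ∧ (s.mem 22 p = s'.reg 64 + 1 ∧ s.mem 23 p = 0 ∨ p ≠ 0 ∧ s'.reg 64 = 0) ∨
      s'.reg 67 ≠ 0 ∧ ∃ t, s'.reg 66 = s'.reg 64 + t ∧
        Start w a (fun k => n < a k) m n nx (s.mem 21) (s.reg 65) d (s'.reg 64) p t) := by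
  have hvm := h.symbols.not_var
  have ht := hI.isTop hp hvm h.next
  have hmn := h.symbols.m_le
  have hgm : max (s.reg 64) (s.mem 21 p) ≤ m := by
    rcases ht.mem with h0 | ⟨hc, -⟩
    · omega
    · by_contra hn
      exact hvm _ (by omega) hc.var
  refine Run.seq (Q' := fun s' => s' = s.setReg 64 (s'.reg 64) ∧
      s'.reg 64 = max (s.reg 64) (s.mem 21 p)) (T₁ := 20) (T₂ := 80)
    (Run.den rfl (by simp [Prog.bound, Expr.cost]) ?_) ?_ (by omega)
  · by_cases hc : s.reg 64 < s.mem 21 p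
    · simp (disch := omega) [Prog.den, h63, hc, max_eq_right hc.le]
    · have hs : s.setReg 64 (s.reg 64) = s := by simp [State.setReg]
      simp (disch := omega) [Prog.den, h63, hc, max_eq_left (not_lt.1 hc), hs]
  rintro s₁ - ⟨h₁, h64⟩
  generalize hg : max (s.reg 64) (s.mem 21 p) = g at *
  rw [h64] at h₁
  subst h₁
  refine Run.den rfl (by simp [Prog.bound, Expr.cost]) ?_
  by_cases hc : s.mem 22 p = g + 1
  · simp (disch := omega) [Prog.den, h63, hc]
    refine ⟨ht, hgm, fun q hq h' => absurd h' hq, ?_⟩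
    by_cases hci : s.mem 23 p = 0
    · exact .inl ⟨hci, .inl hci⟩
    · exact .inr ⟨hci, hI.start_old hp hc hci⟩
  · have hle : (if p = 0 then 1 else 0) ≤ 1 := by split <;> omega
    have hc' : ¬ g + 1 = s.mem 22 p := fun h => hc h.symm
    have hact := fun h0 => hI.start_new hp ht hvm hc h0
    simp (disch := omega) [Prog.den, h63, hc, hc']
    refine ⟨ht, hgm, fun q hq h' => absurd h' hq, fun q hq h' => absurd h' hq, ?_⟩
    by_cases h0 : p = 0 ∨ 0 < g
    · right
      refine ⟨?_, hact h0⟩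
      omega
    · left
      omega

theorem walkLetters_run {E : ℕ → ℕ} {ok g t : ℕ} (h : Ready w a nx n m s)
    (hW : 1000 * n + 1000 < 2 ^ W) (h63 : s.reg 63 = p) (h64 : s.reg 64 = g)
    (h66 : s.reg 66 = g + t) (hs : Start w a (fun k => n < a k) m n nx E ok d g p t) :
    Run W walkLetters 500 s fun s' => ∃ t', s'.reg 66 = g + t' ∧ s'.reg 60 = p + t' ∧
      Start w a (fun k => n < a k) m n nx E ok d g p t' ∧
      (g + t' < m → p + t' < n → a (g + t') ≠ w (p + t')) := by
  have hm := hs.valid.le_m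
  have hn := hs.valid.le_n
  have hmn := h.symbols.m_le
  refine Run.assign (p + t) (by simp (disch := omega) [h63, h64, h66]) (T₂ := 490) ?_
    (by simp [Expr.cost])
  refine Run.assign 0 (by simp (disch := omega)) (T₂ := 480) ?_ (by simp [Expr.cost])
  have h' : Ready w a nx n m ((s.setReg 60 (p + t)).setReg 52 0) :=
    h.of_frame (q := walkLetters) (((Frame.refl _ _).setReg _ rfl).setReg _ rfl)
      rfl rfl rfl rfl rfl rfl rfl rfl rfl rfl rfl rfl rfl rfl
  refine Run.seq (T₁ := 400) (T₂ := 50) (Q' := fun s' => s'.reg 60 = p + t ∧ s'.reg 66 = g + t ∧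
    (∀ k < s'.reg 52, g + t + k < m ∧ p + t + k < n ∧ ¬ n < a (g + t + k) ∧
      a (g + t + k) = w (p + t + k)) ∧ (g + t + s'.reg 52 < m → p + t + s'.reg 52 < n →
      a (g + t + s'.reg 52) ≠ w (p + t + s'.reg 52))) ?_ ?_ (by omega)
  · by_cases hc : g + t < m ∧ p + t < n
    · refine Run.cond_true (T₁ := 350) (by
        simp (disch := omega) [h.reg_n, h.reg_m, h66, hc.1, hc.2]) ?_ (by simp [Expr.cost])
      refine Run.assign (n + 1 + (g + t)) (by simp (disch := omega) [h.reg_n, h66]) (T₂ := 300) ?_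
        (by simp [Expr.cost])
      have h'' : Ready w a nx n m
          (((s.setReg 60 (p + t)).setReg 52 0).setReg 61 (n + 1 + (g + t))) :=
        h'.of_frame (q := walkLetters) ((Frame.refl _ _).setReg _ rfl)
          rfl rfl rfl rfl rfl rfl rfl rfl rfl rfl rfl rfl rfl rfl
      refine (queryLce_run h''.tables (by omega) (i := p + t) (j := n + 1 + (g + t)) (by simp)
        (by simp) (by omega) (by omega) (by omega)).mono le_rfl ?_
      intro s' f' hl
      obtain ⟨l₁, l₂⟩ := h.symbols.lce hc.1 hc.2 hl
      exact ⟨by rw [f'.reg 60 rfl]; simp, by rw [f'.reg 66 rfl]; simpa using h66, l₁,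
        fun h₁ h₂ => l₂ h₂ h₁⟩
    · have he : (Expr.eval W ((s.setReg 60 (p + t)).setReg 52 0)
          (lt (.reg 66) (.reg 1) * lt (.reg 60) (.reg 0))) = 0 := by
        by_cases h₁ : g + t < m
        · have h₂ : ¬ p + t < n := fun h₂ => hc ⟨h₁, h₂⟩
          simp (disch := omega) [h.reg_n, h.reg_m, h66, h₁, h₂]
        · by_cases h₂ : p + t < n
          · simp (disch := omega) [h.reg_n, h.reg_m, h66, h₁, h₂]
          · simp (disch := omega) [h.reg_n, h.reg_m, h66, h₁, h₂]
      refine Run.cond_false (T₁ := 1) he (Run.den rfl (by simp [Prog.bound]) ?_)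
        (by simp [Expr.cost])
      refine ⟨by simp [Prog.den], by simpa [Prog.den] using h66, by simp [Prog.den], ?_⟩
      simp [Prog.den]
      intro h₁ h₂
      exact absurd ⟨h₁, h₂⟩ hc
  · rintro s₁ - ⟨q60, q66, q₁, q₂⟩
    generalize hl : s₁.reg 52 = l at *
    have hs' := hs.walk q₁
    have hm' := hs'.valid.le_m
    have hn' := hs'.valid.le_n
    refine Run.den rfl (by simp [Prog.bound, Expr.cost]) ⟨t + l, ?_, ?_, hs', ?_⟩
    · simp (disch := omega) [Prog.den, q60, q66, hl, add_assoc]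
    · simp (disch := omega) [Prog.den, q60, q66, hl, add_assoc]
    · simpa only [add_assoc] using q₂

theorem finishJob_run {g t : ℕ} (h : Ready w a nx n m s) {GP CI E : ℕ → ℕ} {g₀ ok : ℕ}
    (hW : 1000 * n + 1000 < 2 ^ W)
    (hI : LayerInv w a (fun k => n < a k) m n nx d p GP CI E g₀ ok)
    (h63 : s.reg 63 = p) (h64 : s.reg 64 = g)
    (h66 : s.reg 66 = g + t) (h60 : s.reg 60 = p + t) (h65 : s.reg 65 = ok) (h21 : s.mem 21 = E)
    (ht : IsTop w a (fun k => n < a k) d p g)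
    (hs : Start w a (fun k => n < a k) m n nx E ok d g p t)
    (hGP : ∀ q ≠ p, s.mem 22 q = GP q) (hGP' : s.mem 22 p = g + 1)
    (hCI : ∀ q ≠ p, s.mem 23 q = CI q) (hCI' : s.mem 23 p = 0)
    (hne : g + t < m → p + t < n → a (g + t) ≠ w (p + t)) :
    Run W finishJob 100 s fun s' => StateInv w a nx n m d (p + 1) s' := by
  have hm := hs.valid.le_m
  have hn := hs.valid.le_n
  have hmn := h.symbols.m_le
  have hvm := h.symbols.not_var
  refine Run.den rfl (by simp [finishJob, Prog.bound, Expr.cost]) ?_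
  by_cases hgm : g + t = m
  · by_cases hpn : p + t = n
    · have e : finishJob.den W s = s.setReg 65 1 := by
        simp (disch := omega) [finishJob, Prog.den, h66, h60, h.reg_n, h.reg_m, hgm, hpn]
      rw [e, StateInv]
      simp [h64, h21]
      exact hI.step_last ht hs hvm hGP hGP' hCI hCI' hgm (by simp [hpn])
    · have e : finishJob.den W s = s := by
        simp (disch := omega) [finishJob, Prog.den, h66, h60, h.reg_n, h.reg_m, hgm, hpn]
      rw [e, StateInv, h64, h65, h21]
      exact hI.step_last ht hs hvm hGP hGP' hCI hCI' hgm (by simp [hpn])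
  · by_cases hv : n < a (g + t)
    · have e : finishJob.den W s = (s.setReg 67 (nx (g + t + 1))).setMem 21 (p + t)
          (max (E (p + t)) (nx (g + t + 1))) := by
        by_cases hc : E (p + t) < nx (g + t + 1)
        · simp (disch := omega) [finishJob, Prog.den, h66, h60, h.reg_n, h.reg_m, hgm, hv,
            h.mem_pat, h.mem_next, h21, hc, max_eq_right hc.le]
        · have : (s.setReg 67 (nx (g + t + 1))).setMem 21 (p + t) (E (p + t)) =
              s.setReg 67 (nx (g + t + 1)) := by
            simp [State.setMem, State.setReg, ← h21]
          simp (disch := omega) [finishJob, Prog.den, h66, h60, h.reg_n, h.reg_m, hgm, hv,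
            h.mem_pat, h.mem_next, h21, hc, max_eq_left (not_lt.1 hc), this]
      rw [e, StateInv, State.setMem_mem_ne _ _ _ _ _ (by omega),
        State.setMem_mem_ne _ _ _ _ _ (by omega)]
      simp [h64, h65]
      refine hI.step_var ht hs h.next hGP hGP' hCI hCI' (by omega) hv fun q => ?_
      by_cases hq : q = p + t <;> simp [hq, h21]
    · by_cases hpn : p + t < n
      · have e : finishJob.den W s = s.setMem 23 p (g + t + 1) := by
          simp (disch := omega) [finishJob, Prog.den, h66, h60, h63, h.reg_n, h.reg_m, hgm, hv,
            h.mem_pat, hpn]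
        have e21 : (s.setMem 23 p (g + t + 1)).mem 21 = E := by
          rw [State.setMem_mem_ne _ _ _ _ _ (by omega), h21]
        have e22 : (s.setMem 23 p (g + t + 1)).mem 22 = s.mem 22 :=
          State.setMem_mem_ne _ _ _ _ _ (by omega)
        rw [e, StateInv, e21, e22, State.setMem_reg, h64, h65]
        refine hI.step_letter ht hs hGP hGP' (fun q hq => ?_) ?_ (by omega) hv (hne (by omega))
        · simpa [hq] using hCI q hq
        · simp [hpn]
      · have e : finishJob.den W s = s := by
          simp (disch := omega) [finishJob, Prog.den, h66, h60, h63, h.reg_n, h.reg_m, hgm, hv,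
            h.mem_pat, hpn]
        rw [e, StateInv, h64, h65, h21]
        exact hI.step_letter ht hs hGP hGP' hCI (by simp [hpn, hCI']) (by omega) hv
          (fun h' => absurd h' hpn)

theorem layerStep_run (h : Ready w a nx n m s) (hW : 1000 * n + 1000 < 2 ^ W)
    (hI : StateInv w a nx n m d p s) (hp : p ≤ n) (h63 : s.reg 63 = p) :
    Run W layerStep 800 s fun s' => s'.reg 63 = p + 1 ∧ StateInv w a nx n m d (p + 1) s' := by
  refine Run.seq (selectJob_run h hW hI hp h63) (T₂ := 700) ?_ (by omega)
  rintro s₁ f₁ ⟨ht, hgm, hGP, hGP', hCI, hCI', hjob⟩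
  have c63 : s₁.reg 63 = p := by rw [f₁.reg 63 rfl, h63]
  have c65 : s₁.reg 65 = s.reg 65 := f₁.reg 65 rfl
  have c21 : s₁.mem 21 = s.mem 21 := f₁.mem 21 rfl
  have h₁ : Ready w a nx n m s₁ := h.of_frame f₁
      rfl rfl rfl rfl rfl rfl rfl rfl rfl rfl rfl rfl rfl rfl
  refine Run.seq (Q' := fun s' => StateInv w a nx n m d (p + 1) s') (T₁ := 650) (T₂ := 50) ?_ ?_
    (by omega)
  · rcases hjob with ⟨h67, hc⟩ | ⟨h67, t, h66, hs⟩
    · refine Run.cond_false (by simpa using h67) (T₁ := 1) (Run.den rfl (by simp [Prog.bound]) ?_)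
        (by simp [Expr.cost])
      simp only [Prog.den]
      rw [StateInv, c65, c21]
      exact hI.step_idle hp ht hGP hGP' hCI hCI' hc
    · refine Run.cond_true (by simpa using h67) (T₁ := 640) ?_ (by simp [Expr.cost])
      refine Run.seq (walkLetters_run h₁ hW c63 rfl h66 hs) (T₂ := 100) ?_ (by omega)
      rintro s₂ f₂ ⟨t', q66, q60, hs', hne⟩
      have h₂ : Ready w a nx n m s₂ := h₁.of_frame f₂
        rfl rfl rfl rfl rfl rfl rfl rfl rfl rfl rfl rfl rfl rfl
      have d22 : s₂.mem 22 = s₁.mem 22 := f₂.mem 22 rfl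
      have d23 : s₂.mem 23 = s₁.mem 23 := f₂.mem 23 rfl
      refine finishJob_run h₂ hW hI (by rw [f₂.reg 63 rfl, c63]) (f₂.reg 64 rfl) q66 q60
        (by rw [f₂.reg 65 rfl, c65]) (by rw [f₂.mem 21 rfl, c21]) ht hs' ?_ ?_ ?_ ?_ hne
      · rw [d22]; exact hGP
      · rw [d22]; exact hGP'
      · rw [d23]; exact hCI
      · rw [d23]; exact hCI'
  · intro s₂ f₂ hI₂
    have d63 : s₂.reg 63 = p := by rw [f₂.reg 63 rfl, c63]
    refine Run.den rfl (by simp [Prog.bound, Expr.cost]) ?_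
    simp (disch := omega) [Prog.den, d63]
    exact hI₂

/-- Process all positions. -/
def layer : Prog :=
  63 ≔ 0 ;; 64 ≔ 0 ;; .loop (lt (.reg 63) (.reg 0 + 1)) layerStep

/-- The invariant involves only memory and the registers 64 and 65. It is required of every state
that agrees there with the start of the layer, whatever the other registers contain. -/
theorem layer_run (h : Ready w a nx n m s) (hW : 1000 * n + 1000 < 2 ^ W)
    (hI : ∀ s', s'.mem = s.mem → s'.reg 64 = 0 → s'.reg 65 = s.reg 65 →
      StateInv w a nx n m d 0 s') :
    Run W layer (1000 * n + 1000) s fun s' => StateInv w a nx n m d (n + 1) s' := by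
  refine Run.assign 0 (by simp (disch := omega)) (T₂ := 1000 * n + 990) ?_
    (by simp [Expr.cost]; omega)
  refine Run.assign 0 (by simp (disch := omega)) (T₂ := 1000 * n + 980) ?_
    (by simp [Expr.cost]; omega)
  have h₁ : Ready w a nx n m ((s.setReg 63 0).setReg 64 0) :=
    h.of_frame (q := layer) (((Frame.refl _ _).setReg _ rfl).setReg _ rfl)
      rfl rfl rfl rfl rfl rfl rfl rfl rfl rfl rfl rfl rfl rfl
  refine Run.loop (fun s' => s'.reg 63 ≤ n + 1 ∧ StateInv w a nx n m d (s'.reg 63) s')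
    (fun s' => 810 * (n + 1 - s'.reg 63)) ⟨by simp, hI _ (by simp) (by simp) (by simp)⟩ ?_
    (by simp [Expr.cost]; omega) ?_
  · rintro s' hf ⟨hp, hI'⟩ he
    have h₂ : Ready w a nx n m s' := h₁.of_frame hf
      rfl rfl rfl rfl rfl rfl rfl rfl rfl rfl rfl rfl rfl rfl
    have hlt : s'.reg 63 < n + 1 := by
      simpa (disch := omega) [h₂.reg_n] using he
    refine ⟨800, (layerStep_run h₂ hW hI' (by omega) rfl).mono le_rfl ?_⟩
    rintro s'' - ⟨h63, hI''⟩
    rw [h63]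
    exact ⟨⟨by omega, hI''⟩, by simp [Expr.cost]; omega⟩
  · rintro s' hf ⟨hp, hI'⟩ he
    have h₂ : Ready w a nx n m s' := h₁.of_frame hf
      rfl rfl rfl rfl rfl rfl rfl rfl rfl rfl rfl rfl rfl rfl
    have hlt : ¬ s'.reg 63 < n + 1 := by
      simpa (disch := omega) [h₂.reg_n] using he
    rwa [show s'.reg 63 = n + 1 by omega] at hI'

/-- Process the layers one after the other; the number of the last one is put into the
register 62. -/
def layers : Prog :=
  .loop (eq (.reg 65) 0) (layer ;; .cond (.reg 65) .skip (62 ≔ .reg 62 + 1))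

/-- After layer d the flag is set exactly if d is at least Φ: the field `found` gives one direction
and `LayerInv.complete` the other. So the loop ends after layer Φ. -/
theorem layers_run {Φ : ℕ} (h : Ready w a nx n m s) (hW : 1000 * n + 1000 < 2 ^ W)
    (hΦ : ∀ d, Reach w a (fun k => n < a k) d m n ↔ Φ ≤ d) (hΦn : Φ ≤ n)
    (h62 : s.reg 62 = 0) (h65 : s.reg 65 = 0) (m21 : s.mem 21 0 = nx 0)
    (m21' : ∀ q, 0 < q → s.mem 21 q = 0) (m22 : ∀ q, s.mem 22 q = 0) (m23 : ∀ q, s.mem 23 q = 0) :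
    Run W layers ((1000 * n + 1100) * (Φ + 1)) s fun s' => s'.reg 62 = Φ := by
  have hmn := h.symbols.m_le
  refine Run.mono (T₁ := (1000 * n + 1050) * (Φ + 1) + 4) (Run.loop (fun s' =>
      (s'.reg 65 ≠ 0 ∧ s'.reg 62 = Φ) ∨
      (s'.reg 65 = 0 ∧ s'.reg 62 ≤ Φ ∧ ∀ s'', s''.mem = s'.mem → s''.reg 64 = 0 →
        s''.reg 65 = s'.reg 65 → StateInv w a nx n m (s'.reg 62) 0 s''))
    (fun s' => if s'.reg 65 = 0 then (1000 * n + 1050) * (Φ + 1 - s'.reg 62) else 0)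
    (.inr ⟨h65, by omega, fun s'' e₁ e₂ e₃ => ?_⟩) ?_ ?_ ?_) ?_ (fun s' _ h' => h')
  · rw [h62, StateInv, e₁, e₂, e₃, h65, show s.mem 22 = fun _ => 0 from funext m22,
      show s.mem 23 = fun _ => 0 from funext m23]
    exact LayerInv.init (h.next 0 (by omega)) m21 m21'
  · rintro s₁ f₁ hI he
    have c65 : s₁.reg 65 = 0 := by
      by_contra hc
      simp (disch := omega) [hc] at he
    rcases hI with ⟨hc, -⟩ | ⟨-, hd, hI⟩
    · exact absurd c65 hc
    have h₁ : Ready w a nx n m s₁ := h.of_frame f₁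
      rfl rfl rfl rfl rfl rfl rfl rfl rfl rfl rfl rfl rfl rfl
    generalize hdd : s₁.reg 62 = d at *
    refine ⟨1000 * n + 1020, Run.seq (layer_run h₁ hW hI) (T₂ := 20) ?_ (by omega)⟩
    intro s₂ f₂ hI₂
    have d62 : s₂.reg 62 = d := by rw [f₂.reg 62 rfl, hdd]
    have hmul : (1000 * n + 1050) * (Φ + 1 - d) = (1000 * n + 1050) * (Φ - d) + (1000 * n + 1050) := by
      rw [show Φ + 1 - d = Φ - d + 1 by omega]; ring
    rw [if_pos c65, hmul]
    by_cases hok : s₂.reg 65 = 0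
    · have hlt : d < Φ := by
        by_contra hn
        exact hI₂.complete h.symbols.not_var h.symbols.m_pos ((hΦ d).2 (by omega)) hok
      refine Run.den rfl (by simp [Prog.bound, Expr.cost]) ?_
      have e : (Prog.cond (.reg 65) .skip (62 ≔ .reg 62 + 1)).den W s₂ = s₂.setReg 62 (d + 1) := by
        simp (disch := omega) [Prog.den, hok, d62]
      rw [e]
      refine ⟨.inr ⟨by simpa using hok, by simpa using hlt, fun s'' e₁ e₂ e₃ => ?_⟩, ?_⟩
      · rw [StateInv, e₁, e₂, e₃]
        simpa using hI₂.nextLayer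
      · simp [hok, Expr.cost, show Φ + 1 - (d + 1) = Φ - d by omega]
        omega
    · have hge := (hΦ d).1 (hI₂.found hok)
      refine Run.den rfl (by simp [Prog.bound, Expr.cost]) ?_
      have e : (Prog.cond (.reg 65) .skip (62 ≔ .reg 62 + 1)).den W s₂ = s₂ := by
        simp (disch := omega) [Prog.den, hok]
      rw [e]
      refine ⟨.inl ⟨hok, by omega⟩, ?_⟩
      rw [if_neg hok]
      simp [Expr.cost]
      omega
  · rw [if_pos h65, h62]
    simp [Expr.cost]
  · rintro s₁ f₁ (⟨hc, hd⟩ | ⟨hc, -, -⟩) he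
    · exact hd
    · exfalso
      simp (disch := omega) [hc] at he
  · nlinarith

end Layer

end WordRAM

/-! ## The algorithm -/

namespace WordRAM
open Suffix PatternMatching

/-- The algorithm for the distance of a regular pattern and a word. -/
def regularMatch : Prog :=
  joinWords ;; prepareLce ;; nextLetters ;; .store 21 0 (.load 24 0) ;; layers ;; 0 ≔ .reg 62

theorem regularMatch_run {W n m Φ : ℕ} {s : State} {w a : ℕ → ℕ} (h : Symbols w a n m)
    (hW₁ : 1000 * n + 1000 < 2 ^ W) (hW₂ : (4 * n + 3) * (4 * n + 3) < 2 ^ W)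
    (h0 : s.reg 0 = n) (h1 : s.reg 1 = m) (h62 : s.reg 62 = 0) (h65 : s.reg 65 = 0)
    (m0 : s.mem 0 = w) (m1 : s.mem 1 = a) (hmem : ∀ b, 2 ≤ b → ∀ i, s.mem b i = 0)
    (hΦ : ∀ d, Reach w a (fun k => n < a k) d m n ↔ Φ ≤ d) (hΦn : Φ ≤ n) :
    Run W regularMatch (2000000 * n + (1000 * n + 1100) * (Φ + 1)) s fun s' => s'.reg 0 = Φ := by
  have hm := h.m_le
  have hm' := h.m_pos
  -- The joined word has length N = n + 1 + m ≤ 2 n + 1, and its bucket sorts use 2 N + 1 buckets.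
  have hsq : (2 * (n + 1 + m) + 1) * (2 * (n + 1 + m) + 1) ≤ (4 * n + 3) * (4 * n + 3) :=
    Nat.mul_le_mul (by omega) (by omega)
  refine Run.seq (joinWords_run h hW₁ h0 h1 m0 m1 (hmem 2 le_rfl))
    (T₂ := 1600000 * n + (1000 * n + 1100) * (Φ + 1)) ?_ (by omega)
  rintro s₁ f₁ ⟨a10, a2⟩
  refine Run.seq (prepareLce_run (by omega) a10 a2 h.isWord
    (fun i => h.joined_le.trans (by omega)) (by omega) (by omega) (fun v => by
      rw [f₁.mem 18 rfl]; exact hmem 18 (by omega) v))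
    (T₂ := 400000 * n + (1000 * n + 1100) * (Φ + 1)) ?_ (by omega)
  intro s₂ f₂ hT
  have b0 : s₂.reg 0 = n := by rw [f₂.reg 0 rfl, f₁.reg 0 rfl, h0]
  have b1 : s₂.reg 1 = m := by rw [f₂.reg 1 rfl, f₁.reg 1 rfl, h1]
  have bm1 : s₂.mem 1 = a := by rw [f₂.mem 1 rfl, f₁.mem 1 rfl, m1]
  refine Run.seq (nextLetters_run h hW₁ b0 b1 bm1)
    (T₂ := 100000 * n + (1000 * n + 1100) * (Φ + 1)) ?_ (by omega)
  intro s₃ f₃ hnx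
  have c21 : s₃.mem 21 = s.mem 21 := by rw [f₃.mem 21 rfl, f₂.mem 21 rfl, f₁.mem 21 rfl]
  have c22 : s₃.mem 22 = s.mem 22 := by rw [f₃.mem 22 rfl, f₂.mem 22 rfl, f₁.mem 22 rfl]
  have c23 : s₃.mem 23 = s.mem 23 := by rw [f₃.mem 23 rfl, f₂.mem 23 rfl, f₁.mem 23 rfl]
  have hR : Ready w a (s₃.mem 24) n m s₃ := ⟨h, hnx, by rw [f₃.reg 0 rfl, b0],
    by rw [f₃.reg 1 rfl, b1], by rw [f₃.mem 1 rfl, bm1], rfl,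
    hT.of_frame f₃ rfl rfl rfl rfl rfl rfl rfl rfl rfl rfl⟩
  refine Run.store 0 (s₃.mem 24 0) (by simp (disch := omega)) (by simp (disch := omega))
    (T₂ := 90000 * n + (1000 * n + 1100) * (Φ + 1)) ?_ (by simp [Expr.cost]; omega)
  have hR' : Ready w a (s₃.mem 24) n m (s₃.setMem 21 0 (s₃.mem 24 0)) :=
    hR.of_frame (q := .store 21 0 (.load 24 0))
      ⟨fun _ _ => rfl, fun b hb => State.setMem_mem_ne _ _ _ _ _ (by simpa [Prog.wmem] using hb)⟩
      rfl rfl rfl rfl rfl rfl rfl rfl rfl rfl rfl rfl rfl rfl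
  refine Run.seq (layers_run hR' hW₁ hΦ hΦn ?_ ?_ (by simp) ?_ ?_ ?_) (T₂ := 5) ?_ (by omega)
  · rw [State.setMem_reg, f₃.reg 62 rfl, f₂.reg 62 rfl, f₁.reg 62 rfl, h62]
  · rw [State.setMem_reg, f₃.reg 65 rfl, f₂.reg 65 rfl, f₁.reg 65 rfl, h65]
  · intro q hq
    simp [hq.ne', c21, hmem 21]
  · intro q
    simp [c22, hmem 22]
  · intro q
    simp [c23, hmem 23]
  · intro s₄ _ h₄
    exact Run.den rfl (by simp [Prog.bound, Expr.cost]) (by simpa [Prog.den] using h₄)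

end WordRAM

namespace PatternMatching
open WordRAM

theorem hamming_le {A : Type} [DecidableEq A] (u v : List A) : hamming u v ≤ v.length :=
  List.countP_le_length.trans (by rw [List.length_zip]; exact min_le_right _ _)

theorem patDist_le {A X : Type} [DecidableEq A] {α : Pattern A X} {w : List A}
    (hadm : ∃ h : X → List A, Admissible α w h) : patDist α w ≤ w.length :=
  let ⟨h, hh⟩ := hadm
  (Nat.sInf_le (⟨h, hh, rfl⟩ : hamming (subst h α) w ∈ {d | ∃ h : X → List A, Admissible α w h ∧
    d = hamming (subst h α) w})).trans (hamming_le _ _)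

/-! ### The encoded instance meets the assumptions on the symbols. -/

section Input
variable {n σ : ℕ} {w : List (Fin σ)} {α : Pattern (Fin σ) (Fin n)}

theorem inputState_word {i : ℕ} (hi : i < w.length) :
    (inputState w α).mem 0 i = (w[i] : ℕ) + 1 := by
  simp [inputState, hi, encodeLetter]

theorem inputState_pattern {i : ℕ} (hi : i < α.length) :
    (inputState w α).mem 1 i = encodeSymbol α[i] := by
  simp [inputState, hi]

theorem encodeSymbol_pos (y : Fin σ ⊕ Fin n) : 0 < encodeSymbol y := by
  rcases y with y | y
  · exact Nat.succ_pos _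
  · exact Nat.add_pos_left (Nat.succ_pos _) _

theorem encodeSymbol_le (hσ : σ ≤ n) (y : Fin σ ⊕ Fin n) : encodeSymbol y ≤ 2 * n := by
  rcases y with y | y
  · have := y.isLt
    simp only [encodeSymbol, encodeLetter]; omega
  · have := y.isLt
    simp only [encodeSymbol]; omega

theorem inputState_symbols (hw : w.length = n) (hσ : σ ≤ n) (hα : α ≠ []) (hαn : α.length ≤ n) :
    Symbols ((inputState w α).mem 0) ((inputState w α).mem 1) n α.length where
  m_pos := List.length_pos_iff.2 hα
  m_le := hαn
  word_pos i hi := by rw [inputState_word (by omega)]; omega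
  word_le i hi := by
    rw [inputState_word (by omega)]
    have := (w[i]'(by omega)).isLt
    omega
  pat_pos i hi := by rw [inputState_pattern hi]; exact encodeSymbol_pos _
  pat_le i := by
    rcases Nat.lt_or_ge i α.length with hi | hi
    · rw [inputState_pattern hi]; exact encodeSymbol_le hσ _
    · simp [inputState, List.getElem?_eq_none hi]
  pat_zero i hi := by simp [inputState, List.getElem?_eq_none hi]

theorem inputState_encodes (hσ : σ ≤ n) :
    Encodes w α ((inputState w α).mem 0) ((inputState w α).mem 1)
      fun k => n < (inputState w α).mem 1 k where
  letter i hi b hb := by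
    rw [inputState_pattern hi, hb]
    have := b.isLt
    simp only [encodeSymbol, encodeLetter]
    refine ⟨by omega, fun p hp => ?_⟩
    rw [inputState_word hp, Nat.add_right_cancel_iff, Fin.val_inj]
  var i hi x hx := by
    rw [inputState_pattern hi, hx]
    simp only [encodeSymbol]
    omega

end Input

/-- Let u be 2 to the binary length of 2 n, so u > 2 n and u ≥ 4. Of the eight factors u, two
account for the quadratic bucket addresses, and the other six give the constant `4 ^ 6`, which is
more than enough. -/
theorem wordLength_large {n : ℕ} (hn : 0 < n) :
    1000 * n + 1000 < 2 ^ wordLength 8 n ∧ (4 * n + 3) * (4 * n + 3) < 2 ^ wordLength 8 n := by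
  have h₁ := Nat.lt_size_self (2 * n)
  have h₂ : 2 ≤ Nat.size (2 * n) := Nat.lt_size.2 (by omega)
  have h₃ : 2 ^ 2 ≤ 2 ^ Nat.size (2 * n) := Nat.pow_le_pow_right (by omega) h₂
  rw [wordLength, pow_mul']
  generalize 2 ^ Nat.size (2 * n) = u at *
  have h₄ : (2 ^ 2) ^ 6 ≤ u ^ 6 := Nat.pow_le_pow_left h₃ 6
  have h₅ : (2 ^ 2) ^ 6 * (u * u) ≤ u ^ 8 := by
    calc _ ≤ u ^ 6 * (u * u) := Nat.mul_le_mul_right _ h₄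
      _ = u ^ 8 := by ring
  have h₆ : 4 * u ≤ u * u := Nat.mul_le_mul_right _ (by omega)
  have h₇ : (4 * n + 3) * (4 * n + 3) ≤ (3 * u) * (3 * u) := Nat.mul_le_mul (by omega) (by omega)
  have h₈ : (3 * u) * (3 * u) = 9 * (u * u) := by ring
  constructor <;> omega

end PatternMatching

theorem mainTheorem3 :
    ∃ (P : WordRAM.Prog) (c C : ℕ), 0 < c ∧
      ∀ (n σ : ℕ) (w : List (Fin σ)) (α : PatternMatching.Pattern (Fin σ) (Fin n)),
        w.length = n → σ ≤ n → α ≠ [] → α.length ≤ n →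
        PatternMatching.IsRegular α →
        (∃ h : Fin n → List (Fin σ), PatternMatching.Admissible α w h) →
        ∃ (t : ℕ) (s : WordRAM.State),
          WordRAM.Exec (PatternMatching.wordLength c n) P (PatternMatching.inputState w α) t s ∧
          s.reg 0 = PatternMatching.patDist α w ∧
          t ≤ C * (n * max 1 (PatternMatching.patDist α w)) := by
  refine ⟨WordRAM.regularMatch, 8, 3000000, by omega, ?_⟩
  intro n σ w α hw hσ hα hαn hreg hadm
  have hn : 0 < n := (List.length_pos_iff.2 hα).trans_le hαn
  obtain ⟨hW₁, hW₂⟩ := PatternMatching.wordLength_large hn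
  have hle := PatternMatching.patDist_le hadm
  have hreach := (PatternMatching.inputState_encodes hσ).reach_iff hreg hadm
  rw [hw] at hle hreach
  obtain ⟨t, s, h₁, h₂, h₃⟩ := WordRAM.regularMatch_run
    (PatternMatching.inputState_symbols hw hσ hα hαn) hW₁ hW₂
    (by simp [PatternMatching.inputState, hw]) (by simp [PatternMatching.inputState])
    (by simp [PatternMatching.inputState]) (by simp [PatternMatching.inputState]) rfl rfl
    (fun b hb i => by
      obtain ⟨b, rfl⟩ : ∃ b', b = b' + 2 := ⟨b - 2, by omega⟩
      rfl) hreach hle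
  refine ⟨t, s, h₁, h₃, h₂.trans ?_⟩
  generalize PatternMatching.patDist α w = Φ
  have hmax : Φ + 1 ≤ 2 * max 1 Φ := by omega
  have hmax' : 1 ≤ max 1 Φ := le_max_left _ _
  generalize max 1 Φ = k at *
  -- As n ≥ 1, the additive constants are absorbed in multiples of n, and Φ + 1 is at most twice the
  -- maximum of 1 and Φ.
  calc 2000000 * n + (1000 * n + 1100) * (Φ + 1)
      ≤ 2000000 * (n * k) + 2100 * n * (2 * k) :=
        Nat.add_le_add (Nat.mul_le_mul_left _ (Nat.le_mul_of_pos_right n hmax'))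
          (Nat.mul_le_mul (by omega) hmax)
    _ = 2004200 * (n * k) := by ring
    _ ≤ 3000000 * (n * k) := Nat.mul_le_mul_right _ (by norm_num)
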